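/- **Setting.** Let $a_0,a_1,a_2,a_3>0$ be constants. A *damping law* is a function $a\in W^{3,\infty}_{loc}(\mathbb R)$ with $a(0)=0$, $a_0\le a'\le a_1$, $|a''|\le a_2$ and $|a'''|\le a_3$ (a.e.). Let $T>0$, $c\in\mathbb R$, and $g_0,g_1\in C^4([0,T])$ with $g_0(0)=g_1(0)=0$ and $g_0'(0)=g_1'(0)=0$. Consider the state system $$\partial_t p+\partial_x u=0,\qquad \partial_t u+\partial_x p+a(u)=0\qquad\text{on }(0,1)\times(0,T),$$ $$u(0,t)=g_0(t),\quad u(1,t)=g_1(t),\qquad p(x,0)=c,\quad u(x,0)=0 .$$ A *classical solution* of this or of the linear system below is a solution in $C^1([0,T];L^2(0,1)^2)\cap C([0,T];H^1(0,1)^2)$. Real numbers $\underline u<\overline u$ are called *flux bounds* if $\underline u\le u(x,t)\le\overline u$ for all $x\in[0,1]$, $t\in[0,T]$ whenever $(p,u)$ is a classical solution of the state system for some damping law. Given flux bounds, let $D(F)\subset H^2(\underline u,\overline u)$ be the set of restrictions of damping laws to $[\underline u,\overline u]$, and let $$F:D(F)\to L^2(0,T),\qquad F(a)=p(0,\cdot)-p(1,\cdot),$$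 where $(p,u)$ is the classical solution of the state system for the parameter $a$ (with $\underline u\le u\le\overline u$). **Theorem (Differentiability).** Flux bounds exist. For any flux bounds $\underline u<\overline u$, the operator $F$ is well defined, i.e. for every $a\in D(F)$ the state system has exactly one classical solution with $\underline u\le u\le\overline u$ and $p(0,\cdot)-p(1,\cdot)\in L^2(0,T)$. Moreover, $F$ is Fréchet differentiable on $D(F)$ with Lipschitz continuous derivative. That is, for every $a\in D(F)$ there is a bounded linear operator $F'(a):H^2(\underline u,\overline u)\to L^2(0,T)$ such that 1. $\|F(\tilde a)-F(a)-F'(a)(\tilde a-a)\|_{L^2(0,T)}=o(\|\tilde a-a\|_{H^2(\underline u,\overline u)})$ as $\tilde a\to a$ in $H^2(\underline u,\overline u)$ with $\tilde a\in D(F)$; 2. for every $b\in H^2(\underline u,\overline u)$, $F'(a)b=r(0,\cdot)-r(1,\cdot)$, where $(r,w)$ is the unique classical solution of the sensitivity system $$\partial_t r+\partial_x w=0,\qquad \partial_t w+\partial_x r=-a'(u)\,w-b(u)\qquad\text{on }(0,1)\times(0,T),$$ $$r(x,0)=w(x,0)=0,\qquad w(0,t)=w(1,t)=0,$$ and $u$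 is the flux of the classical solution of the state system for the parameter $a$; 3. there is a constant $L\ge0$ with $$\|F'(a)-F'(\tilde a)\|_{H^2(\underline u,\overline u)\to L^2(0,T)}\le L\,\|a-\tilde a\|_{H^2(\underline u,\overline u)}\qquad\text{for all }a,\tilde a\in D(F).$$ -/

import Mathlib

open MeasureTheory Set Filter
open scoped ENNReal ContDiff

noncomputable section

namespace DampedWave

/-- The Lebesgue space `L²(a,b)` of real functions. -/
abbrev L2 (a b : ℝ) : Type := Lp ℝ 2 (volume.restrict (Ioo a b))

/-- `g ∈ L²(a,b)` is the weak derivative of `f ∈ L²(a,b)`: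
`∫ f φ' = - ∫ g φ` for all test functions `φ ∈ C_c^∞(a,b)`. -/
def HasWeakDeriv {a b : ℝ} (f g : L2 a b) : Prop :=
  ∀ φ : ℝ → ℝ, ContDiff ℝ ∞ φ → HasCompactSupport φ → tsupport φ ⊆ Ioo a b →
    ∫ x in Ioo a b, f x * deriv φ x = - ∫ x in Ioo a b, g x * φ x

theorem integrable_mul_test {a b : ℝ} (f : L2 a b) {φ : ℝ → ℝ} (hφ : Continuous φ)
    (hc : HasCompactSupport φ) :
    Integrable (fun x => f x * φ x) (volume.restrict (Ioo a b)) := by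
  have h1 : Integrable (f : ℝ → ℝ) (volume.restrict (Ioo a b)) :=
    (Lp.memLp f).integrable (by norm_num)
  obtain ⟨C, hC⟩ := hc.exists_bound_of_continuous hφ
  exact h1.mul_bdd hφ.aestronglyMeasurable (Eventually.of_forall hC)

theorem HasWeakDeriv.add {a b : ℝ} {f g f' g' : L2 a b} (h : HasWeakDeriv f g)
    (h' : HasWeakDeriv f' g') : HasWeakDeriv (f + f') (g + g') := by
  intro φ hφ hc hs
  have hd : Continuous (deriv φ) := hφ.continuous_deriv (by simp)
  have e1 : ∫ x in Ioo a b, (f + f' : L2 a b) x * deriv φ x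
      = ∫ x in Ioo a b, (f x * deriv φ x + f' x * deriv φ x) := by
    refine integral_congr_ae ?_
    filter_upwards [Lp.coeFn_add f f'] with x hx
    rw [hx, Pi.add_apply, add_mul]
  have e2 : ∫ x in Ioo a b, (g + g' : L2 a b) x * φ x
      = ∫ x in Ioo a b, (g x * φ x + g' x * φ x) := by
    refine integral_congr_ae ?_
    filter_upwards [Lp.coeFn_add g g'] with x hx
    rw [hx, Pi.add_apply, add_mul]
  rw [e1, e2, integral_add (integrable_mul_test f hd hc.deriv) (integrable_mul_test f' hd hc.deriv),
    integral_add (integrable_mul_test g hφ.continuous hc)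
      (integrable_mul_test g' hφ.continuous hc), h φ hφ hc hs, h' φ hφ hc hs]
  ring

theorem HasWeakDeriv.smul {a b : ℝ} {f g : L2 a b} (c : ℝ) (h : HasWeakDeriv f g) :
    HasWeakDeriv (c • f) (c • g) := by
  intro φ hφ hc hs
  have e1 : ∫ x in Ioo a b, (c • f : L2 a b) x * deriv φ x
      = ∫ x in Ioo a b, c * (f x * deriv φ x) := by
    refine integral_congr_ae ?_
    filter_upwards [Lp.coeFn_smul c f] with x hx
    rw [hx, Pi.smul_apply, smul_eq_mul, mul_assoc]
  have e2 : ∫ x in Ioo a b, (c • g : L2 a b) x * φ x = ∫ x in Ioo a b, c * (g x * φ x) := by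
    refine integral_congr_ae ?_
    filter_upwards [Lp.coeFn_smul c g] with x hx
    rw [hx, Pi.smul_apply, smul_eq_mul, mul_assoc]
  rw [e1, e2, integral_const_mul, integral_const_mul, h φ hφ hc hs]
  ring

theorem HasWeakDeriv.zero {a b : ℝ} : HasWeakDeriv (0 : L2 a b) 0 := by
  intro φ _ _ _
  have e : ∀ ψ : ℝ → ℝ, ∫ x in Ioo a b, (0 : L2 a b) x * ψ x = 0 := by
    intro ψ
    refine integral_eq_zero_of_ae ?_
    filter_upwards [Lp.coeFn_zero ℝ 2 (volume.restrict (Ioo a b))] with x hx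
    rw [hx]; simp
  rw [e, e, neg_zero]

/-- The Sobolev space `H^k(a,b)`. An element is the tuple `(f, f', …, f^(k))` of an `L²` function
and its successive weak derivatives, so that the norm inherited from the `ℓ²`-product is
`‖f‖² = ‖f‖²_{L²} + ‖f'‖²_{L²} + … + ‖f^(k)‖²_{L²}`. -/
def Sobolev (k : ℕ) (a b : ℝ) : Submodule ℝ (PiLp 2 (fun _ : Fin (k + 1) => L2 a b)) where
  carrier := {f | ∀ i : Fin k, HasWeakDeriv (f i.castSucc) (f i.succ)}
  add_mem' hf hg i := (hf i).add (hg i)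
  zero_mem' _ := HasWeakDeriv.zero
  smul_mem' c _ hf i := (hf i).smul c

/-- The `j`-th weak derivative, as an element of `L²(a,b)`. -/
def der {k : ℕ} {a b : ℝ} (f : Sobolev k a b) (j : Fin (k + 1)) : L2 a b :=
  (f : PiLp 2 (fun _ : Fin (k + 1) => L2 a b)) j

/-- A smooth function supported in a compact subset of `(a,b)` with zero mean is the derivative
of a test function. -/
theorem exists_test_primitive {a b : ℝ} (hab : a < b) {k : ℝ → ℝ} (hk : ContDiff ℝ ∞ k)
    (hc : HasCompactSupport k) (hs : tsupport k ⊆ Ioo a b) (h0 : ∫ x in a..b, k x = 0) :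
    ∃ φ : ℝ → ℝ, ContDiff ℝ ∞ φ ∧ HasCompactSupport φ ∧ tsupport φ ⊆ Ioo a b ∧ deriv φ = k := by
  obtain ⟨α, β, haα, hαβ, hβb, hz⟩ : ∃ α β, a < α ∧ α ≤ β ∧ β < b ∧
      ∀ x, x ∉ Icc α β → k x = 0 := by
    rcases (tsupport k).eq_empty_or_nonempty with he | hne
    · refine ⟨(a + b) / 2, (a + b) / 2, by linarith, le_rfl, by linarith, fun x _ => ?_⟩
      exact image_eq_zero_of_notMem_tsupport (by rw [he]; exact notMem_empty x)
    · obtain ⟨α, hα⟩ := hc.isCompact.exists_isLeast hne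
      obtain ⟨β, hβ⟩ := hc.isCompact.exists_isGreatest hne
      refine ⟨α, β, (hs hα.1).1, hα.2 hβ.1, (hs hβ.1).2, fun x hx => ?_⟩
      exact image_eq_zero_of_notMem_tsupport fun hx' => hx ⟨hα.2 hx', hβ.2 hx'⟩
  have hkc : Continuous k := hk.continuous
  have hd : ∀ x, HasDerivAt (fun y => ∫ t in a..y, k t) (k x) x := fun x =>
    intervalIntegral.integral_hasDerivAt_right (hkc.intervalIntegrable _ _)
      (hkc.stronglyMeasurableAtFilter _ _) hkc.continuousAt
  have hder : deriv (fun y => ∫ t in a..y, k t) = k := funext fun x => (hd x).deriv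
  have hzero : ∀ x, x ∉ Icc α β → ∫ t in a..x, k t = 0 := by
    intro x hx
    rcases lt_or_ge x α with h | h
    · refine intervalIntegral.integral_zero_ae (Eventually.of_forall fun t ht => hz t ?_)
      intro ht'
      have := ht.2
      have h2 := ht'.1
      rcases max_cases a x with h3 | h3 <;> linarith
    · have hxβ : β < x := by
        by_contra hcon
        exact hx ⟨h, not_lt.1 hcon⟩
      have hb : ∫ t in b..x, k t = 0 := by
        refine intervalIntegral.integral_zero_ae (Eventually.of_forall fun t ht => hz t ?_)
        intro ht'
        have := ht.1
        have h2 := ht'.2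
        rcases min_cases b x with h3 | h3 <;> linarith
      rw [← intervalIntegral.integral_add_adjacent_intervals (hkc.intervalIntegrable a b)
        (hkc.intervalIntegrable b x), h0, hb, add_zero]
  have hsub : tsupport (fun y => ∫ t in a..y, k t) ⊆ Icc α β := by
    refine closure_minimal (fun x hx => ?_) isClosed_Icc
    by_contra hcon
    exact hx (hzero x hcon)
  refine ⟨fun y => ∫ t in a..y, k t, ?_, ?_, ?_, hder⟩
  · rw [contDiff_infty_iff_deriv, hder]
    exact ⟨fun x => (hd x).differentiableAt, hk⟩
  · exact HasCompactSupport.of_support_subset_isCompact isCompact_Icc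
      ((subset_tsupport _).trans hsub)
  · exact hsub.trans fun x hx => ⟨haα.trans_le hx.1, hx.2.trans_lt hβb⟩

/-- A function in `L²(a,b)` with a weak derivative in `L²(a,b)` has a representative that is
continuous on `[a,b]`. -/
theorem HasWeakDeriv.exists_continuousOn {a b : ℝ} (hab : a < b) {f g : L2 a b}
    (h : HasWeakDeriv f g) :
    ∃ v : ℝ → ℝ, ContinuousOn v (Icc a b) ∧ f =ᵐ[volume.restrict (Ioo a b)] v := by
  have hf1 : Integrable (f : ℝ → ℝ) (volume.restrict (Ioo a b)) :=
    (Lp.memLp f).integrable (by norm_num)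
  have hg1 : Integrable (g : ℝ → ℝ) (volume.restrict (Ioo a b)) :=
    (Lp.memLp g).integrable (by norm_num)
  have hgi : IntervalIntegrable (g : ℝ → ℝ) volume a b := by
    rw [intervalIntegrable_iff_integrableOn_Ioo_of_le hab.le]
    exact hg1
  set G : ℝ → ℝ := fun x => ∫ t in a..x, g t with hG
  have hGac : AbsolutelyContinuousOnInterval G a b :=
    hgi.absolutelyContinuousOnInterval_intervalIntegral (by simp)
  have hGc : ContinuousOn G (Icc a b) := by
    simpa [uIcc_of_le hab.le] using hGac.continuousOn
  have hGi : Integrable G (volume.restrict (Ioo a b)) :=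
    (hGc.integrableOn_Icc).mono_set Ioo_subset_Icc_self
  have hderG : ∀ᵐ x ∂(volume.restrict (Ioo a b)), deriv G x = g x := by
    rw [ae_restrict_iff' measurableSet_Ioo]
    filter_upwards [hgi.ae_hasDerivAt_integral] with x hx hxm
    have hxm' : x ∈ uIcc a b := by
      rw [uIcc_of_le hab.le]
      exact Ioo_subset_Icc_self hxm
    exact (hx hxm' a left_mem_uIcc).deriv
  have ibp : ∀ φ : ℝ → ℝ, ContDiff ℝ ∞ φ → HasCompactSupport φ → tsupport φ ⊆ Ioo a b →
      ∫ x in Ioo a b, G x * deriv φ x = - ∫ x in Ioo a b, g x * φ x := by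
    intro φ hφ hc hs
    have hφac : AbsolutelyContinuousOnInterval φ a b := by
      refine ContDiffOn.absolutelyContinuousOnInterval ?_
      exact (hφ.of_le (by simp)).contDiffOn
    have ha : φ a = 0 := image_eq_zero_of_notMem_tsupport fun hx => lt_irrefl _ (hs hx).1
    have hb : φ b = 0 := image_eq_zero_of_notMem_tsupport fun hx => lt_irrefl _ (hs hx).2
    have := hGac.integral_mul_deriv_eq_deriv_mul hφac
    rw [ha, hb, mul_zero, mul_zero, sub_zero, zero_sub,
      intervalIntegral.integral_of_le hab.le, intervalIntegral.integral_of_le hab.le,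
      integral_Ioc_eq_integral_Ioo, integral_Ioc_eq_integral_Ioo] at this
    rw [this]
    congr 1
    refine integral_congr_ae ?_
    filter_upwards [hderG] with x hx
    rw [hx]
  -- the difference `f - G` is orthogonal to all derivatives of test functions
  have horth : ∀ φ : ℝ → ℝ, ContDiff ℝ ∞ φ → HasCompactSupport φ → tsupport φ ⊆ Ioo a b →
      ∫ x in Ioo a b, (f x - G x) * deriv φ x = 0 := by
    intro φ hφ hc hs
    have hd : Continuous (deriv φ) := hφ.continuous_deriv (by simp)
    obtain ⟨C, hC⟩ := hc.deriv.exists_bound_of_continuous hd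
    have i2 : Integrable (fun x => G x * deriv φ x) (volume.restrict (Ioo a b)) :=
      hGi.mul_bdd hd.aestronglyMeasurable (Eventually.of_forall hC)
    simp_rw [sub_mul]
    rw [integral_sub (integrable_mul_test f hd hc.deriv) i2, h φ hφ hc hs, ibp φ hφ hc hs, sub_self]
  -- a bump function of mass one
  obtain ⟨η, hη, hηc, hηs, hη1⟩ : ∃ η : ℝ → ℝ, ContDiff ℝ ∞ η ∧ HasCompactSupport η ∧
      tsupport η ⊆ Ioo a b ∧ ∫ x in a..b, η x = 1 := by
    let F : ContDiffBump ((a + b) / 2) :=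
      ⟨(b - a) / 8, (b - a) / 4, by linarith, by linarith⟩
    have hsub : tsupport (F.normed volume) ⊆ Ioo a b := by
      rw [F.tsupport_normed_eq, Real.closedBall_eq_Icc]
      intro x hx
      have h1 : (a + b) / 2 - (b - a) / 4 ≤ x := hx.1
      have h2 : x ≤ (a + b) / 2 + (b - a) / 4 := hx.2
      exact ⟨by linarith, by linarith⟩
    refine ⟨F.normed volume, F.contDiff_normed (n := ⊤), F.hasCompactSupport_normed, hsub, ?_⟩
    rw [intervalIntegral.integral_of_le hab.le, setIntegral_eq_integral_of_forall_compl_eq_zero,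
      F.integral_normed]
    intro x hx
    refine image_eq_zero_of_notMem_tsupport fun hx' => hx ?_
    exact ⟨(hsub hx').1, (hsub hx').2.le⟩
  set c : ℝ := ∫ x in Ioo a b, (f x - G x) * η x with hcdef
  have hfG : Integrable (fun x => f x - G x) (volume.restrict (Ioo a b)) := hf1.sub hGi
  have hint : ∀ ψ : ℝ → ℝ, Continuous ψ → HasCompactSupport ψ →
      Integrable (fun x => (f x - G x) * ψ x) (volume.restrict (Ioo a b)) := by
    intro ψ hψ hc
    obtain ⟨C, hC⟩ := hc.exists_bound_of_continuous hψ
    exact hfG.mul_bdd hψ.aestronglyMeasurable (Eventually.of_forall hC)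
  have hloc : LocallyIntegrableOn (fun x => f x - G x - c) (Ioo a b) volume := by
    have : IntegrableOn (fun x => f x - G x - c) (Ioo a b) volume :=
      hfG.sub (integrable_const c)
    exact this.locallyIntegrableOn
  have key := isOpen_Ioo.ae_eq_zero_of_integral_contDiff_smul_eq_zero hloc (by
    intro ψ hψ hψc hψs
    have hψi : ∫ x, ψ x • (f x - G x - c) = ∫ x in Ioo a b, ψ x • (f x - G x - c) := by
      rw [setIntegral_eq_integral_of_forall_compl_eq_zero]
      intro x hx
      rw [image_eq_zero_of_notMem_tsupport fun hx' => hx (hψs hx'), zero_smul]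
    set I : ℝ := ∫ x in a..b, ψ x with hI
    have hII : ∫ x in Ioo a b, ψ x = I := by
      rw [hI, intervalIntegral.integral_of_le hab.le, integral_Ioc_eq_integral_Ioo]
    have hkc : HasCompactSupport (fun x => ψ x - I * η x) := hψc.sub hηc.mul_left
    have hks : tsupport (fun x => ψ x - I * η x) ⊆ Ioo a b := by
      refine (tsupport_sub ψ (fun x => I * η x)).trans (union_subset hψs ?_)
      exact (tsupport_mul_subset_right (f := fun _ => I) (g := η)).trans hηs
    obtain ⟨φ, hφ, hφc, hφs, hφd⟩ := exists_test_primitive hab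
      (k := fun x => ψ x - I * η x) (hψ.sub (contDiff_const.mul hη)) hkc hks (by
        have hηi : IntervalIntegrable (fun x => I * η x) volume a b :=
          (continuous_const.mul hη.continuous).intervalIntegrable _ _
        rw [intervalIntegral.integral_sub (hψ.continuous.intervalIntegrable _ _) hηi,
          intervalIntegral.integral_const_mul, hη1, mul_one, sub_self])
    have h1 := horth φ hφ hφc hφs
    rw [hφd] at h1
    have h2 : ∫ x in Ioo a b, (f x - G x) * (ψ x - I * η x)
        = (∫ x in Ioo a b, (f x - G x) * ψ x) - I * c := by
      rw [hcdef, ← integral_const_mul, ← integral_sub (hint ψ hψ.continuous hψc)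
        ((hint η hη.continuous hηc).const_mul I)]
      refine integral_congr_ae (Eventually.of_forall fun x => ?_)
      simp only
      ring
    have hψint : Integrable ψ (volume.restrict (Ioo a b)) :=
      (hψ.continuous.integrable_of_hasCompactSupport hψc).restrict
    have h3 : ∫ x in Ioo a b, ψ x • (f x - G x - c)
        = (∫ x in Ioo a b, (f x - G x) * ψ x) - c * I := by
      rw [← hII, ← integral_const_mul, ← integral_sub (hint ψ hψ.continuous hψc)
        (hψint.const_mul c)]
      refine integral_congr_ae (Eventually.of_forall fun x => ?_)
      simp only [smul_eq_mul]
      ring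
    rw [hψi, h3]
    linarith)
  refine ⟨fun x => G x + c, hGc.add continuousOn_const, ?_⟩
  rw [Filter.EventuallyEq, ae_restrict_iff' measurableSet_Ioo]
  filter_upwards [key] with x hx hxm
  linarith [hx hxm]

open Classical in
/-- The values of the continuous representative on `[a,b]` of `f ∈ L²(a,b)`.
It exists whenever `f` has a weak derivative in `L²(a,b)` and `a < b`, in particular for functions
in `H¹(a,b)` and for functions in `H²(a,b)` and their first derivatives, the only cases in which it
is used; only its values at points of `[a,b]` matter. -/
def contRep {a b : ℝ} (f : L2 a b) : ℝ → ℝ :=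
  if h : ∃ v : ℝ → ℝ, ContinuousOn v (Icc a b) ∧ f =ᵐ[volume.restrict (Ioo a b)] v
  then h.choose else 0

theorem contRep_spec {k : ℕ} {a b : ℝ} (hab : a < b) (f : Sobolev k a b) (i : Fin k) :
    ContinuousOn (contRep (der f i.castSucc)) (Icc a b) ∧
      der f i.castSucc =ᵐ[volume.restrict (Ioo a b)] contRep (der f i.castSucc) := by
  have h : ∃ v : ℝ → ℝ, ContinuousOn v (Icc a b) ∧
      der f i.castSucc =ᵐ[volume.restrict (Ioo a b)] v := (f.2 i).exists_continuousOn hab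
  rw [contRep, dif_pos h]
  exact h.choose_spec

/-- Pointwise values of `f ∈ H^k(a,b)`, `k ≥ 1`, on `[a,b]`; at the end points, its traces. -/
def val {k : ℕ} {a b : ℝ} (f : Sobolev k a b) : ℝ → ℝ := contRep (der f 0)

/-- Pointwise values on `[a,b]` of the first derivative `f'` of `f ∈ H²(a,b)`. -/
def derivVal {a b : ℝ} (f : Sobolev 2 a b) : ℝ → ℝ := contRep (der f 1)

/-- `(p,u)` is a classical solution on `[0,T]`, that is, it lies in
`C¹([0,T]; L²(0,1) × L²(0,1)) ∩ C([0,T]; H¹(0,1) × H¹(0,1))`, of the wave system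
`∂ₜp + ∂ₓu = 0`, `∂ₜu + ∂ₓp = f` on `(0,1) × (0,T)`, with `u(0,t) = g₀(t)`, `u(1,t) = g₁(t)`
and `p(x,0) = p₀(x)`, `u(x,0) = u₀(x)`. The first argument of `f` is the time. -/
structure IsClassicalSolution (T : ℝ) (f : ℝ → ℝ → ℝ) (g₀ g₁ p₀ u₀ : ℝ → ℝ)
    (p u : ℝ → Sobolev 1 0 1) : Prop where
  contDiffOn_p : ContDiffOn ℝ 1 (fun t => der (p t) 0) (Icc 0 T)
  contDiffOn_u : ContDiffOn ℝ 1 (fun t => der (u t) 0) (Icc 0 T)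
  continuousOn_p : ContinuousOn p (Icc 0 T)
  continuousOn_u : ContinuousOn u (Icc 0 T)
  mass : ∀ t ∈ Icc 0 T,
    derivWithin (fun s => der (p s) 0) (Icc 0 T) t + der (u t) 1 = 0
  momentum : ∀ t ∈ Icc 0 T, ∀ᵐ x ∂(volume.restrict (Ioo (0 : ℝ) 1)),
    derivWithin (fun s => der (u s) 0) (Icc 0 T) t x + der (p t) 1 x = f t x
  boundary_left : ∀ t ∈ Icc 0 T, val (u t) 0 = g₀ t
  boundary_right : ∀ t ∈ Icc 0 T, val (u t) 1 = g₁ t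
  initial_p : ∀ x ∈ Ioo (0 : ℝ) 1, val (p 0) x = p₀ x
  initial_u : ∀ x ∈ Ioo (0 : ℝ) 1, val (u 0) x = u₀ x

/-- The data of the experiment: time horizon `T`, boundary fluxes `g₀, g₁`, and the constant
initial pressure `c` (the initial flux is zero). -/
structure Data where
  T : ℝ
  c : ℝ
  g₀ : ℝ → ℝ
  g₁ : ℝ → ℝ
  T_pos : 0 < T
  contDiffOn_g₀ : ContDiffOn ℝ 4 g₀ (Icc 0 T)
  contDiffOn_g₁ : ContDiffOn ℝ 4 g₁ (Icc 0 T)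
  g₀_zero : g₀ 0 = 0
  g₁_zero : g₁ 0 = 0
  deriv_g₀_zero : derivWithin g₀ (Icc 0 T) 0 = 0
  deriv_g₁_zero : derivWithin g₁ (Icc 0 T) 0 = 0

/-- The positive constants in the bounds for the damping law. -/
structure Bounds where
  a₀ : ℝ
  a₁ : ℝ
  a₂ : ℝ
  a₃ : ℝ
  a₀_pos : 0 < a₀
  a₁_pos : 0 < a₁
  a₂_pos : 0 < a₂
  a₃_pos : 0 < a₃

/-- `α ∈ W^{3,∞}_loc(ℝ)` (that is, `α` is twice continuously differentiable with locally Lipschitz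
second derivative), `α(0) = 0`, `a₀ ≤ α' ≤ a₁`, `|α''| ≤ a₂`, and `|α'''| ≤ a₃` almost
everywhere. -/
structure IsDampingLaw (K : Bounds) (α : ℝ → ℝ) : Prop where
  contDiff : ContDiff ℝ 2 α
  locallyLipschitz : LocallyLipschitz (iteratedDeriv 2 α)
  zero : α 0 = 0
  le_deriv : ∀ ξ, K.a₀ ≤ deriv α ξ
  deriv_le : ∀ ξ, deriv α ξ ≤ K.a₁
  abs_deriv2_le : ∀ ξ, |iteratedDeriv 2 α ξ| ≤ K.a₂
  abs_deriv3_le : ∀ᵐ ξ : ℝ, |iteratedDeriv 3 α ξ| ≤ K.a₃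

/-- `(p,u)` is a classical solution of the state system `∂ₜp + ∂ₓu = 0`, `∂ₜu + ∂ₓp + α(u) = 0`,
`u(0,·) = g₀`, `u(1,·) = g₁`, `p(·,0) = c`, `u(·,0) = 0`. -/
def IsState (d : Data) (α : ℝ → ℝ) (p u : ℝ → Sobolev 1 0 1) : Prop :=
  IsClassicalSolution d.T (fun t x => - α (val (u t) x)) d.g₀ d.g₁ (fun _ => d.c) (fun _ => 0) p u

/-- `m ≤ u(x,t) ≤ M` for `x ∈ [0,1]`, `t ∈ [0,T]`. -/
def TakesValuesIn (d : Data) (m M : ℝ) (u : ℝ → Sobolev 1 0 1) : Prop :=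
  ∀ t ∈ Icc 0 d.T, ∀ x ∈ Icc (0 : ℝ) 1, val (u t) x ∈ Icc m M

/-- `m` and `M` are lower and upper bounds for the flux `u`, independent of the choice of the
damping law. -/
def AreFluxBounds (d : Data) (K : Bounds) (m M : ℝ) : Prop :=
  ∀ α, IsDampingLaw K α → ∀ p u, IsState d α p u → TakesValuesIn d m M u

/-- The domain `D(F) ⊆ H²(m,M)`: restrictions to `[m,M]` of damping laws. -/
def domF (K : Bounds) (m M : ℝ) : Set (Sobolev 2 m M) :=
  {a | ∃ α, IsDampingLaw K α ∧ ∀ ξ ∈ Icc m M, val a ξ = α ξ}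

/-- `(p,u)` is the solution of the state system for the parameter `a ∈ H²(m,M)`; as `a` is only
given on `[m,M]`, the flux has to take its values there. -/
def IsStateFor (d : Data) {m M : ℝ} (a : Sobolev 2 m M) (p u : ℝ → Sobolev 1 0 1) : Prop :=
  IsState d (val a) p u ∧ TakesValuesIn d m M u

/-- `(r,w)` is a classical solution of the linear sensitivity system at the parameter `a`, with
flux `u`, in the direction `b`: `∂ₜr + ∂ₓw = 0`, `∂ₜw + ∂ₓr = -a'(u) w - b(u)` with homogeneous
initial and boundary values `r(x,0) = w(x,0) = w(0,t) = w(1,t) = 0`. -/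
def IsSensitivity (d : Data) {m M : ℝ} (a b : Sobolev 2 m M) (u r w : ℝ → Sobolev 1 0 1) : Prop :=
  IsClassicalSolution d.T
    (fun t x => - derivVal a (val (u t) x) * val (w t) x - val b (val (u t) x))
    (fun _ => 0) (fun _ => 0) (fun _ => 0) (fun _ => 0) r w

/-- `h ∈ L²(0,T)` is the pressure drop `p(0,·) - p(1,·)`. -/
def IsPressureDrop {T : ℝ} (p : ℝ → Sobolev 1 0 1) (h : L2 0 T) : Prop :=
  h =ᵐ[volume.restrict (Ioo 0 T)] fun t => val (p t) 0 - val (p t) 1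

open Classical in
/-- The forward operator `F`, which maps a parameter `a` to the pressure drop `p(0,·) - p(1,·)`
of the solution `(p,u)` of the state system for `a`. -/
def forwardOp (d : Data) (m M : ℝ) (a : Sobolev 2 m M) : L2 0 d.T :=
  if h : ∃ y : L2 0 d.T, ∃ p u, IsStateFor d a p u ∧ IsPressureDrop p y then h.choose else 0

end DampedWave

end

open DampedWave

open MeasureTheory Set Filter Topology
open scoped ENNReal ContDiff RealInnerProductSpace

noncomputable section

namespace DampedWave

/-! ### Weak derivatives and absolutely continuous representatives -/

theorem L2.integrable {a b : ℝ} (f : L2 a b) : Integrable f (volume.restrict (Ioo a b)) :=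
  (Lp.memLp f).integrable (by norm_num)

theorem L2.intervalIntegrable {a b : ℝ} (hab : a ≤ b) (f : L2 a b) :
    IntervalIntegrable f volume a b := by
  rw [intervalIntegrable_iff_integrableOn_Ioo_of_le hab]
  exact L2.integrable f

theorem intervalIntegral_eq_Ioo {a b : ℝ} (hab : a ≤ b) (f : ℝ → ℝ) :
    ∫ x in a..b, f x = ∫ x in Ioo a b, f x := by
  rw [intervalIntegral.integral_of_le hab, integral_Ioc_eq_integral_Ioo]

theorem L2.inner_eq {a b : ℝ} (f g : L2 a b) : ⟪f, g⟫ = ∫ x in Ioo a b, f x * g x := by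
  rw [MeasureTheory.L2.inner_def]
  refine integral_congr_ae (Eventually.of_forall fun x => ?_)
  simp [mul_comm]

theorem absolutelyContinuous_primitive {a b : ℝ} (hab : a ≤ b) (c : ℝ) (g : L2 a b) :
    AbsolutelyContinuousOnInterval (fun x => c + ∫ t in a..x, g t) a b :=
  (ContDiffOn.absolutelyContinuousOnInterval contDiffOn_const).fun_add
    ((L2.intervalIntegrable hab g).absolutelyContinuousOnInterval_intervalIntegral (by simp))

theorem ae_deriv_primitive {a b : ℝ} (hab : a ≤ b) (c : ℝ) (g : L2 a b) :
    ∀ᵐ x ∂(volume.restrict (Ioo a b)), deriv (fun x => c + ∫ t in a..x, g t) x = g x := by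
  rw [ae_restrict_iff' measurableSet_Ioo]
  filter_upwards [(L2.intervalIntegrable hab g).ae_hasDerivAt_integral] with x hx hxm
  have hxm' : x ∈ uIcc a b := by
    rw [uIcc_of_le hab]
    exact Ioo_subset_Icc_self hxm
  exact ((hx hxm' a left_mem_uIcc).const_add c).deriv

theorem continuousOn_primitive_L2 {a b : ℝ} (hab : a ≤ b) (c : ℝ) (g : L2 a b) :
    ContinuousOn (fun x => c + ∫ t in a..x, g t) (Icc a b) := by
  simpa [uIcc_of_le hab] using (absolutelyContinuous_primitive hab c g).continuousOn

theorem hasWeakDeriv_of_primitive {a b : ℝ} (hab : a < b) {f g : L2 a b} {c : ℝ}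
    (h : f =ᵐ[volume.restrict (Ioo a b)] fun x => c + ∫ t in a..x, g t) : HasWeakDeriv f g := by
  intro φ hφ hc hs
  have hφac : AbsolutelyContinuousOnInterval φ a b :=
    ContDiffOn.absolutelyContinuousOnInterval (hφ.of_le (by simp)).contDiffOn
  have ha : φ a = 0 := image_eq_zero_of_notMem_tsupport fun hx => lt_irrefl _ (hs hx).1
  have hb : φ b = 0 := image_eq_zero_of_notMem_tsupport fun hx => lt_irrefl _ (hs hx).2
  have := (absolutelyContinuous_primitive hab.le c g).integral_mul_deriv_eq_deriv_mul hφac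
  rw [ha, hb, mul_zero, mul_zero, sub_zero, zero_sub, intervalIntegral_eq_Ioo hab.le,
    intervalIntegral_eq_Ioo hab.le] at this
  have e : ∫ x in Ioo a b, f x * deriv φ x
      = ∫ x in Ioo a b, (c + ∫ t in a..x, g t) * deriv φ x :=
    integral_congr_ae (h.mono fun x hx => by simp only [hx])
  rw [e, this]
  congr 1
  refine integral_congr_ae ?_
  filter_upwards [ae_deriv_primitive hab.le c g] with x hx
  rw [hx]

theorem HasWeakDeriv.unique {a b : ℝ} {f g g' : L2 a b} (h : HasWeakDeriv f g)
    (h' : HasWeakDeriv f g') : g = g' := by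
  have hi : Integrable (fun x => g x - g' x) (volume.restrict (Ioo a b)) :=
    (L2.integrable g).sub (L2.integrable g')
  have key := isOpen_Ioo.ae_eq_zero_of_integral_contDiff_smul_eq_zero (U := Ioo a b)
    (f := fun x => g x - g' x) (μ := volume)
    (show IntegrableOn _ _ _ from hi).locallyIntegrableOn (by
      intro φ hφ hc hs
      have e : ∫ x, φ x • (g x - g' x) = ∫ x in Ioo a b, φ x • (g x - g' x) := by
        rw [setIntegral_eq_integral_of_forall_compl_eq_zero]
        intro x hx
        rw [image_eq_zero_of_notMem_tsupport fun hx' => hx (hs hx'), zero_smul]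
      have e2 : ∫ x in Ioo a b, φ x • (g x - g' x)
          = (∫ x in Ioo a b, g x * φ x) - ∫ x in Ioo a b, g' x * φ x := by
        rw [← integral_sub (integrable_mul_test g hφ.continuous hc)
          (integrable_mul_test g' hφ.continuous hc)]
        refine integral_congr_ae (Eventually.of_forall fun x => ?_)
        simp only [smul_eq_mul]
        ring
      have h1 := h φ hφ hc hs
      have h2 := h' φ hφ hc hs
      rw [e, e2]
      linarith)
  refine Lp.ext ?_
  rw [Filter.EventuallyEq, ae_restrict_iff' measurableSet_Ioo]
  filter_upwards [key] with x hx hxm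
  linarith [hx hxm]

theorem ae_eq_const_of_hasWeakDeriv_zero {a b : ℝ} (hab : a < b) {f : L2 a b}
    (h : HasWeakDeriv f 0) : ∃ c : ℝ, f =ᵐ[volume.restrict (Ioo a b)] fun _ => c := by
  have horth : ∀ φ : ℝ → ℝ, ContDiff ℝ ∞ φ → HasCompactSupport φ → tsupport φ ⊆ Ioo a b →
      ∫ x in Ioo a b, f x * deriv φ x = 0 := by
    intro φ hφ hc hs
    rw [h φ hφ hc hs, neg_eq_zero]
    refine integral_eq_zero_of_ae ?_
    filter_upwards [Lp.coeFn_zero ℝ 2 (volume.restrict (Ioo a b))] with x hx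
    rw [hx]; simp
  obtain ⟨η, hη, hηc, hηs, hη1⟩ : ∃ η : ℝ → ℝ, ContDiff ℝ ∞ η ∧ HasCompactSupport η ∧
      tsupport η ⊆ Ioo a b ∧ ∫ x in a..b, η x = 1 := by
    let F : ContDiffBump ((a + b) / 2) :=
      ⟨(b - a) / 8, (b - a) / 4, by linarith, by linarith⟩
    have hsub : tsupport (F.normed volume) ⊆ Ioo a b := by
      rw [F.tsupport_normed_eq, Real.closedBall_eq_Icc]
      intro x hx
      have h1 : (a + b) / 2 - (b - a) / 4 ≤ x := hx.1
      have h2 : x ≤ (a + b) / 2 + (b - a) / 4 := hx.2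
      exact ⟨by linarith, by linarith⟩
    refine ⟨F.normed volume, F.contDiff_normed (n := ⊤), F.hasCompactSupport_normed, hsub, ?_⟩
    rw [intervalIntegral.integral_of_le hab.le, setIntegral_eq_integral_of_forall_compl_eq_zero,
      F.integral_normed]
    intro x hx
    refine image_eq_zero_of_notMem_tsupport fun hx' => hx ?_
    exact ⟨(hsub hx').1, (hsub hx').2.le⟩
  set c : ℝ := ∫ x in Ioo a b, f x * η x with hcdef
  have hloc : IntegrableOn (fun x => f x - c) (Ioo a b) volume :=
    (L2.integrable f).sub (integrable_const c)
  have key := isOpen_Ioo.ae_eq_zero_of_integral_contDiff_smul_eq_zero hloc.locallyIntegrableOn (by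
    intro ψ hψ hψc hψs
    have hψi : ∫ x, ψ x • (f x - c) = ∫ x in Ioo a b, ψ x • (f x - c) := by
      rw [setIntegral_eq_integral_of_forall_compl_eq_zero]
      intro x hx
      rw [image_eq_zero_of_notMem_tsupport fun hx' => hx (hψs hx'), zero_smul]
    set I : ℝ := ∫ x in a..b, ψ x with hI
    have hII : ∫ x in Ioo a b, ψ x = I := by rw [hI, intervalIntegral_eq_Ioo hab.le]
    have hkc : HasCompactSupport (fun x => ψ x - I * η x) := hψc.sub hηc.mul_left
    have hks : tsupport (fun x => ψ x - I * η x) ⊆ Ioo a b := by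
      refine (tsupport_sub ψ (fun x => I * η x)).trans (union_subset hψs ?_)
      exact (tsupport_mul_subset_right (f := fun _ => I) (g := η)).trans hηs
    obtain ⟨φ, hφ, hφc, hφs, hφd⟩ := exists_test_primitive hab
      (k := fun x => ψ x - I * η x) (hψ.sub (contDiff_const.mul hη)) hkc hks (by
        have hηi : IntervalIntegrable (fun x => I * η x) volume a b :=
          (continuous_const.mul hη.continuous).intervalIntegrable _ _
        rw [intervalIntegral.integral_sub (hψ.continuous.intervalIntegrable _ _) hηi,
          intervalIntegral.integral_const_mul, hη1, mul_one, sub_self])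
    have h1 := horth φ hφ hφc hφs
    rw [hφd] at h1
    have h2 : ∫ x in Ioo a b, f x * (ψ x - I * η x)
        = (∫ x in Ioo a b, f x * ψ x) - I * c := by
      rw [hcdef, ← integral_const_mul, ← integral_sub (integrable_mul_test f hψ.continuous hψc)
        ((integrable_mul_test f hη.continuous hηc).const_mul I)]
      refine integral_congr_ae (Eventually.of_forall fun x => ?_)
      simp only
      ring
    have hψint : Integrable ψ (volume.restrict (Ioo a b)) :=
      (hψ.continuous.integrable_of_hasCompactSupport hψc).restrict
    have h3 : ∫ x in Ioo a b, ψ x • (f x - c)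
        = (∫ x in Ioo a b, f x * ψ x) - c * I := by
      rw [← hII, ← integral_const_mul, ← integral_sub (integrable_mul_test f hψ.continuous hψc)
        (hψint.const_mul c)]
      refine integral_congr_ae (Eventually.of_forall fun x => ?_)
      simp only [smul_eq_mul]
      ring
    rw [hψi, h3]
    linarith)
  refine ⟨c, ?_⟩
  rw [Filter.EventuallyEq, ae_restrict_iff' measurableSet_Ioo]
  filter_upwards [key] with x hx hxm
  linarith [hx hxm]

theorem memLp_of_continuousOn {a b : ℝ} {v : ℝ → ℝ} (hv : ContinuousOn v (Icc a b)) :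
    MemLp v 2 (volume.restrict (Ioo a b)) := by
  obtain ⟨C, hC⟩ := isCompact_Icc.exists_bound_of_continuousOn hv
  refine MemLp.of_bound ((hv.mono Ioo_subset_Icc_self).aestronglyMeasurable measurableSet_Ioo) C ?_
  filter_upwards [ae_restrict_mem measurableSet_Ioo] with x hx
  exact hC x (Ioo_subset_Icc_self hx)

theorem HasWeakDeriv.exists_primitive {a b : ℝ} (hab : a < b) {f g : L2 a b}
    (h : HasWeakDeriv f g) :
    ∃ c : ℝ, f =ᵐ[volume.restrict (Ioo a b)] fun x => c + ∫ t in a..x, g t := by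
  set G : L2 a b := (memLp_of_continuousOn (continuousOn_primitive_L2 hab.le 0 g)).toLp _
  have hG : G =ᵐ[volume.restrict (Ioo a b)] fun x => 0 + ∫ t in a..x, g t := MemLp.coeFn_toLp _
  have h0 : HasWeakDeriv (f + (-1 : ℝ) • G) 0 := by
    have := h.add ((hasWeakDeriv_of_primitive hab hG).smul (-1))
    simpa using this
  obtain ⟨c, hc⟩ := ae_eq_const_of_hasWeakDeriv_zero hab h0
  refine ⟨c, ?_⟩
  filter_upwards [hc, hG, Lp.coeFn_add f ((-1 : ℝ) • G), Lp.coeFn_smul (-1 : ℝ) G]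
    with x h1 h2 h3 h4
  rw [h3, Pi.add_apply, h4, Pi.smul_apply, h2, smul_eq_mul] at h1
  linarith

theorem eqOn_Icc_of_ae_Ioo {a b : ℝ} (hab : a < b) {v w : ℝ → ℝ} (hv : ContinuousOn v (Icc a b))
    (hw : ContinuousOn w (Icc a b)) (h : v =ᵐ[volume.restrict (Ioo a b)] w) :
    EqOn v w (Icc a b) := by
  refine Measure.eqOn_Icc_of_ae_eq volume hab.ne ?_ hv hw
  rwa [← restrict_Ioo_eq_restrict_Icc]

theorem contRep_eqOn {a b : ℝ} (hab : a < b) {f : L2 a b} {v : ℝ → ℝ}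
    (hv : ContinuousOn v (Icc a b)) (h : f =ᵐ[volume.restrict (Ioo a b)] v) :
    EqOn (contRep f) v (Icc a b) := by
  have hex : ∃ v : ℝ → ℝ, ContinuousOn v (Icc a b) ∧ f =ᵐ[volume.restrict (Ioo a b)] v := ⟨v, hv, h⟩
  rw [contRep, dif_pos hex]
  exact eqOn_Icc_of_ae_Ioo hab hex.choose_spec.1 hv (hex.choose_spec.2.symm.trans h)

theorem HasWeakDeriv.continuousOn_contRep {a b : ℝ} (hab : a < b) {f g : L2 a b}
    (h : HasWeakDeriv f g) : ContinuousOn (contRep f) (Icc a b) := by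
  have := h.exists_continuousOn hab
  rw [contRep, dif_pos this]
  exact this.choose_spec.1

theorem HasWeakDeriv.ae_eq_contRep {a b : ℝ} (hab : a < b) {f g : L2 a b}
    (h : HasWeakDeriv f g) : f =ᵐ[volume.restrict (Ioo a b)] contRep f := by
  have := h.exists_continuousOn hab
  rw [contRep, dif_pos this]
  exact this.choose_spec.2

theorem HasWeakDeriv.exists_eqOn_primitive {a b : ℝ} (hab : a < b) {f g : L2 a b}
    (h : HasWeakDeriv f g) :
    ∃ c : ℝ, EqOn (contRep f) (fun x => c + ∫ t in a..x, g t) (Icc a b) := by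
  obtain ⟨c, hc⟩ := h.exists_primitive hab
  exact ⟨c, contRep_eqOn hab (continuousOn_primitive_L2 hab.le c g) hc⟩

theorem HasWeakDeriv.contRep_sub {a b : ℝ} (hab : a < b) {f g : L2 a b} (h : HasWeakDeriv f g)
    {x y : ℝ} (hx : x ∈ Icc a b) (hy : y ∈ Icc a b) :
    contRep f y - contRep f x = ∫ t in x..y, g t := by
  obtain ⟨c, hc⟩ := h.exists_eqOn_primitive hab
  have hi := L2.intervalIntegrable hab.le g
  have sub : ∀ z ∈ Icc a b, IntervalIntegrable g volume a z := fun z hz =>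
    hi.mono_set (by rw [uIcc_of_le hz.1, uIcc_of_le hab.le]; exact Icc_subset_Icc_right hz.2)
  rw [hc hx, hc hy, ← intervalIntegral.integral_interval_sub_left (sub y hy) (sub x hx)]
  ring

theorem HasWeakDeriv.inner_add_inner {a b : ℝ} (hab : a < b) {f f' g g' : L2 a b}
    (hf : HasWeakDeriv f f') (hg : HasWeakDeriv g g') :
    ⟪f', g⟫ + ⟪f, g'⟫ = contRep f b * contRep g b - contRep f a * contRep g a := by
  obtain ⟨c, hc⟩ := hf.exists_eqOn_primitive hab
  obtain ⟨k, hk⟩ := hg.exists_eqOn_primitive hab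
  have h := (absolutelyContinuous_primitive hab.le c f').integral_mul_deriv_eq_deriv_mul
    (absolutelyContinuous_primitive hab.le k g')
  rw [hc (left_mem_Icc.2 hab.le), hc (right_mem_Icc.2 hab.le), hk (left_mem_Icc.2 hab.le),
    hk (right_mem_Icc.2 hab.le), L2.inner_eq, L2.inner_eq]
  have e1 : ∫ x in Ioo a b, f' x * g x
      = ∫ x in Ioo a b, deriv (fun x => c + ∫ t in a..x, f' t) x * (k + ∫ t in a..x, g' t) := by
    refine integral_congr_ae ?_
    filter_upwards [ae_deriv_primitive hab.le c f', hg.ae_eq_contRep hab,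
      ae_restrict_mem measurableSet_Ioo] with x h1 h2 h3
    rw [h1, h2, hk (Ioo_subset_Icc_self h3)]
  have e2 : ∫ x in Ioo a b, f x * g' x
      = ∫ x in Ioo a b, (c + ∫ t in a..x, f' t) * deriv (fun x => k + ∫ t in a..x, g' t) x := by
    refine integral_congr_ae ?_
    filter_upwards [ae_deriv_primitive hab.le k g', hf.ae_eq_contRep hab,
      ae_restrict_mem measurableSet_Ioo] with x h1 h2 h3
    rw [h1, h2, hc (Ioo_subset_Icc_self h3)]
  rw [e1, e2, ← intervalIntegral_eq_Ioo hab.le, ← intervalIntegral_eq_Ioo hab.le]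
  simp only
  linarith

theorem L2.integral_norm_le {a b : ℝ} (hab : a ≤ b) (f : L2 a b) :
    ∫ x in Ioo a b, ‖f x‖ ≤ √(b - a) * ‖f‖ := by
  have h := integral_mul_le_Lp_mul_Lq_of_nonneg (μ := volume.restrict (Ioo a b))
    (f := fun x => ‖f x‖) (g := fun _ => (1 : ℝ)) Real.HolderConjugate.two_two
    (Eventually.of_forall fun _ => norm_nonneg _) (Eventually.of_forall fun _ => zero_le_one)
    (by simpa using (Lp.memLp f).norm) (memLp_const _)
  have hn : ‖f‖ = √(∫ x in Ioo a b, ‖f x‖ ^ 2) := by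
    have := L2.inner_eq f f
    rw [real_inner_self_eq_norm_sq] at this
    rw [← Real.sqrt_sq (norm_nonneg f), this]
    congr 1
    refine integral_congr_ae (Eventually.of_forall fun x => ?_)
    simp [pow_two]
  simp only [mul_one, Real.rpow_two, one_pow, integral_const, smul_eq_mul,
    MeasurableSet.univ, measureReal_restrict_apply, univ_inter, Real.volume_real_Ioo_of_le hab,
    ← Real.sqrt_eq_rpow] at h
  rw [hn, mul_comm]
  exact h

theorem HasWeakDeriv.exists_bound {a b : ℝ} (hab : a < b) :
    ∃ C : ℝ, 0 ≤ C ∧ ∀ {f g : L2 a b}, HasWeakDeriv f g → ∀ x ∈ Icc a b,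
      |contRep f x| ≤ C * (‖f‖ + ‖g‖) := by
  refine ⟨√(b - a) / (b - a) + √(b - a), by have := sub_pos.2 hab; positivity, ?_⟩
  intro f g h x hx
  have hba := sub_pos.2 hab
  have hpt : ∀ y ∈ Icc a b, |contRep f x| ≤ |contRep f y| + √(b - a) * ‖g‖ := by
    intro y hy
    have h1 := h.contRep_sub hab hy hx
    have h2 : |∫ t in y..x, g t| ≤ √(b - a) * ‖g‖ := by
      refine le_trans ?_ (L2.integral_norm_le hab.le g)
      rw [← Real.norm_eq_abs]
      refine (intervalIntegral.norm_integral_le_integral_norm_uIoc).trans ?_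
      rw [← integral_Ioc_eq_integral_Ioo]
      refine setIntegral_mono_set ?_ (Eventually.of_forall fun _ => norm_nonneg _)
        (LE.le.eventuallyLE (Ioc_subset_Ioc (le_min hy.1 hx.1) (max_le hy.2 hx.2)))
      exact (integrableOn_Ioc_iff_integrableOn_Ioo).2 (L2.integrable g).norm
    have : contRep f x = contRep f y + ∫ t in y..x, g t := by linarith
    rw [this]
    exact (abs_add_le _ _).trans (by linarith)
  have h3 : ∫ _y in Ioo a b, |contRep f x| ≤ ∫ y in Ioo a b, (‖f y‖ + √(b - a) * ‖g‖) := by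
    refine integral_mono_ae (integrable_const _)
      ((L2.integrable f).norm.add (integrable_const _)) ?_
    filter_upwards [h.ae_eq_contRep hab, ae_restrict_mem measurableSet_Ioo] with y hy hym
    simp only [hy, Real.norm_eq_abs]
    exact hpt y (Ioo_subset_Icc_self hym)
  rw [integral_add (L2.integrable f).norm (integrable_const _)] at h3
  simp only [integral_const, smul_eq_mul,
    MeasurableSet.univ, measureReal_restrict_apply, univ_inter,
    Real.volume_real_Ioo_of_le hab.le] at h3
  have h4 := L2.integral_norm_le hab.le f
  have h5 : |contRep f x| ≤ √(b - a) / (b - a) * ‖f‖ + √(b - a) * ‖g‖ := by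
    have h6 : (b - a) * |contRep f x| ≤
        (b - a) * (√(b - a) / (b - a) * ‖f‖ + √(b - a) * ‖g‖) := by
      have e : (b - a) * (√(b - a) / (b - a) * ‖f‖ + √(b - a) * ‖g‖)
        = √(b - a) * ‖f‖ + (b - a) * (√(b - a) * ‖g‖) := by field_simp
      rw [e]
      linarith
    exact le_of_mul_le_mul_left h6 hba
  have h7 : 0 ≤ √(b - a) / (b - a) * ‖g‖ := by positivity
  have h8 : 0 ≤ √(b - a) * ‖f‖ := by positivity
  nlinarith

/-! ### The wave propagators on `L²(0,1)`

A function on `(0,1)` is extended to an odd function on the circle `ℝ/2ℤ`, and the solution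
operators of the wave equation are averages of translations on the circle. -/

instance fact_two_pos : Fact ((0 : ℝ) < 2) := ⟨two_pos⟩

/-- Square integrable functions on the circle `ℝ/2ℤ`. -/
abbrev LCircle : Type := Lp ℝ 2 (volume : Measure (AddCircle (2 : ℝ)))

/-- The coordinate in `(-1,1]` of a point of the circle `ℝ/2ℤ`. -/
def circleCoord (y : AddCircle (2 : ℝ)) : ℝ := (AddCircle.equivIoc 2 (-1) y : ℝ)

theorem measurePreserving_circleCoord :
    MeasurePreserving circleCoord volume (volume.restrict (Ioc (-1 : ℝ) (-1 + 2))) :=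
  (measurePreserving_subtype_coe measurableSet_Ioc).comp
    (AddCircle.measurePreserving_equivIoc (T := 2) (a := -1))

theorem circleCoord_mem (y : AddCircle (2 : ℝ)) : circleCoord y ∈ Ioc (-1 : ℝ) 1 := by
  have := (AddCircle.equivIoc 2 (-1) y).2
  norm_num at this
  exact this

theorem coe_circleCoord (y : AddCircle (2 : ℝ)) : (circleCoord y : AddCircle (2 : ℝ)) = y :=
  AddCircle.coe_equivIoc

theorem circleCoord_coe {x : ℝ} (hx : x ∈ Ioc (-1 : ℝ) 1) :
    circleCoord (x : AddCircle (2 : ℝ)) = x := by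
  rw [circleCoord, AddCircle.equivIoc_coe_of_mem]
  norm_num
  exact hx

theorem ae_real_of_ae_circle {P : AddCircle (2 : ℝ) → Prop} (h : ∀ᵐ y, P y) :
    ∀ᵐ x : ℝ, P (x : AddCircle (2 : ℝ)) := by
  have h1 : ∀ n : ℤ, ∀ᵐ x : ℝ ∂(volume.restrict (Ioc (n • (2 : ℝ)) (n • (2 : ℝ) + 2))),
      P (x : AddCircle (2 : ℝ)) := fun n =>
    (AddCircle.measurePreserving_mk 2 (n • (2 : ℝ))).quasiMeasurePreserving.ae h
  have h2 := (ae_restrict_iUnion_iff (μ := volume)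
    (fun n : ℤ => Ioc (n • (2 : ℝ)) (n • (2 : ℝ) + 2)) _).2 h1
  have h3 : (⋃ n : ℤ, Ioc (n • (2 : ℝ)) (n • (2 : ℝ) + 2)) = univ := by
    simpa [add_smul] using iUnion_Ioc_zsmul (two_pos (α := ℝ))
  rwa [h3, Measure.restrict_univ] at h2

/-- The odd extension to `(-1,1)` of a function on `(0,1)`. -/
def oddReal (f : ℝ → ℝ) (x : ℝ) : ℝ := (Ioo 0 1).indicator f x - (Ioo 0 1).indicator f (-x)

theorem oddReal_neg (f : ℝ → ℝ) (x : ℝ) : oddReal f (-x) = -oddReal f x := by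
  simp [oddReal]

theorem memLp_oddReal (f : L2 0 1) : MemLp (oddReal f) 2 volume := by
  have h : MemLp ((Ioo (0 : ℝ) 1).indicator f) 2 volume :=
    (memLp_indicator_iff_restrict measurableSet_Ioo).2 (Lp.memLp f)
  exact h.sub (h.comp_measurePreserving (Measure.measurePreserving_neg volume))

theorem eLpNorm_oddReal_le (f : L2 0 1) : eLpNorm (oddReal f) 2 volume ≤ 2 * ‖f‖ₑ := by
  have h : MemLp ((Ioo (0 : ℝ) 1).indicator f) 2 volume :=
    (memLp_indicator_iff_restrict measurableSet_Ioo).2 (Lp.memLp f)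
  refine (eLpNorm_sub_le h.1 (h.comp_measurePreserving
    (Measure.measurePreserving_neg volume)).1 (by norm_num)).trans (le_of_eq ?_)
  rw [eLpNorm_comp_measurePreserving h.1 (Measure.measurePreserving_neg volume),
    eLpNorm_indicator_eq_eLpNorm_restrict measurableSet_Ioo, ← two_mul, Lp.enorm_def]

theorem memLp_oddCircle (f : L2 0 1) : MemLp (fun y => oddReal f (circleCoord y)) 2
    (volume : Measure (AddCircle (2 : ℝ))) :=
  ((memLp_oddReal f).restrict _).comp_measurePreserving measurePreserving_circleCoord

theorem ae_circleCoord {P : ℝ → Prop} (h : ∀ᵐ x : ℝ, P x) :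
    ∀ᵐ y : AddCircle (2 : ℝ), P (circleCoord y) :=
  measurePreserving_circleCoord.quasiMeasurePreserving.ae (ae_restrict_of_ae h)

theorem ae_oddReal {f g h : ℝ → ℝ} {R : ℝ → ℝ → ℝ → Prop} (h0 : R 0 0 0)
    (hp : ∀ᵐ x ∂(volume.restrict (Ioo (0 : ℝ) 1)), R (f x) (g x) (h x))
    (hn : ∀ᵐ x ∂(volume.restrict (Ioo (0 : ℝ) 1)), R (-f x) (-g x) (-h x)) :
    ∀ᵐ x : ℝ, R (oddReal f x) (oddReal g x) (oddReal h x) := by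
  rw [ae_restrict_iff' measurableSet_Ioo] at hp hn
  have hn' := (Measure.measurePreserving_neg (volume : Measure ℝ)).quasiMeasurePreserving.ae hn
  filter_upwards [hp, hn'] with x h1 h2
  by_cases hx : x ∈ Ioo (0 : ℝ) 1
  · have hx' : -x ∉ Ioo (0 : ℝ) 1 := fun h => by have := h.1; have := hx.1; linarith
    simpa [oddReal, indicator_of_mem hx, indicator_of_notMem hx'] using h1 hx
  · by_cases hx' : -x ∈ Ioo (0 : ℝ) 1
    · simpa [oddReal, indicator_of_mem hx', indicator_of_notMem hx] using h2 hx'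
    · simpa [oddReal, indicator_of_notMem hx', indicator_of_notMem hx] using h0

/-- The odd extension of `f ∈ L²(0,1)` to the circle. -/
def oddExtFun (f : L2 0 1) : LCircle := (memLp_oddCircle f).toLp _

theorem coeFn_oddExtFun (f : L2 0 1) :
    oddExtFun f =ᵐ[volume] fun y => oddReal f (circleCoord y) := MemLp.coeFn_toLp _

theorem oddExtFun_add (f g : L2 0 1) : oddExtFun (f + g) = oddExtFun f + oddExtFun g := by
  have key := ae_circleCoord (ae_oddReal (f := f) (g := g) (h := (f + g : L2 0 1))
    (R := fun a b c => c = a + b) (by simp)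
    (by filter_upwards [Lp.coeFn_add f g] with x hx; rw [hx]; rfl)
    (by filter_upwards [Lp.coeFn_add f g] with x hx; rw [hx, Pi.add_apply]; ring))
  refine Lp.ext ?_
  filter_upwards [key, coeFn_oddExtFun f, coeFn_oddExtFun g, coeFn_oddExtFun (f + g),
    Lp.coeFn_add (oddExtFun f) (oddExtFun g)] with y h1 h2 h3 h4 h5
  rw [h4, h5, Pi.add_apply, h2, h3, h1]

theorem oddExtFun_smul (c : ℝ) (f : L2 0 1) : oddExtFun (c • f) = c • oddExtFun f := by
  have key := ae_circleCoord (ae_oddReal (f := f) (g := f) (h := (c • f : L2 0 1))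
    (R := fun a _ d => d = c * a) (by simp)
    (by filter_upwards [Lp.coeFn_smul c f] with x hx; rw [hx]; rfl)
    (by filter_upwards [Lp.coeFn_smul c f] with x hx; rw [hx, Pi.smul_apply]; simp))
  refine Lp.ext ?_
  filter_upwards [key, coeFn_oddExtFun f, coeFn_oddExtFun (c • f),
    Lp.coeFn_smul c (oddExtFun f)] with y h1 h2 h4 h5
  rw [h4, h5, Pi.smul_apply, h2, h1, smul_eq_mul]

theorem norm_oddExtFun_le (f : L2 0 1) : ‖oddExtFun f‖ ≤ 2 * ‖f‖ := by
  have e0 : ‖oddExtFun f‖ = (eLpNorm (fun y => oddReal f (circleCoord y)) 2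
      (volume : Measure (AddCircle (2 : ℝ)))).toReal := Lp.norm_toLp _ _
  rw [e0]
  have h : eLpNorm (fun y => oddReal f (circleCoord y)) 2 (volume : Measure (AddCircle (2 : ℝ)))
      ≤ 2 * ‖f‖ₑ := by
    have e := eLpNorm_comp_measurePreserving (p := 2) (g := oddReal f)
      ((memLp_oddReal f).restrict _).1 measurePreserving_circleCoord
    rw [Function.comp_def] at e
    rw [e]
    exact (eLpNorm_mono_measure _ Measure.restrict_le_self).trans (eLpNorm_oddReal_le f)
  refine (ENNReal.toReal_mono (by finiteness) h).trans (le_of_eq ?_)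
  simp

/-- Odd extension to the circle as a bounded operator. -/
def oddExt : L2 0 1 →L[ℝ] LCircle :=
  LinearMap.mkContinuous ⟨⟨oddExtFun, oddExtFun_add⟩, oddExtFun_smul⟩ 2 norm_oddExtFun_le

theorem coeFn_oddExt (f : L2 0 1) : oddExt f =ᵐ[volume] fun y => oddReal f (circleCoord y) :=
  coeFn_oddExtFun f

theorem norm_oddExt_le (f : L2 0 1) : ‖oddExt f‖ ≤ 2 * ‖f‖ := norm_oddExtFun_le f

attribute [irreducible] oddExt circleCoord

theorem circleCoord_neg {y : AddCircle (2 : ℝ)} (h : circleCoord y ≠ 1) :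
    circleCoord (-y) = -circleCoord y := by
  have hy := circleCoord_mem y
  have e : -y = ((-circleCoord y : ℝ) : AddCircle (2 : ℝ)) := by
    rw [AddCircle.coe_neg, coe_circleCoord]
  rw [e]
  exact circleCoord_coe ⟨by linarith [lt_of_le_of_ne hy.2 h], by linarith [hy.1]⟩

theorem ae_neg_circle {P : AddCircle (2 : ℝ) → Prop} (h : ∀ᵐ y, P y) : ∀ᵐ y, P (-y) :=
  (Measure.measurePreserving_neg (volume : Measure (AddCircle (2 : ℝ)))).quasiMeasurePreserving.ae h

theorem oddExt_neg_ae (f : L2 0 1) :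
    ∀ᵐ y : AddCircle (2 : ℝ), oddExt f (-y) = -oddExt f y := by
  have hneg := ae_neg_circle (P := fun y => oddExt f y = oddReal f (circleCoord y)) (coeFn_oddExt f)
  have hne : ∀ᵐ y : AddCircle (2 : ℝ), circleCoord y ≠ 1 :=
    ae_circleCoord (P := fun x => x ≠ 1) (by simp [ae_iff])
  filter_upwards [coeFn_oddExt f, hneg, hne] with y h1 h2 h3
  rw [h1, h2, circleCoord_neg h3, oddReal_neg]

theorem restrict_Ioo_le_restrict_Ioc :
    volume.restrict (Ioo (0 : ℝ) 1) ≤ volume.restrict (Ioc (-1 : ℝ) (-1 + 2)) :=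
  Measure.restrict_mono_set volume fun x hx => ⟨by linarith [hx.1], by linarith [hx.2]⟩

theorem memLp_restrictFun (F : LCircle) :
    MemLp (fun x : ℝ => F (x : AddCircle (2 : ℝ))) 2 (volume.restrict (Ioo 0 1)) :=
  ((Lp.memLp F).comp_measurePreserving (AddCircle.measurePreserving_mk 2 (-1))).mono_measure
    restrict_Ioo_le_restrict_Ioc

/-- The restriction to `(0,1)` of a function on the circle. -/
def restrictFun (F : LCircle) : L2 0 1 := (memLp_restrictFun F).toLp _

theorem coeFn_restrictFun (F : LCircle) :
    restrictFun F =ᵐ[volume.restrict (Ioo (0 : ℝ) 1)] fun x => F (x : AddCircle (2 : ℝ)) :=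
  MemLp.coeFn_toLp _

theorem restrictFun_add (F G : LCircle) : restrictFun (F + G) = restrictFun F + restrictFun G := by
  refine Lp.ext ?_
  filter_upwards [coeFn_restrictFun F, coeFn_restrictFun G, coeFn_restrictFun (F + G),
    ae_restrict_of_ae (ae_real_of_ae_circle (Lp.coeFn_add F G)),
    Lp.coeFn_add (restrictFun F) (restrictFun G)] with x h1 h2 h3 h4 h5
  rw [h3, h4, h5, Pi.add_apply, Pi.add_apply, h1, h2]

theorem restrictFun_smul (c : ℝ) (F : LCircle) : restrictFun (c • F) = c • restrictFun F := by
  refine Lp.ext ?_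
  filter_upwards [coeFn_restrictFun F, coeFn_restrictFun (c • F),
    ae_restrict_of_ae (ae_real_of_ae_circle (Lp.coeFn_smul c F)),
    Lp.coeFn_smul c (restrictFun F)] with x h1 h3 h4 h5
  rw [h3, h4, h5, Pi.smul_apply, Pi.smul_apply, h1]

theorem norm_restrictFun_le (F : LCircle) : ‖restrictFun F‖ ≤ 1 * ‖F‖ := by
  have e0 : ‖restrictFun F‖ = (eLpNorm (fun x : ℝ => F (x : AddCircle (2 : ℝ))) 2
      (volume.restrict (Ioo 0 1))).toReal := Lp.norm_toLp _ _
  rw [e0, one_mul, Lp.norm_def]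
  refine ENNReal.toReal_mono (Lp.eLpNorm_ne_top F) ?_
  have e := eLpNorm_comp_measurePreserving (p := 2) (g := F) (Lp.memLp F).1
    (AddCircle.measurePreserving_mk 2 (-1))
  rw [Function.comp_def] at e
  rw [← e]
  exact eLpNorm_mono_measure _ restrict_Ioo_le_restrict_Ioc

/-- Restriction from the circle to `(0,1)` as a bounded operator. -/
def restrictCircle : LCircle →L[ℝ] L2 0 1 :=
  LinearMap.mkContinuous ⟨⟨restrictFun, restrictFun_add⟩, restrictFun_smul⟩ 1 norm_restrictFun_le

theorem coeFn_restrictCircle (F : LCircle) :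
    restrictCircle F =ᵐ[volume.restrict (Ioo (0 : ℝ) 1)] fun x => F (x : AddCircle (2 : ℝ)) :=
  coeFn_restrictFun F

theorem norm_restrictCircle_le (F : LCircle) : ‖restrictCircle F‖ ≤ ‖F‖ :=
  (norm_restrictFun_le F).trans_eq (one_mul _)

attribute [irreducible] restrictCircle

theorem restrictCircle_oddExt (f : L2 0 1) : restrictCircle (oddExt f) = f := by
  refine Lp.ext ?_
  filter_upwards [coeFn_restrictCircle (oddExt f),
    ae_restrict_of_ae (ae_real_of_ae_circle (coeFn_oddExt f)),
    ae_restrict_mem measurableSet_Ioo] with x h1 h2 hx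
  have hx' : -x ∉ Ioo (0 : ℝ) 1 := fun h => by have := h.1; have := hx.1; linarith
  rw [h1, h2, circleCoord_coe ⟨by linarith [hx.1], hx.2.le⟩, oddReal, indicator_of_mem hx,
    indicator_of_notMem hx', sub_zero]

theorem measurePreserving_add_circle (τ : ℝ) :
    MeasurePreserving (fun y : AddCircle (2 : ℝ) => y + (τ : AddCircle (2 : ℝ))) volume volume :=
  measurePreserving_add_right volume _

/-- Translation on the circle. -/
def translate (τ : ℝ) : LCircle →L[ℝ] LCircle :=
  (Lp.compMeasurePreservingₗᵢ ℝ _ (measurePreserving_add_circle τ)).toContinuousLinearMap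

theorem coeFn_translate (τ : ℝ) (F : LCircle) :
    translate τ F =ᵐ[volume] fun y => F (y + (τ : AddCircle (2 : ℝ))) :=
  Lp.coeFn_compMeasurePreserving F (measurePreserving_add_circle τ)

theorem norm_translate (τ : ℝ) (F : LCircle) : ‖translate τ F‖ = ‖F‖ :=
  Lp.norm_compMeasurePreserving F (measurePreserving_add_circle τ)

theorem continuous_translate : Continuous fun p : ℝ × LCircle => translate p.1 p.2 := by
  have hc : Continuous fun q : (ℝ × LCircle) × AddCircle (2 : ℝ) =>
      q.2 + ((q.1.1 : ℝ) : AddCircle (2 : ℝ)) :=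
    continuous_snd.add ((AddCircle.continuous_mk' 2).comp (continuous_fst.comp continuous_fst))
  let g : C(ℝ × LCircle, C(AddCircle (2 : ℝ), AddCircle (2 : ℝ))) := (ContinuousMap.mk _ hc).curry
  exact continuous_snd.compMeasurePreservingLp g.continuous
    (fun p => measurePreserving_add_circle p.1) (by norm_num)

attribute [irreducible] translate

/-- The periodic odd extension to the real line of `f ∈ L²(0,1)`. -/
def lineExt (f : L2 0 1) (x : ℝ) : ℝ := oddExt f (x : AddCircle (2 : ℝ))

theorem lineExt_periodic (f : L2 0 1) : Function.Periodic (lineExt f) 2 := by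
  intro x
  simp only [lineExt]
  rw [AddCircle.coe_add_period]

theorem lineExt_neg_ae (f : L2 0 1) : ∀ᵐ x : ℝ, lineExt f (-x) = -lineExt f x := by
  filter_upwards [ae_real_of_ae_circle (oddExt_neg_ae f)] with x hx
  simpa only [lineExt, AddCircle.coe_neg] using hx

theorem lineExt_ae_eq (f : L2 0 1) : f =ᵐ[volume.restrict (Ioo (0 : ℝ) 1)] lineExt f := by
  have := coeFn_restrictCircle (oddExt f)
  rwa [restrictCircle_oddExt] at this

theorem locallyIntegrable_lineExt (f : L2 0 1) : LocallyIntegrable (lineExt f) volume := by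
  intro x
  refine ⟨Ioc (x - 1) (x - 1 + 2), Ioc_mem_nhds (by linarith) (by linarith), ?_⟩
  exact (((Lp.memLp (oddExt f)).comp_measurePreserving
    (AddCircle.measurePreserving_mk 2 (x - 1))).integrable (by norm_num))

theorem lineExt_bound {f : L2 0 1} {M : ℝ} (hM : 0 ≤ M)
    (h : ∀ᵐ x ∂(volume.restrict (Ioo (0 : ℝ) 1)), |f x| ≤ M) : ∀ᵐ x : ℝ, |lineExt f x| ≤ M := by
  have key := ae_circleCoord (ae_oddReal (f := f) (g := f) (h := f)
    (R := fun a _ _ => |a| ≤ M) (by simpa using hM) h (by simpa using h))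
  refine ae_real_of_ae_circle (P := fun y => |oddExt f y| ≤ M) ?_
  filter_upwards [key, coeFn_oddExt f] with y h1 h2
  rwa [h2]

/-- The even propagator `f ↦ (f(· + τ) + f(· - τ)) / 2` with respect to odd extension. -/
def waveCos (τ : ℝ) : L2 0 1 →L[ℝ] L2 0 1 :=
  (1 / 2 : ℝ) • restrictCircle ∘L (translate τ + translate (-τ)) ∘L oddExt

/-- The odd propagator `f ↦ (f(· - τ) - f(· + τ)) / 2` with respect to odd extension. -/
def waveSin (τ : ℝ) : L2 0 1 →L[ℝ] L2 0 1 :=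
  (1 / 2 : ℝ) • restrictCircle ∘L (translate (-τ) - translate τ) ∘L oddExt

theorem restrict_translate_ae (τ : ℝ) (f : L2 0 1) :
    restrictCircle (translate τ (oddExt f)) =ᵐ[volume.restrict (Ioo (0 : ℝ) 1)]
      fun x => lineExt f (x + τ) := by
  filter_upwards [coeFn_restrictCircle (translate τ (oddExt f)),
    ae_restrict_of_ae (ae_real_of_ae_circle (coeFn_translate τ (oddExt f)))] with x h1 h2
  rw [h1, h2, lineExt, AddCircle.coe_add]

theorem waveCos_eq (τ : ℝ) (f : L2 0 1) :
    waveCos τ f = (1 / 2 : ℝ) • (restrictCircle (translate τ (oddExt f))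
      + restrictCircle (translate (-τ) (oddExt f))) := by
  simp [waveCos]

theorem waveCos_ae (τ : ℝ) (f : L2 0 1) : waveCos τ f =ᵐ[volume.restrict (Ioo (0 : ℝ) 1)]
    fun x => (lineExt f (x + τ) + lineExt f (x - τ)) / 2 := by
  rw [waveCos_eq]
  filter_upwards [Lp.coeFn_smul (1 / 2 : ℝ) (restrictCircle (translate τ (oddExt f))
      + restrictCircle (translate (-τ) (oddExt f))),
    Lp.coeFn_add (restrictCircle (translate τ (oddExt f)))
      (restrictCircle (translate (-τ) (oddExt f))),
    restrict_translate_ae τ f, restrict_translate_ae (-τ) f] with x h1 h2 h3 h4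
  rw [h1, Pi.smul_apply, h2, Pi.add_apply, h3, h4, smul_eq_mul, ← sub_eq_add_neg]
  ring

theorem waveSin_eq (τ : ℝ) (f : L2 0 1) :
    waveSin τ f = (1 / 2 : ℝ) • (restrictCircle (translate (-τ) (oddExt f))
      - restrictCircle (translate τ (oddExt f))) := by
  simp [waveSin]

theorem waveSin_ae (τ : ℝ) (f : L2 0 1) : waveSin τ f =ᵐ[volume.restrict (Ioo (0 : ℝ) 1)]
    fun x => (lineExt f (x - τ) - lineExt f (x + τ)) / 2 := by
  rw [waveSin_eq]
  filter_upwards [Lp.coeFn_smul (1 / 2 : ℝ) (restrictCircle (translate (-τ) (oddExt f))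
      - restrictCircle (translate τ (oddExt f))),
    Lp.coeFn_sub (restrictCircle (translate (-τ) (oddExt f)))
      (restrictCircle (translate τ (oddExt f))),
    restrict_translate_ae τ f, restrict_translate_ae (-τ) f] with x h1 h2 h3 h4
  rw [h1, Pi.smul_apply, h2, Pi.sub_apply, h3, h4, smul_eq_mul, ← sub_eq_add_neg]
  ring

theorem continuous_waveCos : Continuous fun p : ℝ × L2 0 1 => waveCos p.1 p.2 := by
  have h1 : Continuous fun p : ℝ × L2 0 1 => translate p.1 (oddExt p.2) :=
    continuous_translate.comp (continuous_fst.prodMk (oddExt.continuous.comp continuous_snd))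
  have h2 : Continuous fun p : ℝ × L2 0 1 => translate (-p.1) (oddExt p.2) :=
    continuous_translate.comp (continuous_fst.neg.prodMk (oddExt.continuous.comp continuous_snd))
  simp only [waveCos_eq]
  exact ((restrictCircle.continuous.comp h1).add (restrictCircle.continuous.comp h2)).const_smul (1 / 2 : ℝ)

theorem continuous_waveSin : Continuous fun p : ℝ × L2 0 1 => waveSin p.1 p.2 := by
  have h1 : Continuous fun p : ℝ × L2 0 1 => translate p.1 (oddExt p.2) :=
    continuous_translate.comp (continuous_fst.prodMk (oddExt.continuous.comp continuous_snd))
  have h2 : Continuous fun p : ℝ × L2 0 1 => translate (-p.1) (oddExt p.2) :=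
    continuous_translate.comp (continuous_fst.neg.prodMk (oddExt.continuous.comp continuous_snd))
  simp only [waveSin_eq]
  exact ((restrictCircle.continuous.comp h2).sub (restrictCircle.continuous.comp h1)).const_smul (1 / 2 : ℝ)

theorem waveCos_zero (f : L2 0 1) : waveCos 0 f = f := by
  refine Lp.ext ?_
  filter_upwards [waveCos_ae 0 f, lineExt_ae_eq f] with x h1 h2
  rw [h1, h2]
  simp

theorem waveSin_zero (f : L2 0 1) : waveSin 0 f = 0 := by
  simp [waveSin]

theorem norm_waveCos_le (τ : ℝ) (f : L2 0 1) : ‖waveCos τ f‖ ≤ 2 * ‖f‖ := by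
  have h1 := norm_restrictCircle_le (translate τ (oddExt f))
  have h2 := norm_restrictCircle_le (translate (-τ) (oddExt f))
  have h3 := norm_oddExt_le f
  have h4 := norm_add_le (restrictCircle (translate τ (oddExt f)))
    (restrictCircle (translate (-τ) (oddExt f)))
  rw [norm_translate] at h1 h2
  rw [waveCos_eq, norm_smul, Real.norm_of_nonneg (by norm_num)]
  linarith

/-- `|f| ≤ M` almost everywhere on `(0,1)`. -/
def AEBdd (f : L2 0 1) (M : ℝ) : Prop := ∀ᵐ x ∂(volume.restrict (Ioo (0 : ℝ) 1)), |f x| ≤ M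

theorem ae_add_real {P : ℝ → Prop} (h : ∀ᵐ x : ℝ, P x) (τ : ℝ) : ∀ᵐ x : ℝ, P (x + τ) :=
  (measurePreserving_add_right volume τ).quasiMeasurePreserving.ae h

theorem AEBdd.nonneg {f : L2 0 1} {M : ℝ} (h : AEBdd f M) : 0 ≤ M := by
  have : NeBot (ae (volume.restrict (Ioo (0 : ℝ) 1))) := by
    rw [ae_neBot, Ne, Measure.restrict_eq_zero]
    simp
  obtain ⟨x, hx⟩ := h.exists
  exact (abs_nonneg _).trans hx

theorem AEBdd.waveCos {f : L2 0 1} {M : ℝ} (h : AEBdd f M) (τ : ℝ) : AEBdd (waveCos τ f) M := by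
  have h0 := lineExt_bound h.nonneg h
  filter_upwards [waveCos_ae τ f, ae_restrict_of_ae (ae_add_real h0 τ),
    ae_restrict_of_ae (ae_add_real h0 (-τ))] with x h1 h2 h3
  rw [← sub_eq_add_neg] at h3
  rw [h1, abs_le]
  rw [abs_le] at h2 h3
  constructor <;> linarith

theorem AEBdd.waveSin {f : L2 0 1} {M : ℝ} (h : AEBdd f M) (τ : ℝ) : AEBdd (waveSin τ f) M := by
  have h0 := lineExt_bound h.nonneg h
  filter_upwards [waveSin_ae τ f, ae_restrict_of_ae (ae_add_real h0 τ),
    ae_restrict_of_ae (ae_add_real h0 (-τ))] with x h1 h2 h3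
  rw [← sub_eq_add_neg] at h3
  rw [h1, abs_le]
  rw [abs_le] at h2 h3
  constructor <;> linarith

/-! ### Pairings of the propagators with smooth functions -/

/-- A continuous function, as an element of `L²(0,1)`. -/
def ofCont (φ : ℝ → ℝ) (h : Continuous φ) : L2 0 1 := (memLp_of_continuousOn h.continuousOn).toLp φ

theorem coeFn_ofCont {φ : ℝ → ℝ} (h : Continuous φ) :
    ofCont φ h =ᵐ[volume.restrict (Ioo (0 : ℝ) 1)] φ := MemLp.coeFn_toLp _

theorem inner_ofCont (f : L2 0 1) {φ : ℝ → ℝ} (h : Continuous φ) :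
    ⟪f, ofCont φ h⟫ = ∫ x in Ioo (0 : ℝ) 1, f x * φ x := by
  rw [L2.inner_eq]
  refine integral_congr_ae ?_
  filter_upwards [coeFn_ofCont h] with x hx
  rw [hx]

theorem inner_translate_eq (f : L2 0 1) {φ : ℝ → ℝ} (h : Continuous φ)
    (hs : tsupport φ ⊆ Ioo 0 1) (τ : ℝ) :
    ⟪restrictCircle (translate τ (oddExt f)), ofCont φ h⟫ = ∫ x, lineExt f x * φ (x - τ) := by
  have e : (fun x => lineExt f (x + τ) * φ x)
      = fun x => (fun y => lineExt f y * φ (y - τ)) (x + τ) := by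
    funext x
    simp
  rw [inner_ofCont, ← integral_add_right_eq_self (fun y => lineExt f y * φ (y - τ)) τ, ← e,
    ← setIntegral_eq_integral_of_forall_compl_eq_zero (s := Ioo (0 : ℝ) 1)
      (f := fun x => lineExt f (x + τ) * φ x)]
  · refine integral_congr_ae ?_
    filter_upwards [restrict_translate_ae τ f] with x hx
    rw [hx]
  · intro x hx
    rw [image_eq_zero_of_notMem_tsupport fun hx' => hx (hs hx'), mul_zero]

theorem hasDerivAt_inner_translate (f : L2 0 1) {φ : ℝ → ℝ} (h : ContDiff ℝ ∞ φ)
    (hc : HasCompactSupport φ) (hs : tsupport φ ⊆ Ioo 0 1) (τ : ℝ) :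
    HasDerivAt (fun τ => ⟪restrictCircle (translate τ (oddExt f)), ofCont φ h.continuous⟫)
      (-⟪restrictCircle (translate τ (oddExt f)), ofCont (deriv φ) (h.continuous_deriv (by simp))⟫)
      τ := by
  have hc' : HasCompactSupport fun z => φ (-z) := hc.comp_homeomorph (Homeomorph.neg ℝ)
  have h' : ContDiff ℝ 1 fun z => φ (-z) := (h.comp contDiff_neg).of_le (by simp)
  have key := hc'.hasDerivAt_convolution_right (ContinuousLinearMap.mul ℝ ℝ)
    (locallyIntegrable_lineExt f) h' τ
  have hd : deriv (fun z => φ (-z)) = fun z => -deriv φ (-z) := by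
    funext z
    exact deriv_comp_neg φ z
  rw [hd] at key
  have e1 : (fun τ => ⟪restrictCircle (translate τ (oddExt f)), ofCont φ h.continuous⟫)
      = convolution (lineExt f) (fun z => φ (-z)) (ContinuousLinearMap.mul ℝ ℝ) volume := by
    funext σ
    rw [inner_translate_eq f h.continuous hs σ, convolution_def]
    simp
  rw [e1]
  refine key.congr_deriv ?_
  rw [inner_translate_eq f _ (tsupport_deriv_subset.trans hs) τ, convolution_def,
    ← integral_neg]
  simp

theorem hasDerivAt_inner_waveSin (f : L2 0 1) {φ : ℝ → ℝ} (h : ContDiff ℝ ∞ φ)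
    (hc : HasCompactSupport φ) (hs : tsupport φ ⊆ Ioo 0 1) (τ : ℝ) :
    HasDerivAt (fun τ => ⟪waveSin τ f, ofCont φ h.continuous⟫)
      ⟪waveCos τ f, ofCont (deriv φ) (h.continuous_deriv (by simp))⟫ τ := by
  simp only [waveSin_eq, waveCos_eq, inner_smul_left, inner_add_left, inner_sub_left]
  have h1 := hasDerivAt_inner_translate f h hc hs τ
  have h2 := (hasDerivAt_inner_translate f h hc hs (-τ)).scomp τ (hasDerivAt_neg τ)
  refine ((h2.sub h1).const_mul _).congr_deriv ?_
  simp
  ring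

theorem hasDerivAt_inner_waveCos (f : L2 0 1) {φ : ℝ → ℝ} (h : ContDiff ℝ ∞ φ)
    (hc : HasCompactSupport φ) (hs : tsupport φ ⊆ Ioo 0 1) (τ : ℝ) :
    HasDerivAt (fun τ => ⟪waveCos τ f, ofCont φ h.continuous⟫)
      ⟪waveSin τ f, ofCont (deriv φ) (h.continuous_deriv (by simp))⟫ τ := by
  simp only [waveSin_eq, waveCos_eq, inner_smul_left, inner_add_left, inner_sub_left]
  have h1 := hasDerivAt_inner_translate f h hc hs τ
  have h2 := (hasDerivAt_inner_translate f h hc hs (-τ)).scomp τ (hasDerivAt_neg τ)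
  refine ((h1.add h2).const_mul _).congr_deriv ?_
  simp
  ring

theorem integral_eq_half_of_even {H : ℝ → ℝ} (hi : IntervalIntegrable H volume (-1) 1)
    (he : ∀ᵐ x : ℝ, H (-x) = H x) : ∫ x in (0 : ℝ)..1, H x = (∫ x in (-1 : ℝ)..1, H x) / 2 := by
  have h1 : IntervalIntegrable H volume (-1) 0 :=
    hi.mono_set (by rw [uIcc_of_le, uIcc_of_le] <;> norm_num; exact Icc_subset_Icc_right (by simp))
  have h2 : IntervalIntegrable H volume 0 1 :=
    hi.mono_set (by rw [uIcc_of_le, uIcc_of_le] <;> norm_num; exact Icc_subset_Icc_left (by simp))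
  have h3 : ∫ x in (-1 : ℝ)..0, H x = ∫ x in (0 : ℝ)..1, H x := by
    have := intervalIntegral.integral_comp_neg (a := 0) (b := 1) H
    rw [neg_zero] at this
    rw [← this]
    exact intervalIntegral.integral_congr_ae (he.mono fun x hx _ => hx)
  rw [← intervalIntegral.integral_add_adjacent_intervals h1 h2, h3]
  ring

theorem intervalIntegrable_lineExt_mul (f : L2 0 1) (τ a b : ℝ) {ψ : ℝ → ℝ} (hψ : Continuous ψ) :
    IntervalIntegrable (fun x => lineExt f (x + τ) * ψ x) volume a b := by
  have h1 : IntervalIntegrable (lineExt f) volume (a + τ) (b + τ) :=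
    ((locallyIntegrable_lineExt f).integrableOn_isCompact isCompact_uIcc).intervalIntegrable
  have h2 := h1.comp_add_right τ
  simp only [add_sub_cancel_right] at h2
  exact h2.mul_continuousOn hψ.continuousOn

theorem integral_lineExt_shift (f : L2 0 1) {ψ : ℝ → ℝ} (hp : Function.Periodic ψ 2) (τ : ℝ) :
    ∫ x in (-1 : ℝ)..1, lineExt f (x + τ) * ψ x = ∫ x in (-1 : ℝ)..1, lineExt f x * ψ (x - τ) := by
  have e : (fun x => lineExt f (x + τ) * ψ x)
      = fun x => (fun y => lineExt f y * ψ (y - τ)) (x + τ) := by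
    funext x
    simp
  have hper : Function.Periodic (fun y => lineExt f y * ψ (y - τ)) 2 := by
    intro y
    simp only
    rw [lineExt_periodic f y, show y + 2 - τ = y - τ + 2 by ring, hp (y - τ)]
  rw [e, intervalIntegral.integral_comp_add_right (fun y => lineExt f y * ψ (y - τ)) τ]
  have := hper.intervalIntegral_add_eq (-1 + τ) (-1)
  rwa [show -1 + τ + 2 = 1 + τ by ring, show (-1 : ℝ) + 2 = 1 by norm_num] at this

theorem periodic_cos_nat (k : ℕ) : Function.Periodic (fun x => Real.cos (k * Real.pi * x)) 2 := by
  intro x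
  simp only
  rw [show (k : ℝ) * Real.pi * (x + 2) = k * Real.pi * x + k * (2 * Real.pi) by ring,
    Real.cos_add_nat_mul_two_pi]

theorem periodic_sin_nat (k : ℕ) : Function.Periodic (fun x => Real.sin (k * Real.pi * x)) 2 := by
  intro x
  simp only
  rw [show (k : ℝ) * Real.pi * (x + 2) = k * Real.pi * x + k * (2 * Real.pi) by ring,
    Real.sin_add_nat_mul_two_pi]

theorem continuous_cos_nat (k : ℕ) : Continuous fun x : ℝ => Real.cos (k * Real.pi * x) := by
  fun_prop

theorem continuous_sin_nat (k : ℕ) : Continuous fun x : ℝ => Real.sin (k * Real.pi * x) := by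
  fun_prop

theorem lineExt_shift_neg_ae (f : L2 0 1) (τ : ℝ) :
    ∀ᵐ x : ℝ, lineExt f (-x + τ) = -lineExt f (x - τ) := by
  filter_upwards [ae_add_real (lineExt_neg_ae f) (-τ)] with x hx
  rw [← sub_eq_add_neg] at hx
  rw [← hx]
  congr 1
  ring

theorem inner_waveSin_cos (f : L2 0 1) (k : ℕ) (τ : ℝ) :
    ⟪waveSin τ f, ofCont _ (continuous_cos_nat k)⟫ = -Real.sin (k * Real.pi * τ) / 2 *
      ∫ x in (-1 : ℝ)..1, lineExt f x * Real.sin (k * Real.pi * x) := by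
  have hi : ∀ σ, IntervalIntegrable (fun x => lineExt f (x + σ) * Real.cos (k * Real.pi * x))
      volume (-1) 1 := fun σ => intervalIntegrable_lineExt_mul f σ _ _ (continuous_cos_nat k)
  have hF : ∀ σ : ℝ, IntervalIntegrable (fun x => lineExt f x * Real.cos (k * Real.pi * (x - σ)))
      volume (-1) 1 := fun σ => by
    simpa using intervalIntegrable_lineExt_mul f 0 (-1) 1
      (ψ := fun x => Real.cos (k * Real.pi * (x - σ))) (by fun_prop)
  set H : ℝ → ℝ := fun x => (lineExt f (x + -τ) * Real.cos (k * Real.pi * x)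
    - lineExt f (x + τ) * Real.cos (k * Real.pi * x)) / 2 with hH
  have e1 : ⟪waveSin τ f, ofCont _ (continuous_cos_nat k)⟫ = ∫ x in (0 : ℝ)..1, H x := by
    rw [inner_ofCont, intervalIntegral_eq_Ioo zero_le_one]
    refine integral_congr_ae ?_
    filter_upwards [waveSin_ae τ f] with x hx
    rw [hx]
    simp only [hH, ← sub_eq_add_neg]
    ring
  have he : ∀ᵐ x : ℝ, H (-x) = H x := by
    filter_upwards [lineExt_shift_neg_ae f τ, lineExt_shift_neg_ae f (-τ)] with x h1 h2
    simp only [hH]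
    rw [h1, h2, mul_neg, Real.cos_neg, sub_neg_eq_add, ← sub_eq_add_neg]
    ring
  rw [e1, integral_eq_half_of_even (((hi (-τ)).sub (hi τ)).div_const 2) he,
    intervalIntegral.integral_div, intervalIntegral.integral_sub (hi (-τ)) (hi τ),
    integral_lineExt_shift f (periodic_cos_nat k), integral_lineExt_shift f (periodic_cos_nat k),
    ← intervalIntegral.integral_sub (hF _) (hF _), ← intervalIntegral.integral_const_mul,
    ← intervalIntegral.integral_div, ← intervalIntegral.integral_div]
  refine intervalIntegral.integral_congr fun x _ => ?_
  simp only [mul_sub, sub_neg_eq_add, mul_add]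
  rw [Real.cos_add, Real.cos_sub]
  ring

theorem inner_waveCos_sin (f : L2 0 1) (k : ℕ) (τ : ℝ) :
    ⟪waveCos τ f, ofCont _ (continuous_sin_nat k)⟫ = Real.cos (k * Real.pi * τ) / 2 *
      ∫ x in (-1 : ℝ)..1, lineExt f x * Real.sin (k * Real.pi * x) := by
  have hi : ∀ σ, IntervalIntegrable (fun x => lineExt f (x + σ) * Real.sin (k * Real.pi * x))
      volume (-1) 1 := fun σ => intervalIntegrable_lineExt_mul f σ _ _ (continuous_sin_nat k)
  have hF : ∀ σ : ℝ, IntervalIntegrable (fun x => lineExt f x * Real.sin (k * Real.pi * (x - σ)))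
      volume (-1) 1 := fun σ => by
    simpa using intervalIntegrable_lineExt_mul f 0 (-1) 1
      (ψ := fun x => Real.sin (k * Real.pi * (x - σ))) (by fun_prop)
  set H : ℝ → ℝ := fun x => (lineExt f (x + τ) * Real.sin (k * Real.pi * x)
    + lineExt f (x + -τ) * Real.sin (k * Real.pi * x)) / 2 with hH
  have e1 : ⟪waveCos τ f, ofCont _ (continuous_sin_nat k)⟫ = ∫ x in (0 : ℝ)..1, H x := by
    rw [inner_ofCont, intervalIntegral_eq_Ioo zero_le_one]
    refine integral_congr_ae ?_
    filter_upwards [waveCos_ae τ f] with x hx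
    rw [hx]
    simp only [hH, ← sub_eq_add_neg]
    ring
  have he : ∀ᵐ x : ℝ, H (-x) = H x := by
    filter_upwards [lineExt_shift_neg_ae f τ, lineExt_shift_neg_ae f (-τ)] with x h1 h2
    simp only [hH]
    rw [h1, h2, mul_neg, Real.sin_neg, sub_neg_eq_add, ← sub_eq_add_neg]
    ring
  rw [e1, integral_eq_half_of_even (((hi τ).add (hi (-τ))).div_const 2) he,
    intervalIntegral.integral_div, intervalIntegral.integral_add (hi τ) (hi (-τ)),
    integral_lineExt_shift f (periodic_sin_nat k), integral_lineExt_shift f (periodic_sin_nat k),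
    ← intervalIntegral.integral_add (hF _) (hF _), ← intervalIntegral.integral_const_mul,
    ← intervalIntegral.integral_div, ← intervalIntegral.integral_div]
  refine intervalIntegral.integral_congr fun x _ => ?_
  simp only [mul_sub, sub_neg_eq_add, mul_add]
  rw [Real.sin_add, Real.sin_sub]
  ring

theorem hasDerivAt_inner_waveSin_cos (f : L2 0 1) (k : ℕ) (τ : ℝ) :
    HasDerivAt (fun τ => ⟪waveSin τ f, ofCont _ (continuous_cos_nat k)⟫)
      ⟪waveCos τ f, (-(k * Real.pi)) • ofCont _ (continuous_sin_nat k)⟫ τ := by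
  simp only [inner_waveSin_cos, inner_smul_right, inner_waveCos_sin]
  have h : HasDerivAt (fun τ : ℝ => Real.sin (k * Real.pi * τ))
      (Real.cos (k * Real.pi * τ) * (k * Real.pi * 1)) τ :=
    ((hasDerivAt_id τ).const_mul _).sin
  refine ((h.neg.div_const 2).mul_const _).congr_deriv ?_
  ring

/-! ### Duhamel integrals -/

section Duhamel

variable {E : Type*} [NormedAddCommGroup E] [NormedSpace ℝ E]

theorem hasDerivAt_parametric_primitive [CompleteSpace E] {F F' : ℝ → ℝ → E} (hF : Continuous (Function.uncurry F))
    (hF' : Continuous (Function.uncurry F')) (hd : ∀ t s, HasDerivAt (fun t => F t s) (F' t s) t)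
    (t : ℝ) :
    HasDerivAt (fun t => ∫ s in (0 : ℝ)..t, F t s) (F t t + ∫ s in (0 : ℝ)..t, F' t s) t := by
  have c1 : ∀ a, Continuous (F a) := fun a => hF.comp (Continuous.prodMk_right a)
  have c2 : ∀ a, Continuous (F' a) := fun a => hF'.comp (Continuous.prodMk_right a)
  have d1 : ∀ a b, HasDerivAt (fun a => ∫ s in (0 : ℝ)..b, F a s) (∫ s in (0 : ℝ)..b, F' a s) a := by
    intro a b
    obtain ⟨C, hC⟩ := ((isCompact_closedBall a 1).prod
      (isCompact_uIcc (a := 0) (b := b))).exists_bound_of_continuousOn hF'.continuousOn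
    refine (intervalIntegral.hasDerivAt_integral_of_dominated_loc_of_deriv_le (bound := fun _ => C)
      (Metric.closedBall_mem_nhds a one_pos) (Eventually.of_forall fun x =>
        (c1 x).aestronglyMeasurable) ((c1 a).intervalIntegrable _ _) (c2 a).aestronglyMeasurable
      ?_ intervalIntegrable_const (Eventually.of_forall fun s _ x _ => hd x s)).2
    exact Eventually.of_forall fun s hs x hx => hC (x, s) ⟨hx, uIoc_subset_uIcc hs⟩
  have d2 : ∀ a b, HasDerivAt (fun b => ∫ s in (0 : ℝ)..b, F a s) (F a b) b := fun a b =>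
    intervalIntegral.integral_hasDerivAt_right ((c1 a).intervalIntegrable _ _)
      ((c1 a).stronglyMeasurableAtFilter _ _) (c1 a).continuousAt
  have key := hasStrictFDerivAt_uncurry_coprod (𝕜 := ℝ) (u := (t, t))
    (f := fun a b => ∫ s in (0 : ℝ)..b, F a s)
    (f₁ := fun a b => ContinuousLinearMap.toSpanSingleton ℝ (∫ s in (0 : ℝ)..b, F' a s))
    (f₂ := fun a b => ContinuousLinearMap.toSpanSingleton ℝ (F a b))
    (Eventually.of_forall fun v => (d1 v.1 v.2).hasFDerivAt)
    (Eventually.of_forall fun v => (d2 v.1 v.2).hasFDerivAt)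
    ((ContinuousLinearMap.toSpanSingletonCLE (𝕜 := ℝ) (E := E)).continuous.comp
      (intervalIntegral.continuous_parametric_primitive_of_continuous hF')).continuousAt
    ((ContinuousLinearMap.toSpanSingletonCLE (𝕜 := ℝ) (E := E)).continuous.comp hF).continuousAt
  have hdiag : HasDerivAt (fun t : ℝ => (t, t)) ((1 : ℝ), (1 : ℝ)) t :=
    (hasDerivAt_id t).prodMk (hasDerivAt_id t)
  have := HasFDerivAt.comp_hasDerivAt (f := fun t : ℝ => (t, t)) t key.hasFDerivAt hdiag
  refine this.congr_deriv ?_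
  simp [Function.HasUncurry.uncurry, add_comm]

theorem continuous_parametric_primitive_diag {F : ℝ → ℝ → E}
    (hF : Continuous (Function.uncurry F)) : Continuous fun t => ∫ s in (0 : ℝ)..t, F t s :=
  (intervalIntegral.continuous_parametric_primitive_of_continuous hF).comp
    (continuous_id.prodMk continuous_id)

/-- The Duhamel integral `∫₀ᵗ K(t - s) f(s) ds`. -/
def duhamel (K : ℝ → E →L[ℝ] E) (f : ℝ → E) (t : ℝ) : E := ∫ s in (0 : ℝ)..t, K (t - s) (f s)

variable {K : ℝ → E →L[ℝ] E}

theorem duhamel_eq (f : ℝ → E) (t : ℝ) : duhamel K f t = ∫ s in (0 : ℝ)..t, K s (f (t - s)) := by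
  have := intervalIntegral.integral_comp_sub_left (a := 0) (b := t)
    (fun s => K (t - s) (f s)) t
  simp only [sub_sub_cancel, sub_self, sub_zero] at this
  rw [duhamel, this]

theorem continuous_duhamel (hK : Continuous fun p : ℝ × E => K p.1 p.2) {f : ℝ → E}
    (hf : Continuous f) : Continuous (duhamel K f) := by
  have h : Continuous (Function.uncurry fun t s => K (t - s) (f s)) :=
    hK.comp ((continuous_fst.sub continuous_snd).prodMk (hf.comp continuous_snd))
  exact continuous_parametric_primitive_diag h

theorem hasDerivAt_duhamel [CompleteSpace E] (hK : Continuous fun p : ℝ × E => K p.1 p.2) {f g : ℝ → E}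
    (hf : ∀ t, HasDerivAt f (g t) t) (hg : Continuous g) (t : ℝ) :
    HasDerivAt (duhamel K f) (K t (f 0) + duhamel K g t) t := by
  have hfc : Continuous f := continuous_iff_continuousAt.2 fun t => (hf t).continuousAt
  have hc : ∀ {h : ℝ → E}, Continuous h →
      Continuous (Function.uncurry fun t s => K s (h (t - s))) := fun hh =>
    hK.comp (continuous_snd.prodMk (hh.comp (continuous_fst.sub continuous_snd)))
  have := hasDerivAt_parametric_primitive (hc hfc) (hc hg) (fun t s => by
    have h1 := (hf (t - s)).scomp t ((hasDerivAt_id t).sub_const s)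
    have h2 := (K s).hasFDerivAt.comp_hasDerivAt t h1
    rw [one_smul] at h2
    exact h2) t
  rw [funext (duhamel_eq (K := K) f), duhamel_eq]
  simpa using this

end Duhamel

theorem hasDerivAt_inner_duhamel {K K' : ℝ → L2 0 1 →L[ℝ] L2 0 1}
    (hK : Continuous fun p : ℝ × L2 0 1 => K p.1 p.2)
    (hK' : Continuous fun p : ℝ × L2 0 1 => K' p.1 p.2) {φ ψ : L2 0 1}
    (hd : ∀ f τ, HasDerivAt (fun τ => ⟪K τ f, φ⟫) ⟪K' τ f, ψ⟫ τ) {f : ℝ → L2 0 1}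
    (hf : Continuous f) (t : ℝ) :
    HasDerivAt (fun t => ⟪duhamel K f t, φ⟫) (⟪K 0 (f t), φ⟫ + ⟪duhamel K' f t, ψ⟫) t := by
  have hc : ∀ {K : ℝ → L2 0 1 →L[ℝ] L2 0 1}, (Continuous fun p : ℝ × L2 0 1 => K p.1 p.2) →
      Continuous (Function.uncurry fun t s => K (t - s) (f s)) := fun hK =>
    hK.comp ((continuous_fst.sub continuous_snd).prodMk (hf.comp continuous_snd))
  have e : ∀ {K : ℝ → L2 0 1 →L[ℝ] L2 0 1}, (Continuous fun p : ℝ × L2 0 1 => K p.1 p.2) →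
      ∀ (φ : L2 0 1) t, ⟪duhamel K f t, φ⟫ = ∫ s in (0 : ℝ)..t, ⟪K (t - s) (f s), φ⟫ := by
    intro K hK φ t
    have hi : IntervalIntegrable (fun s => K (t - s) (f s)) volume 0 t :=
      ((hc hK).comp (Continuous.prodMk_right t)).intervalIntegrable _ _
    have := (innerSL ℝ φ).intervalIntegral_comp_comm hi
    simp only [innerSL_apply_apply] at this
    rw [real_inner_comm, duhamel, ← this]
    simp only [real_inner_comm]
  rw [funext (e hK φ), e hK' ψ]
  have := hasDerivAt_parametric_primitive (F := fun t s => ⟪K (t - s) (f s), φ⟫)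
    (F' := fun t s => ⟪K' (t - s) (f s), ψ⟫) ((hc hK).inner continuous_const)
    ((hc hK').inner continuous_const) (fun t s => by
      have h1 := (hd (f s) (t - s)).scomp t ((hasDerivAt_id t).sub_const s)
      rw [one_smul] at h1
      exact h1) t
  simpa using this

/-! ### Almost everywhere bounds -/

/-- The constant function one. -/
def oneL2 : L2 0 1 := ofCont (fun _ => 1) continuous_const

theorem aebdd_iff {f : L2 0 1} {M : ℝ} : AEBdd f M ↔ -(M • oneL2) ≤ f ∧ f ≤ M • oneL2 := by
  have h1 : (M • oneL2 : L2 0 1) =ᵐ[volume.restrict (Ioo (0 : ℝ) 1)] fun _ => M := by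
    filter_upwards [Lp.coeFn_smul M oneL2, coeFn_ofCont (φ := fun _ => 1) continuous_const]
      with x h1 h2
    rw [h1, Pi.smul_apply, oneL2, h2]
    simp
  rw [← Lp.coeFn_le, ← Lp.coeFn_le]
  constructor
  · intro h
    constructor
    · filter_upwards [h1, Lp.coeFn_neg (M • oneL2), h] with x h1 h2 h3
      rw [h2, Pi.neg_apply, h1]
      exact (abs_le.1 h3).1
    · filter_upwards [h1, h] with x h1 h3
      rw [h1]
      exact (abs_le.1 h3).2
  · rintro ⟨ha, hb⟩
    filter_upwards [h1, Lp.coeFn_neg (M • oneL2), ha, hb] with x h1 h2 h3 h4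
    rw [h2, Pi.neg_apply, h1] at h3
    rw [h1] at h4
    exact abs_le.2 ⟨h3, h4⟩

theorem isClosed_aebdd (M : ℝ) : IsClosed {f : L2 0 1 | AEBdd f M} := by
  have e : {f : L2 0 1 | AEBdd f M} = {f | -(M • oneL2) ≤ f} ∩ {f | f ≤ M • oneL2} :=
    Set.ext fun f => aebdd_iff
  rw [e]
  exact isClosed_Ici.inter isClosed_Iic

theorem AEBdd.mono {f : L2 0 1} {M N : ℝ} (h : AEBdd f M) (hMN : M ≤ N) : AEBdd f N :=
  Eventually.mono h fun _ hx => hx.trans hMN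

theorem AEBdd.add {f g : L2 0 1} {M N : ℝ} (hf : AEBdd f M) (hg : AEBdd g N) :
    AEBdd (f + g) (M + N) := by
  filter_upwards [hf, hg, Lp.coeFn_add f g] with x h1 h2 h3
  rw [h3]
  exact (abs_add_le _ _).trans (add_le_add h1 h2)

theorem AEBdd.neg {f : L2 0 1} {M : ℝ} (hf : AEBdd f M) : AEBdd (-f) M := by
  filter_upwards [hf, Lp.coeFn_neg f] with x h1 h3
  rwa [h3, Pi.neg_apply, abs_neg]

theorem AEBdd.sub {f g : L2 0 1} {M N : ℝ} (hf : AEBdd f M) (hg : AEBdd g N) :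
    AEBdd (f - g) (M + N) := by
  rw [sub_eq_add_neg]
  exact hf.add hg.neg

theorem aebdd_zero : AEBdd 0 0 := by
  filter_upwards [Lp.coeFn_zero ℝ 2 (volume.restrict (Ioo (0 : ℝ) 1))] with x hx
  rw [hx]
  simp

instance isOrderedModule_L2 {a b : ℝ} : IsOrderedModule ℝ (L2 a b) :=
  IsOrderedModule.of_smul_nonneg fun c hc f hf => by
    rw [← Lp.coeFn_nonneg] at hf ⊢
    filter_upwards [hf, Lp.coeFn_smul c f] with x h1 h2
    rw [h2]
    exact mul_nonneg hc h1

theorem AEBdd.intervalIntegral {F : ℝ → L2 0 1} {m : ℝ → ℝ} (hF : Continuous F)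
    (hm : Continuous m) {a b : ℝ} (hab : a ≤ b) (h : ∀ s ∈ Icc a b, AEBdd (F s) (m s)) :
    AEBdd (∫ s in a..b, F s) (∫ s in a..b, m s) := by
  have hc : Continuous fun s => m s • oneL2 := hm.smul continuous_const
  rw [aebdd_iff, ← intervalIntegral.integral_smul_const, ← intervalIntegral.integral_neg,
    intervalIntegral.integral_of_le hab, intervalIntegral.integral_of_le hab,
    intervalIntegral.integral_of_le hab]
  refine ⟨integral_mono_ae (hc.neg.intervalIntegrable a b).1 (hF.intervalIntegrable a b).1 ?_,
    integral_mono_ae (hF.intervalIntegrable a b).1 (hc.intervalIntegrable a b).1 ?_⟩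
  · filter_upwards [ae_restrict_mem measurableSet_Ioc] with s hs
    exact (aebdd_iff.1 (h s (Ioc_subset_Icc_self hs))).1
  · filter_upwards [ae_restrict_mem measurableSet_Ioc] with s hs
    exact (aebdd_iff.1 (h s (Ioc_subset_Icc_self hs))).2

theorem AEBdd.duhamel {K : ℝ → L2 0 1 →L[ℝ] L2 0 1}
    (hK : Continuous fun p : ℝ × L2 0 1 => K p.1 p.2)
    (hb : ∀ (f : L2 0 1) (M τ : ℝ), AEBdd f M → AEBdd (K τ f) M)
    {f : ℝ → L2 0 1} {m : ℝ → ℝ} (hf : Continuous f) (hm : Continuous m) {t : ℝ} (ht : 0 ≤ t)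
    (h : ∀ s ∈ Icc 0 t, AEBdd (f s) (m s)) :
    AEBdd (duhamel K f t) (∫ s in (0 : ℝ)..t, m s) :=
  AEBdd.intervalIntegral (hK.comp ((continuous_const.sub continuous_id).prodMk hf)) hm ht
    fun s hs => hb _ _ _ (h s hs)

/-! ### The space `H¹(0,1)` -/

@[simp] theorem der_add {k : ℕ} {a b : ℝ} (f g : Sobolev k a b) (j : Fin (k + 1)) :
    der (f + g) j = der f j + der g j := rfl

@[simp] theorem der_smul {k : ℕ} {a b : ℝ} (c : ℝ) (f : Sobolev k a b) (j : Fin (k + 1)) :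
    der (c • f) j = c • der f j := rfl

@[simp] theorem der_zero {k : ℕ} {a b : ℝ} (j : Fin (k + 1)) :
    der (0 : Sobolev k a b) j = 0 := rfl

theorem continuous_der {k : ℕ} {a b : ℝ} (j : Fin (k + 1)) :
    Continuous fun f : Sobolev k a b => der f j :=
  (PiLp.continuous_apply 2 _ j).comp continuous_subtype_val

theorem norm_der_le {k : ℕ} {a b : ℝ} (f : Sobolev k a b) (j : Fin (k + 1)) :
    ‖der f j‖ ≤ ‖f‖ := PiLp.norm_apply_le (p := 2) f.1 j

theorem hasWeakDeriv_der {a b : ℝ} (f : Sobolev 1 a b) : HasWeakDeriv (der f 0) (der f 1) := f.2 0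

theorem Sobolev.ext_of_der_zero {a b : ℝ} {f g : Sobolev 1 a b} (h : der f 0 = der g 0) :
    f = g := by
  have h1 : der f 1 = der g 1 := by
    have hf := hasWeakDeriv_der f
    rw [h] at hf
    exact hf.unique (hasWeakDeriv_der g)
  refine Subtype.ext (PiLp.ext fun i => ?_)
  fin_cases i
  exacts [h, h1]

/-- The element of `H¹(a,b)` given by a function and its weak derivative. -/
def mkH1 {a b : ℝ} (f g : L2 a b) (h : HasWeakDeriv f g) : Sobolev 1 a b :=
  ⟨WithLp.toLp 2 ![f, g], fun i => by
    fin_cases i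
    exact h⟩

@[simp] theorem der_mkH1_zero {a b : ℝ} {f g : L2 a b} (h : HasWeakDeriv f g) :
    der (mkH1 f g h) 0 = f := rfl

@[simp] theorem der_mkH1_one {a b : ℝ} {f g : L2 a b} (h : HasWeakDeriv f g) :
    der (mkH1 f g h) 1 = g := rfl

theorem continuous_mkH1 {a b : ℝ} {f g : ℝ → L2 a b} (h : ∀ t, HasWeakDeriv (f t) (g t))
    (hf : Continuous f) (hg : Continuous g) : Continuous fun t => mkH1 (f t) (g t) (h t) := by
  refine Continuous.subtype_mk ((PiLp.continuous_toLp 2 _).comp (continuous_pi fun i => ?_)) _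
  fin_cases i
  exacts [hf, hg]

theorem contRep_add {a b : ℝ} (hab : a < b) {f f' g g' : L2 a b} (hf : HasWeakDeriv f f')
    (hg : HasWeakDeriv g g') {x : ℝ} (hx : x ∈ Icc a b) :
    contRep (f + g) x = contRep f x + contRep g x := by
  refine contRep_eqOn hab (v := fun x => contRep f x + contRep g x)
    ((hf.continuousOn_contRep hab).add (hg.continuousOn_contRep hab)) ?_ hx
  filter_upwards [Lp.coeFn_add f g, hf.ae_eq_contRep hab, hg.ae_eq_contRep hab] with x h1 h2 h3
  rw [h1, Pi.add_apply, h2, h3]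

theorem contRep_smul {a b : ℝ} (hab : a < b) (c : ℝ) {f f' : L2 a b} (hf : HasWeakDeriv f f')
    {x : ℝ} (hx : x ∈ Icc a b) : contRep (c • f) x = c * contRep f x := by
  refine contRep_eqOn hab (v := fun x => c * contRep f x)
    (continuousOn_const.mul (hf.continuousOn_contRep hab)) ?_ hx
  filter_upwards [Lp.coeFn_smul c f, hf.ae_eq_contRep hab] with x h1 h2
  rw [h1, Pi.smul_apply, h2, smul_eq_mul]

theorem val_add {f g : Sobolev 1 0 1} {x : ℝ} (hx : x ∈ Icc (0 : ℝ) 1) :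
    val (f + g) x = val f x + val g x :=
  contRep_add zero_lt_one (hasWeakDeriv_der f) (hasWeakDeriv_der g) hx

theorem val_smul (c : ℝ) {f : Sobolev 1 0 1} {x : ℝ} (hx : x ∈ Icc (0 : ℝ) 1) :
    val (c • f) x = c * val f x :=
  contRep_smul zero_lt_one c (hasWeakDeriv_der f) hx

theorem val_ae (f : Sobolev 1 0 1) : der f 0 =ᵐ[volume.restrict (Ioo (0 : ℝ) 1)] val f :=
  (hasWeakDeriv_der f).ae_eq_contRep zero_lt_one

theorem continuousOn_val (f : Sobolev 1 0 1) : ContinuousOn (val f) (Icc 0 1) :=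
  (hasWeakDeriv_der f).continuousOn_contRep zero_lt_one

theorem val_bound_of_aebdd {f : Sobolev 1 0 1} {M : ℝ} (h : AEBdd (der f 0) M) {x : ℝ}
    (hx : x ∈ Icc (0 : ℝ) 1) : |val f x| ≤ M := by
  have h1 : ∀ᵐ x ∂(volume.restrict (Ioo (0 : ℝ) 1)), max |val f x| M = M := by
    filter_upwards [h, val_ae f] with x h1 h2
    rw [← h2]
    exact max_eq_right h1
  have h2 := eqOn_Icc_of_ae_Ioo zero_lt_one
    (((continuousOn_val f).abs).sup continuousOn_const) (continuousOn_const (c := M)) h1 hx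
  exact max_eq_right_iff.1 h2

theorem aebdd_of_val_bound {f : Sobolev 1 0 1} {M : ℝ} (h : ∀ x ∈ Icc (0 : ℝ) 1, |val f x| ≤ M) :
    AEBdd (der f 0) M := by
  filter_upwards [val_ae f, ae_restrict_mem measurableSet_Ioo] with x h1 h2
  rw [h1]
  exact h x (Ioo_subset_Icc_self h2)

theorem exists_val_bound : ∃ C : ℝ, 0 ≤ C ∧ ∀ f : Sobolev 1 0 1, ∀ x ∈ Icc (0 : ℝ) 1,
    |val f x| ≤ C * ‖f‖ := by
  obtain ⟨C, hC, h⟩ := HasWeakDeriv.exists_bound (zero_lt_one (α := ℝ))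
  refine ⟨C * 2, by positivity, fun f x hx => (h (hasWeakDeriv_der f) x hx).trans ?_⟩
  have h0 := norm_der_le f 0
  have h1 := norm_der_le f 1
  calc C * (‖der f 0‖ + ‖der f 1‖) ≤ C * (‖f‖ + ‖f‖) := by gcongr
    _ = C * 2 * ‖f‖ := by ring

theorem val_continuousOn {T : ℝ} {u : ℝ → Sobolev 1 0 1} (hu : ContinuousOn u (Icc 0 T)) {x : ℝ}
    (hx : x ∈ Icc (0 : ℝ) 1) : ContinuousOn (fun t => val (u t) x) (Icc 0 T) := by
  obtain ⟨C, hC, h⟩ := exists_val_bound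
  intro t ht
  have h1 : Tendsto (fun s => C * ‖u s - u t‖) (𝓝[Icc 0 T] t) (𝓝 0) := by
    have := (((hu t ht).sub (continuousWithinAt_const (b := u t))).norm).const_mul C
    simpa [ContinuousWithinAt] using this
  refine tendsto_iff_dist_tendsto_zero.2
    (squeeze_zero (fun _ => dist_nonneg) (fun s => ?_) h1)
  have h2 : val (u s - u t) x = val (u s) x - val (u t) x := by
    rw [sub_eq_add_neg, ← neg_one_smul ℝ, val_add hx, val_smul _ hx]
    ring
  rw [Real.dist_eq, ← h2]
  exact h _ x hx

theorem hasWeakDeriv_ofCont {φ ψ : ℝ → ℝ} (hφ : Continuous φ) (hψ : Continuous ψ)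
    (hd : ∀ x, HasDerivAt φ (ψ x) x) : HasWeakDeriv (ofCont φ hφ) (ofCont ψ hψ) := by
  intro θ hθ hc hs
  have h0 : θ 0 = 0 := image_eq_zero_of_notMem_tsupport fun hx => lt_irrefl _ (hs hx).1
  have h1 : θ 1 = 0 := image_eq_zero_of_notMem_tsupport fun hx => lt_irrefl _ (hs hx).2
  have hθd : Continuous (deriv θ) := hθ.continuous_deriv (by simp)
  have key := intervalIntegral.integral_mul_deriv_eq_deriv_mul (a := 0) (b := 1)
    (fun x _ => hd x) (fun x _ => (hθ.differentiable (by simp) x).hasDerivAt)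
    (hψ.intervalIntegrable _ _) (hθd.intervalIntegrable _ _)
  rw [h0, h1, mul_zero, mul_zero, sub_zero, zero_sub, intervalIntegral_eq_Ioo zero_le_one,
    intervalIntegral_eq_Ioo zero_le_one] at key
  have e1 : ∫ x in Ioo (0 : ℝ) 1, ofCont φ hφ x * deriv θ x
      = ∫ x in Ioo (0 : ℝ) 1, φ x * deriv θ x :=
    integral_congr_ae ((coeFn_ofCont hφ).mono fun x hx => by simp only [hx])
  have e2 : ∫ x in Ioo (0 : ℝ) 1, ofCont ψ hψ x * θ x = ∫ x in Ioo (0 : ℝ) 1, ψ x * θ x :=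
    integral_congr_ae ((coeFn_ofCont hψ).mono fun x hx => by simp only [hx])
  rw [e1, e2, key]

/-- The affine function `x ↦ k + l x`, as an element of `H¹(0,1)`. -/
def affineH1 (k l : ℝ) : Sobolev 1 0 1 :=
  mkH1 (ofCont (fun x => k + l * x) (by fun_prop)) (ofCont (fun _ => l) continuous_const)
    (hasWeakDeriv_ofCont _ _ fun x => by
      simpa using ((hasDerivAt_id x).const_mul l).const_add k)

theorem der_affineH1_zero_ae (k l : ℝ) :
    der (affineH1 k l) 0 =ᵐ[volume.restrict (Ioo (0 : ℝ) 1)] fun x => k + l * x :=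
  coeFn_ofCont (by fun_prop)

theorem der_affineH1_one_ae (k l : ℝ) :
    der (affineH1 k l) 1 =ᵐ[volume.restrict (Ioo (0 : ℝ) 1)] fun _ => l :=
  coeFn_ofCont continuous_const

theorem val_affineH1 (k l : ℝ) {x : ℝ} (hx : x ∈ Icc (0 : ℝ) 1) : val (affineH1 k l) x = k + l * x :=
  contRep_eqOn zero_lt_one (v := fun x => k + l * x) (by fun_prop)
    (coeFn_ofCont (φ := fun x => k + l * x) (by fun_prop)) hx

/-! ### Linear combinations and uniqueness of classical solutions -/

theorem IsClassicalSolution.hasDerivWithinAt_p {T : ℝ} {f : ℝ → ℝ → ℝ} {g₀ g₁ p₀ u₀ : ℝ → ℝ}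
    {p u : ℝ → Sobolev 1 0 1} (h : IsClassicalSolution T f g₀ g₁ p₀ u₀ p u) {t : ℝ}
    (ht : t ∈ Icc 0 T) :
    HasDerivWithinAt (fun s => der (p s) 0) (-der (u t) 1) (Icc 0 T) t := by
  have h1 := ((h.contDiffOn_p.differentiableOn one_ne_zero) t ht).hasDerivWithinAt
  rwa [eq_neg_of_add_eq_zero_left (h.mass t ht)] at h1

theorem IsClassicalSolution.exists_hasDerivWithinAt_u {T : ℝ} {f : ℝ → ℝ → ℝ}
    {g₀ g₁ p₀ u₀ : ℝ → ℝ} {p u : ℝ → Sobolev 1 0 1}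
    (h : IsClassicalSolution T f g₀ g₁ p₀ u₀ p u) {t : ℝ} (ht : t ∈ Icc 0 T) :
    ∃ F : L2 0 1, F =ᵐ[volume.restrict (Ioo (0 : ℝ) 1)] f t ∧
      HasDerivWithinAt (fun s => der (u s) 0) (F - der (p t) 1) (Icc 0 T) t := by
  have h1 := ((h.contDiffOn_u.differentiableOn one_ne_zero) t ht).hasDerivWithinAt
  refine ⟨derivWithin (fun s => der (u s) 0) (Icc 0 T) t + der (p t) 1, ?_, by
    rwa [add_sub_cancel_right]⟩
  filter_upwards [h.momentum t ht, Lp.coeFn_add (derivWithin (fun s => der (u s) 0) (Icc 0 T) t)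
    (der (p t) 1)] with x h1 h2
  rw [h2, Pi.add_apply, h1]

theorem IsClassicalSolution.add_smul {T : ℝ} (hT : 0 < T) {f f' : ℝ → ℝ → ℝ}
    {g₀ g₁ p₀ u₀ g₀' g₁' p₀' u₀' : ℝ → ℝ} {p u p' u' : ℝ → Sobolev 1 0 1}
    (h : IsClassicalSolution T f g₀ g₁ p₀ u₀ p u)
    (h' : IsClassicalSolution T f' g₀' g₁' p₀' u₀' p' u') (c : ℝ) :
    IsClassicalSolution T (fun t x => f t x + c * f' t x) (fun t => g₀ t + c * g₀' t)
      (fun t => g₁ t + c * g₁' t) (fun x => p₀ x + c * p₀' x) (fun x => u₀ x + c * u₀' x)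
      (fun t => p t + c • p' t) (fun t => u t + c • u' t) where
  contDiffOn_p := h.contDiffOn_p.add (h'.contDiffOn_p.const_smul c)
  contDiffOn_u := h.contDiffOn_u.add (h'.contDiffOn_u.const_smul c)
  continuousOn_p := h.continuousOn_p.add (h'.continuousOn_p.const_smul c)
  continuousOn_u := h.continuousOn_u.add (h'.continuousOn_u.const_smul c)
  mass t ht := by
    have h1 : HasDerivWithinAt (fun s => der (p s + c • p' s) 0) _ (Icc 0 T) t :=
      (h.hasDerivWithinAt_p ht).add ((h'.hasDerivWithinAt_p ht).const_smul c)
    rw [h1.derivWithin (uniqueDiffOn_Icc hT t ht), der_add, der_smul, smul_neg]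
    abel
  momentum t ht := by
    obtain ⟨F, hF, hd⟩ := h.exists_hasDerivWithinAt_u ht
    obtain ⟨F', hF', hd'⟩ := h'.exists_hasDerivWithinAt_u ht
    have h1 : HasDerivWithinAt (fun s => der (u s + c • u' s) 0) _ (Icc 0 T) t :=
      hd.add (hd'.const_smul c)
    rw [h1.derivWithin (uniqueDiffOn_Icc hT t ht), der_add, der_smul]
    have e : F - der (p t) 1 + c • (F' - der (p' t) 1) = (F + c • F')
        - (der (p t) 1 + c • der (p' t) 1) := by
      rw [smul_sub]
      abel
    rw [e]
    filter_upwards [hF, hF', Lp.coeFn_sub (F + c • F') (der (p t) 1 + c • der (p' t) 1),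
      Lp.coeFn_add F (c • F'), Lp.coeFn_smul c F'] with x h1 h2 h3 h4 h5
    rw [h3, Pi.sub_apply, sub_add_cancel, h4, Pi.add_apply, h5, Pi.smul_apply, h1, h2, smul_eq_mul]
  boundary_left t ht := by
    rw [val_add (by simp), val_smul _ (by simp), h.boundary_left t ht, h'.boundary_left t ht]
  boundary_right t ht := by
    rw [val_add (by simp), val_smul _ (by simp), h.boundary_right t ht, h'.boundary_right t ht]
  initial_p x hx := by
    rw [val_add (Ioo_subset_Icc_self hx), val_smul _ (Ioo_subset_Icc_self hx), h.initial_p x hx,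
      h'.initial_p x hx]
  initial_u x hx := by
    rw [val_add (Ioo_subset_Icc_self hx), val_smul _ (Ioo_subset_Icc_self hx), h.initial_u x hx,
      h'.initial_u x hx]

theorem der_eq_zero_of_val {f : Sobolev 1 0 1} (h : ∀ x ∈ Ioo (0 : ℝ) 1, val f x = 0) :
    der f 0 = 0 := by
  refine Lp.ext ?_
  filter_upwards [val_ae f, ae_restrict_mem measurableSet_Ioo,
    Lp.coeFn_zero ℝ 2 (volume.restrict (Ioo (0 : ℝ) 1))] with x h1 h2 h3
  rw [h1, h x h2, h3]
  rfl

theorem IsClassicalSolution.eq_zero_of_dissipative {T : ℝ} {f : ℝ → ℝ → ℝ}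
    {g₀ g₁ p₀ u₀ : ℝ → ℝ} {p u : ℝ → Sobolev 1 0 1}
    (h : IsClassicalSolution T f g₀ g₁ p₀ u₀ p u) (hg₀ : ∀ t ∈ Icc 0 T, g₀ t = 0)
    (hg₁ : ∀ t ∈ Icc 0 T, g₁ t = 0) (hp₀ : ∀ x, p₀ x = 0) (hu₀ : ∀ x, u₀ x = 0)
    (hf : ∀ t ∈ Icc 0 T, ∀ x ∈ Icc (0 : ℝ) 1, f t x * val (u t) x ≤ 0) {t : ℝ} (ht : t ∈ Icc 0 T) :
    p t = 0 ∧ u t = 0 := by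
  set E : ℝ → ℝ := fun t => ‖der (p t) 0‖ ^ 2 + ‖der (u t) 0‖ ^ 2 with hE
  have hder : ∀ t ∈ Icc 0 T, ∃ e ≤ 0, HasDerivWithinAt E e (Icc 0 T) t := by
    intro t ht
    obtain ⟨F, hF, hd⟩ := h.exists_hasDerivWithinAt_u ht
    refine ⟨_, ?_, (h.hasDerivWithinAt_p ht).norm_sq.add hd.norm_sq⟩
    have hibp := (hasWeakDeriv_der (p t)).inner_add_inner zero_lt_one (hasWeakDeriv_der (u t))
    have hu0 : contRep (der (u t) 0) 0 = 0 := (h.boundary_left t ht).trans (hg₀ t ht)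
    have hu1 : contRep (der (u t) 0) 1 = 0 := (h.boundary_right t ht).trans (hg₁ t ht)
    rw [hu0, hu1, mul_zero, mul_zero, sub_zero] at hibp
    have hle : ⟪der (u t) 0, F⟫ ≤ 0 := by
      rw [L2.inner_eq]
      refine integral_nonpos_of_ae ?_
      filter_upwards [hF, val_ae (u t), ae_restrict_mem measurableSet_Ioo] with x h1 h2 h3
      rw [h1, h2, mul_comm]
      exact hf t ht x (Ioo_subset_Icc_self h3)
    rw [inner_neg_right, inner_sub_right, real_inner_comm (der (p t) 1) (der (u t) 0)]
    linarith
  have hanti : AntitoneOn E (Icc 0 T) := by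
    refine antitoneOn_of_deriv_nonpos (convex_Icc 0 T) (fun t ht => ?_) (fun t ht => ?_)
      (fun t ht => ?_)
    · obtain ⟨e, _, he⟩ := hder t ht
      exact he.continuousWithinAt
    · obtain ⟨e, _, he⟩ := hder t (interior_subset ht)
      exact (he.mono interior_subset).differentiableWithinAt
    · obtain ⟨e, hle, he⟩ := hder t (interior_subset ht)
      rw [(he.hasDerivAt (mem_interior_iff_mem_nhds.1 ht)).deriv]
      exact hle
  have h0T : (0 : ℝ) ∈ Icc 0 T := ⟨le_rfl, ht.1.trans ht.2⟩
  have hE0 : E 0 = 0 := by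
    have hp : der (p 0) 0 = 0 :=
      der_eq_zero_of_val fun x hx => (h.initial_p x hx).trans (hp₀ x)
    have hu : der (u 0) 0 = 0 :=
      der_eq_zero_of_val fun x hx => (h.initial_u x hx).trans (hu₀ x)
    simp [hE, hp, hu]
  have hEt : E t ≤ 0 := hE0 ▸ hanti h0T ht ht.1
  have h1 : ‖der (p t) 0‖ ^ 2 = 0 := by nlinarith [sq_nonneg ‖der (p t) 0‖, sq_nonneg ‖der (u t) 0‖]
  have h2 : ‖der (u t) 0‖ ^ 2 = 0 := by nlinarith [sq_nonneg ‖der (p t) 0‖, sq_nonneg ‖der (u t) 0‖]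
  exact ⟨Sobolev.ext_of_der_zero (norm_eq_zero.1 (pow_eq_zero_iff two_ne_zero |>.1 h1)),
    Sobolev.ext_of_der_zero (norm_eq_zero.1 (pow_eq_zero_iff two_ne_zero |>.1 h2))⟩

theorem IsClassicalSolution.eqOn_of_dissipative {T : ℝ} (hT : 0 < T) {f f' : ℝ → ℝ → ℝ}
    {g₀ g₁ p₀ u₀ : ℝ → ℝ} {p u p' u' : ℝ → Sobolev 1 0 1}
    (h : IsClassicalSolution T f g₀ g₁ p₀ u₀ p u)
    (h' : IsClassicalSolution T f' g₀ g₁ p₀ u₀ p' u')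
    (hf : ∀ t ∈ Icc 0 T, ∀ x ∈ Icc (0 : ℝ) 1,
      (f t x - f' t x) * (val (u t) x - val (u' t) x) ≤ 0) :
    EqOn p p' (Icc 0 T) ∧ EqOn u u' (Icc 0 T) := by
  have hd := h.add_smul hT h' (-1)
  have key := fun t ht => hd.eq_zero_of_dissipative (fun _ _ => by ring) (fun _ _ => by ring)
    (fun _ => by ring) (fun _ => by ring) (fun t ht x hx => by
      rw [val_add hx, val_smul _ hx]
      have := hf t ht x hx
      linarith) (t := t) ht
  constructor
  · intro t ht
    have := (key t ht).1
    rwa [neg_one_smul, ← sub_eq_add_neg, sub_eq_zero] at this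
  · intro t ht
    have := (key t ht).2
    rwa [neg_one_smul, ← sub_eq_add_neg, sub_eq_zero] at this

/-! ### Classical solutions of the linear wave system with a source -/

theorem exists_linear_wave {f g : ℝ → L2 0 1} (hf : ∀ t, HasDerivAt f (g t) t)
    (hg : Continuous g) :
    ∃ P U : ℝ → Sobolev 1 0 1, Continuous P ∧ Continuous U ∧
      (∀ t, der (P t) 0 = duhamel waveSin f t) ∧ (∀ t, der (U t) 0 = duhamel waveCos f t) ∧
      (∀ t, HasDerivAt (fun t => der (P t) 0) (-der (U t) 1) t) ∧
      (∀ t, HasDerivAt (fun t => der (U t) 0) (f t - der (P t) 1) t) ∧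
      ∀ t, val (U t) 0 = 0 ∧ val (U t) 1 = 0 := by
  have hfc : Continuous f := continuous_iff_continuousAt.2 fun t => (hf t).continuousAt
  set P' : ℝ → L2 0 1 := fun t => waveSin t (f 0) + duhamel waveSin g t
  set U' : ℝ → L2 0 1 := fun t => waveCos t (f 0) + duhamel waveCos g t
  have hP' : ∀ t, HasDerivAt (duhamel waveSin f) (P' t) t :=
    hasDerivAt_duhamel continuous_waveSin hf hg
  have hU' : ∀ t, HasDerivAt (duhamel waveCos f) (U' t) t :=
    hasDerivAt_duhamel continuous_waveCos hf hg
  have hP'c : Continuous P' := (continuous_waveSin.comp (continuous_id.prodMk continuous_const)).add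
    (continuous_duhamel continuous_waveSin hg)
  have hU'c : Continuous U' := (continuous_waveCos.comp (continuous_id.prodMk continuous_const)).add
    (continuous_duhamel continuous_waveCos hg)
  have hUw : ∀ t, HasWeakDeriv (duhamel waveCos f t) (-P' t) := by
    intro t φ hφ hc hs
    have h1 := hasDerivAt_inner_duhamel continuous_waveSin continuous_waveCos
      (φ := ofCont φ hφ.continuous) (ψ := ofCont (deriv φ) (hφ.continuous_deriv (by simp)))
      (fun f τ => hasDerivAt_inner_waveSin f hφ hc hs τ) hfc t
    have h2 := ((hP' t).inner ℝ (hasDerivAt_const t (ofCont φ hφ.continuous)))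
    have h3 := h1.unique h2
    rw [waveSin_zero, inner_zero_left, zero_add, inner_zero_right, zero_add, inner_ofCont] at h3
    rw [h3, ← inner_ofCont _ hφ.continuous, inner_neg_left, neg_neg]
  have hPw : ∀ t, HasWeakDeriv (duhamel waveSin f t) (f t - U' t) := by
    intro t φ hφ hc hs
    have h1 := hasDerivAt_inner_duhamel continuous_waveCos continuous_waveSin
      (φ := ofCont φ hφ.continuous) (ψ := ofCont (deriv φ) (hφ.continuous_deriv (by simp)))
      (fun f τ => hasDerivAt_inner_waveCos f hφ hc hs τ) hfc t
    have h2 := ((hU' t).inner ℝ (hasDerivAt_const t (ofCont φ hφ.continuous)))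
    have h3 := h1.unique h2
    rw [waveCos_zero, inner_zero_right, zero_add,
      inner_ofCont _ (hφ.continuous_deriv (by simp))] at h3
    rw [← inner_ofCont _ hφ.continuous, inner_sub_left]
    linarith
  have htr : ∀ t, ∀ k : ℕ, contRep (duhamel waveCos f t) 1 * Real.cos (k * Real.pi)
      = contRep (duhamel waveCos f t) 0 := by
    intro t k
    have h1 := hasDerivAt_inner_duhamel continuous_waveSin continuous_waveCos
      (fun f τ => hasDerivAt_inner_waveSin_cos f k τ) hfc t
    have h2 := ((hP' t).inner ℝ (hasDerivAt_const t (ofCont _ (continuous_cos_nat k))))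
    have h3 := h1.unique h2
    have hw : HasWeakDeriv (ofCont _ (continuous_cos_nat k))
        ((-(k * Real.pi)) • ofCont _ (continuous_sin_nat k)) := by
      have e : (-(k * Real.pi)) • ofCont _ (continuous_sin_nat k)
          = ofCont (fun x => -Real.sin (k * Real.pi * x) * (k * Real.pi)) (by fun_prop) := by
        refine Lp.ext ?_
        filter_upwards [Lp.coeFn_smul (-(k * Real.pi)) (ofCont _ (continuous_sin_nat k)),
          coeFn_ofCont (continuous_sin_nat k), coeFn_ofCont
          (φ := fun x => -Real.sin (k * Real.pi * x) * (k * Real.pi)) (by fun_prop)] with x h1 h2 h3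
        rw [h1, h3, Pi.smul_apply, h2, smul_eq_mul]
        ring
      rw [e]
      refine hasWeakDeriv_ofCont _ _ fun x => ?_
      simpa using ((hasDerivAt_id x).const_mul (k * Real.pi)).cos
    have h4 := (hUw t).inner_add_inner zero_lt_one hw
    rw [waveSin_zero, inner_zero_left, zero_add, inner_zero_right, zero_add] at h3
    rw [h3, inner_neg_left, neg_add_cancel] at h4
    have e0 := contRep_eqOn zero_lt_one (continuous_cos_nat k).continuousOn
      (coeFn_ofCont (continuous_cos_nat k)) (left_mem_Icc.2 zero_le_one)
    have e1 := contRep_eqOn zero_lt_one (continuous_cos_nat k).continuousOn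
      (coeFn_ofCont (continuous_cos_nat k)) (right_mem_Icc.2 zero_le_one)
    rw [e0, e1] at h4
    simp only [mul_one, mul_zero, Real.cos_zero] at h4
    linarith
  refine ⟨fun t => mkH1 _ _ (hPw t), fun t => mkH1 _ _ (hUw t), ?_, ?_, fun _ => rfl, fun _ => rfl,
    fun t => ?_, fun t => ?_, fun t => ?_⟩
  · exact continuous_mkH1 _ (continuous_duhamel continuous_waveSin hfc) (hfc.sub hU'c)
  · exact continuous_mkH1 _ (continuous_duhamel continuous_waveCos hfc) hP'c.neg
  · simpa using hP' t
  · simpa using hU' t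
  · have h0 := htr t 0
    have h1 := htr t 1
    simp only [Nat.cast_zero, zero_mul, Real.cos_zero, mul_one, Nat.cast_one, one_mul,
      Real.cos_pi] at h0 h1
    constructor
    · change contRep (duhamel waveCos f t) 0 = 0
      linarith
    · change contRep (duhamel waveCos f t) 1 = 0
      linarith

/-- The affine lifting `(1 - x) γ₀ + x γ₁` of boundary values. -/
def lift (γ₀ γ₁ : ℝ) : Sobolev 1 0 1 := affineH1 γ₀ (γ₁ - γ₀)

theorem affineH1_eq (k l : ℝ) : affineH1 k l = k • affineH1 1 0 + l • affineH1 0 1 := by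
  refine Sobolev.ext_of_der_zero (Lp.ext ?_)
  rw [der_add, der_smul, der_smul]
  filter_upwards [der_affineH1_zero_ae k l, der_affineH1_zero_ae 1 0, der_affineH1_zero_ae 0 1,
    Lp.coeFn_add (k • der (affineH1 1 0) 0) (l • der (affineH1 0 1) 0),
    Lp.coeFn_smul k (der (affineH1 1 0) 0), Lp.coeFn_smul l (der (affineH1 0 1) 0)]
    with x h1 h2 h3 h4 h5 h6
  rw [h1, h4, Pi.add_apply, h5, h6, Pi.smul_apply, Pi.smul_apply, h2, h3]
  simp

theorem lift_eq (γ₀ γ₁ : ℝ) :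
    lift γ₀ γ₁ = γ₀ • affineH1 1 0 + (γ₁ - γ₀) • affineH1 0 1 := affineH1_eq _ _

theorem hasDerivAt_lift {γ₀ γ₁ γ₀' γ₁' : ℝ → ℝ} {t : ℝ} (h₀ : HasDerivAt γ₀ (γ₀' t) t)
    (h₁ : HasDerivAt γ₁ (γ₁' t) t) :
    HasDerivAt (fun t => lift (γ₀ t) (γ₁ t)) (lift (γ₀' t) (γ₁' t)) t := by
  simp only [lift_eq]
  exact (h₀.smul_const _).add ((h₁.sub h₀).smul_const _)

theorem continuous_lift {γ₀ γ₁ : ℝ → ℝ} (h₀ : Continuous γ₀) (h₁ : Continuous γ₁) :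
    Continuous fun t => lift (γ₀ t) (γ₁ t) := by
  simp only [lift_eq]
  exact (h₀.smul continuous_const).add ((h₁.sub h₀).smul continuous_const)

/-- The evaluation of the zeroth derivative as a bounded operator. -/
def derCLM (j : Fin 2) : Sobolev 1 0 1 →L[ℝ] L2 0 1 where
  toFun f := der f j
  map_add' _ _ := rfl
  map_smul' _ _ := rfl
  cont := continuous_der j

theorem hasDerivAt_der_lift {γ₀ γ₁ γ₀' γ₁' : ℝ → ℝ} {t : ℝ} (h₀ : HasDerivAt γ₀ (γ₀' t) t)
    (h₁ : HasDerivAt γ₁ (γ₁' t) t) :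
    HasDerivAt (fun t => der (lift (γ₀ t) (γ₁ t)) 0) (der (lift (γ₀' t) (γ₁' t)) 0) t :=
  (derCLM 0).hasFDerivAt.comp_hasDerivAt t (hasDerivAt_lift h₀ h₁)

theorem exists_wave_with_boundary {T : ℝ} (hT : 0 < T) {f g : ℝ → L2 0 1}
    (hf : ∀ t, HasDerivAt f (g t) t) (hg : Continuous g) {γ₀ γ₁ γ₀' γ₁' : ℝ → ℝ}
    (h₀ : ∀ t, HasDerivAt γ₀ (γ₀' t) t) (h₁ : ∀ t, HasDerivAt γ₁ (γ₁' t) t)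
    (hc₀ : Continuous γ₀') (hc₁ : Continuous γ₁') (hz₀ : γ₀ 0 = 0) (hz₁ : γ₁ 0 = 0) (c : ℝ) :
    ∃ p u : ℝ → Sobolev 1 0 1,
      (∀ t, der (p t) 0 = duhamel waveSin f t
        + der (affineH1 (c - ∫ s in (0 : ℝ)..t, (γ₁ s - γ₀ s)) 0) 0) ∧
      (∀ t, der (u t) 0 = duhamel waveCos f t + der (lift (γ₀ t) (γ₁ t)) 0) ∧
      ∀ (φ : ℝ → ℝ → ℝ) (g₀ g₁ : ℝ → ℝ), EqOn g₀ γ₀ (Icc 0 T) → EqOn g₁ γ₁ (Icc 0 T) →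
        (∀ t ∈ Icc 0 T, (f t + der (lift (γ₀' t) (γ₁' t)) 0 : L2 0 1)
          =ᵐ[volume.restrict (Ioo (0 : ℝ) 1)] φ t) →
        IsClassicalSolution T φ g₀ g₁ (fun _ => c) (fun _ => 0) p u := by
  obtain ⟨P, U, hPc, hUc, hP, hU, hPd, hUd, htr⟩ := exists_linear_wave hf hg
  have hfc : Continuous f := continuous_iff_continuousAt.2 fun t => (hf t).continuousAt
  have hγ₀ : Continuous γ₀ := continuous_iff_continuousAt.2 fun t => (h₀ t).continuousAt
  have hγ₁ : Continuous γ₁ := continuous_iff_continuousAt.2 fun t => (h₁ t).continuousAt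
  set m : ℝ → ℝ := fun t => c - ∫ s in (0 : ℝ)..t, (γ₁ s - γ₀ s) with hm
  have hmd : ∀ t, HasDerivAt m (-(γ₁ t - γ₀ t)) t := fun t =>
    (intervalIntegral.integral_hasDerivAt_right ((hγ₁.sub hγ₀).intervalIntegrable _ _)
      ((hγ₁.sub hγ₀).stronglyMeasurableAtFilter _ _) (hγ₁.sub hγ₀).continuousAt).const_sub c
  have hmc : Continuous m := continuous_iff_continuousAt.2 fun t => (hmd t).continuousAt
  have haff : ∀ t, affineH1 (m t) 0 = m t • affineH1 1 0 := fun t => by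
    rw [affineH1_eq, zero_smul, add_zero]
  have hone : der (affineH1 1 0) 1 = 0 := by
    refine Lp.ext ?_
    filter_upwards [der_affineH1_one_ae 1 0, Lp.coeFn_zero ℝ 2 (volume.restrict (Ioo (0 : ℝ) 1))]
      with x h1 h2
    rw [h1, h2]
    rfl
  have hone' : der (affineH1 0 1) 1 = der (affineH1 1 0) 0 := by
    refine Lp.ext ?_
    filter_upwards [der_affineH1_one_ae 0 1, der_affineH1_zero_ae 1 0] with x h1 h2
    rw [h1, h2]
    simp
  set p : ℝ → Sobolev 1 0 1 := fun t => P t + affineH1 (m t) 0 with hp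
  set u : ℝ → Sobolev 1 0 1 := fun t => U t + lift (γ₀ t) (γ₁ t) with hu
  have hpc : Continuous p := by
    simp only [hp, haff]
    exact hPc.add (hmc.smul continuous_const)
  have huc : Continuous u := hUc.add (continuous_lift hγ₀ hγ₁)
  have hpd : ∀ t, HasDerivAt (fun t => der (p t) 0) (-der (u t) 1) t := by
    intro t
    simp only [hp, hu, haff, der_add, der_smul, lift_eq, hone, hone', smul_zero, zero_add, neg_add,
      ← neg_smul]
    exact (hPd t).add ((hmd t).smul_const _)
  have hud : ∀ t, HasDerivAt (fun t => der (u t) 0)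
      (f t + der (lift (γ₀' t) (γ₁' t)) 0 - der (p t) 1) t := by
    intro t
    refine ((hUd t).add (hasDerivAt_der_lift (h₀ t) (h₁ t))).congr_deriv ?_
    simp only [hp, haff, der_add, der_smul, hone, smul_zero, add_zero]
    abel
  have hdpc : Continuous fun t => -der (u t) 1 := ((continuous_der 1).comp huc).neg
  have hduc : Continuous fun t => f t + der (lift (γ₀' t) (γ₁' t)) 0 - der (p t) 1 :=
    (hfc.add ((continuous_der 0).comp (continuous_lift hc₀ hc₁))).sub
      ((continuous_der 1).comp hpc)
  have hcd : ∀ {q q' : ℝ → L2 0 1}, (∀ t, HasDerivAt q (q' t) t) → Continuous q' →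
      ContDiff ℝ 1 q := fun {q q'} h hq' => by
    rw [contDiff_one_iff_deriv]
    refine ⟨fun t => (h t).differentiableAt, ?_⟩
    rwa [show deriv q = q' from funext fun t => (h t).deriv]
  refine ⟨p, u, fun t => by rw [← hP]; rfl, fun t => by rw [← hU]; rfl,
    fun φ g₀ g₁ hg₀ hg₁ hφ => ?_⟩
  have h0 : lift 0 0 = 0 := by rw [lift_eq]; simp
  refine ⟨(hcd hpd hdpc).contDiffOn, (hcd hud hduc).contDiffOn, hpc.continuousOn, huc.continuousOn,
    fun t ht => ?_, fun t ht => ?_, fun t ht => ?_, fun t ht => ?_, fun x hx => ?_, fun x hx => ?_⟩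
  · rw [(hpd t).hasDerivWithinAt.derivWithin (uniqueDiffOn_Icc hT t ht), neg_add_cancel]
  · rw [(hud t).hasDerivWithinAt.derivWithin (uniqueDiffOn_Icc hT t ht)]
    filter_upwards [hφ t ht, Lp.coeFn_sub (f t + der (lift (γ₀' t) (γ₁' t)) 0) (der (p t) 1)]
      with x h1 h2
    rw [h2, Pi.sub_apply, sub_add_cancel, h1]
  · rw [val_add (by simp), (htr t).1, lift, val_affineH1 _ _ (by simp), hg₀ ht]
    ring
  · rw [val_add (by simp), (htr t).2, lift, val_affineH1 _ _ (by simp), hg₁ ht]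
    ring
  · have hx' := Ioo_subset_Icc_self hx
    have hP0 : P 0 = 0 := Sobolev.ext_of_der_zero (by rw [hP]; simp [duhamel])
    simp only [hp, hP0, hm, intervalIntegral.integral_same, sub_zero, zero_add]
    rw [val_affineH1 _ _ hx', zero_mul, add_zero]
  · have hx' := Ioo_subset_Icc_self hx
    have hU0 : U 0 = 0 := Sobolev.ext_of_der_zero (by rw [hU]; simp [duhamel])
    simp only [hu, hU0, hz₀, hz₁, h0, zero_add]
    rw [← h0, lift, val_affineH1 _ _ hx']
    ring

/-! ### Pointwise operations on bounded elements of `L²(0,1)` -/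

open Classical in
/-- The class in `L²(0,1)` of a square integrable function. -/
def mkL2 (f : ℝ → ℝ) : L2 0 1 :=
  if h : MemLp f 2 (volume.restrict (Ioo (0 : ℝ) 1)) then h.toLp f else 0

theorem coeFn_mkL2 {f : ℝ → ℝ} {C : ℝ}
    (hf : AEStronglyMeasurable f (volume.restrict (Ioo (0 : ℝ) 1)))
    (hC : ∀ᵐ x ∂(volume.restrict (Ioo (0 : ℝ) 1)), |f x| ≤ C) :
    mkL2 f =ᵐ[volume.restrict (Ioo (0 : ℝ) 1)] f := by
  have h : MemLp f 2 (volume.restrict (Ioo (0 : ℝ) 1)) := MemLp.of_bound hf C hC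
  rw [mkL2, dif_pos h]
  exact h.coeFn_toLp

theorem norm_le_of_ae_le {f g₁ g₂ : L2 0 1} {c₁ c₂ c₃ : ℝ} (h₁ : 0 ≤ c₁) (h₂ : 0 ≤ c₂)
    (h₃ : 0 ≤ c₃) (h : ∀ᵐ x ∂(volume.restrict (Ioo (0 : ℝ) 1)),
      |f x| ≤ c₁ * |g₁ x| + c₂ * |g₂ x| + c₃) :
    ‖f‖ ≤ c₁ * ‖g₁‖ + c₂ * ‖g₂‖ + c₃ := by
  have hone : ‖oneL2‖ ≤ 1 := by
    have := Lp.norm_le_of_ae_bound (f := oneL2) zero_le_one (by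
      filter_upwards [coeFn_ofCont (φ := fun _ => 1) continuous_const] with x hx
      rw [oneL2, hx]
      simp)
    simpa [measureUnivNNReal, Real.volume_Ioo] using this
  have key : ‖f‖ ≤ ‖c₁ • |g₁| + c₂ • |g₂| + c₃ • oneL2‖ := by
    refine Lp.norm_le_norm_of_ae_le ?_
    filter_upwards [h, Lp.coeFn_add (c₁ • |g₁| + c₂ • |g₂|) (c₃ • oneL2),
      Lp.coeFn_add (c₁ • |g₁|) (c₂ • |g₂|), Lp.coeFn_smul c₁ |g₁|, Lp.coeFn_smul c₂ |g₂|,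
      Lp.coeFn_smul c₃ oneL2, Lp.coeFn_abs g₁, Lp.coeFn_abs g₂,
      coeFn_ofCont (φ := fun _ => 1) continuous_const] with x h h1 h2 h3 h4 h5 h6 h7 h8
    rw [h1, Pi.add_apply, h2, Pi.add_apply, h3, h4, h5]
    simp only [Pi.smul_apply, smul_eq_mul]
    rw [h6, h7, oneL2, h8, mul_one, Real.norm_eq_abs]
    exact h.trans (le_abs_self _)
  refine key.trans ((norm_add_le _ _).trans (add_le_add ((norm_add_le _ _).trans
    (add_le_add ?_ ?_)) ?_))
  · rw [norm_smul, Real.norm_of_nonneg h₁, norm_abs_eq_norm]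
  · rw [norm_smul, Real.norm_of_nonneg h₂, norm_abs_eq_norm]
  · rw [norm_smul, Real.norm_of_nonneg h₃]
    exact mul_le_of_le_one_right h₃ hone

/-- A continuously differentiable curve in `L²(0,1)` with bounded derivative in `L^∞(0,1)`. -/
structure BddCurve (u v : ℝ → L2 0 1) (M : ℝ) : Prop where
  hasDerivAt : ∀ t, HasDerivAt u (v t) t
  continuous_deriv : Continuous v
  aebdd_deriv : ∀ t, AEBdd (v t) M
  aebdd_zero : AEBdd (u 0) M

namespace BddCurve

variable {u v : ℝ → L2 0 1} {M : ℝ}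

theorem nonneg (h : BddCurve u v M) : 0 ≤ M := h.aebdd_zero.nonneg

theorem aebdd_sub (h : BddCurve u v M) (s t : ℝ) : AEBdd (u t - u s) (M * |t - s|) := by
  have key : ∀ s t : ℝ, s ≤ t → AEBdd (u t - u s) (M * |t - s|) := by
    intro s t hst
    rw [← intervalIntegral.integral_eq_sub_of_hasDerivAt (fun x _ => h.hasDerivAt x)
      (h.continuous_deriv.intervalIntegrable _ _)]
    have := AEBdd.intervalIntegral h.continuous_deriv (continuous_const (y := M)) hst
      fun s _ => h.aebdd_deriv s
    rwa [intervalIntegral.integral_const, smul_eq_mul, mul_comm, ← abs_of_nonneg (sub_nonneg.2 hst)]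
      at this
  rcases le_total s t with hst | hst
  · exact key s t hst
  · have := (key t s hst).neg
    rwa [neg_sub, abs_sub_comm] at this

theorem aebdd (h : BddCurve u v M) (t : ℝ) : AEBdd (u t) (M * (1 + |t|)) := by
  have := (h.aebdd_sub 0 t).add h.aebdd_zero
  rw [sub_add_cancel, sub_zero] at this
  exact this.mono (by linarith)

end BddCurve

theorem exists_bound_of_continuous₂ {φ : ℝ → ℝ → ℝ} (hφ : Continuous (Function.uncurry φ))
    (R : ℝ) : ∃ C, 0 ≤ C ∧ ∀ y z, |y| ≤ R → |z| ≤ R → |φ y z| ≤ C := by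
  obtain ⟨C, hC⟩ := (isCompact_Icc (a := ((-R, -R) : ℝ × ℝ)) (b := (R, R))).exists_bound_of_continuousOn
    hφ.continuousOn
  refine ⟨max C 0, le_max_right _ _, fun y z hy hz => (hC (y, z) ?_).trans (le_max_left _ _)⟩
  rw [abs_le] at hy hz
  exact ⟨⟨hy.1, hz.1⟩, ⟨hy.2, hz.2⟩⟩

theorem exists_delta_of_continuous₂ {φ : ℝ → ℝ → ℝ} (hφ : Continuous (Function.uncurry φ))
    (R : ℝ) {ε : ℝ} (hε : 0 < ε) : ∃ δ > 0, ∀ y z y' z', |y| ≤ R → |z| ≤ R →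
      |y' - y| ≤ δ → |z' - z| ≤ δ → |φ y' z' - φ y z| ≤ ε := by
  have hcpt := isCompact_Icc (a := ((-(R + 1), -(R + 1)) : ℝ × ℝ)) (b := (R + 1, R + 1))
  obtain ⟨δ, hδ, h⟩ := Metric.uniformContinuousOn_iff_le.1
    (hcpt.uniformContinuousOn_of_continuous hφ.continuousOn) ε hε
  refine ⟨min δ 1, lt_min hδ one_pos, fun y z y' z' hy hz hy' hz' => ?_⟩
  have hy1 := hy'.trans (min_le_right _ _)
  have hz1 := hz'.trans (min_le_right _ _)
  have hy2 := hy'.trans (min_le_left _ _)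
  have hz2 := hz'.trans (min_le_left _ _)
  rw [abs_le] at hy hz hy1 hz1
  refine h (y', z') ⟨⟨?_, ?_⟩, ⟨?_, ?_⟩⟩ (y, z) ⟨⟨?_, ?_⟩, ⟨?_, ?_⟩⟩ ?_ <;>
    try (simp only; linarith)
  rw [Prod.dist_eq, Real.dist_eq, Real.dist_eq]
  exact max_le hy2 hz2

/-- `Φ` is differentiable on the plane, with continuous partial derivatives `Φ₁` and `Φ₂`. -/
structure HasPartials (Φ Φ₁ Φ₂ : ℝ → ℝ → ℝ) : Prop where
  hasFDerivAt : ∀ q : ℝ × ℝ, HasFDerivAt (Function.uncurry Φ)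
    (Φ₁ q.1 q.2 • ContinuousLinearMap.fst ℝ ℝ ℝ + Φ₂ q.1 q.2 • ContinuousLinearMap.snd ℝ ℝ ℝ) q
  continuous_fst : Continuous (Function.uncurry Φ₁)
  continuous_snd : Continuous (Function.uncurry Φ₂)

namespace HasPartials

variable {Φ Φ₁ Φ₂ : ℝ → ℝ → ℝ}

theorem continuous (h : HasPartials Φ Φ₁ Φ₂) : Continuous (Function.uncurry Φ) :=
  continuous_iff_continuousAt.2 fun q => (h.hasFDerivAt q).continuousAt

theorem exists_delta (h : HasPartials Φ Φ₁ Φ₂) (R : ℝ) {ε : ℝ} (hε : 0 < ε) :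
    ∃ δ > 0, ∀ y z y' z', |y| ≤ R → |z| ≤ R → |y' - y| ≤ δ → |z' - z| ≤ δ →
      |Φ y' z' - Φ y z - (Φ₁ y z * (y' - y) + Φ₂ y z * (z' - z))|
        ≤ ε * |y' - y| + ε * |z' - z| := by
  obtain ⟨δ₁, hδ₁, h₁⟩ := exists_delta_of_continuous₂ h.continuous_fst R (half_pos hε)
  obtain ⟨δ₂, hδ₂, h₂⟩ := exists_delta_of_continuous₂ h.continuous_snd R (half_pos hε)
  refine ⟨min δ₁ δ₂, lt_min hδ₁ hδ₂, fun y z y' z' hy hz hy' hz' => ?_⟩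
  have hconv : Convex ℝ (Metric.closedBall (y, z) (min δ₁ δ₂)) := convex_closedBall _ _
  have hmem : ∀ {q : ℝ × ℝ}, q ∈ Metric.closedBall (y, z) (min δ₁ δ₂) ↔
      |q.1 - y| ≤ min δ₁ δ₂ ∧ |q.2 - z| ≤ min δ₁ δ₂ := fun {q} => by
    rw [Metric.mem_closedBall, Prod.dist_eq, Real.dist_eq, Real.dist_eq, max_le_iff]
  have key := hconv.norm_image_sub_le_of_norm_hasFDerivWithin_le' (C := ε)
    (φ := Φ₁ y z • ContinuousLinearMap.fst ℝ ℝ ℝ + Φ₂ y z • ContinuousLinearMap.snd ℝ ℝ ℝ)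
    (fun q _ => (h.hasFDerivAt q).hasFDerivWithinAt) (fun q hq => by
      obtain ⟨hq1, hq2⟩ := hmem.1 hq
      have e : Φ₁ q.1 q.2 • ContinuousLinearMap.fst ℝ ℝ ℝ
          + Φ₂ q.1 q.2 • ContinuousLinearMap.snd ℝ ℝ ℝ
          - (Φ₁ y z • ContinuousLinearMap.fst ℝ ℝ ℝ + Φ₂ y z • ContinuousLinearMap.snd ℝ ℝ ℝ)
          = (Φ₁ q.1 q.2 - Φ₁ y z) • ContinuousLinearMap.fst ℝ ℝ ℝ
          + (Φ₂ q.1 q.2 - Φ₂ y z) • ContinuousLinearMap.snd ℝ ℝ ℝ := by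
        ext <;> simp
      rw [e]
      refine (norm_add_le _ _).trans ?_
      rw [norm_smul, norm_smul]
      have a1 := h₁ y z q.1 q.2 hy hz (hq1.trans (min_le_left _ _)) (hq2.trans (min_le_left _ _))
      have a2 := h₂ y z q.1 q.2 hy hz (hq1.trans (min_le_right _ _)) (hq2.trans (min_le_right _ _))
      have b1 := ContinuousLinearMap.norm_fst_le ℝ ℝ ℝ
      have b2 := ContinuousLinearMap.norm_snd_le ℝ ℝ ℝ
      rw [← Real.norm_eq_abs] at a1 a2
      nlinarith [norm_nonneg (Φ₁ q.1 q.2 - Φ₁ y z), norm_nonneg (Φ₂ q.1 q.2 - Φ₂ y z)])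
    (x := (y, z)) (y := (y', z')) (Metric.mem_closedBall_self (le_min hδ₁.le hδ₂.le))
    (hmem.2 ⟨hy', hz'⟩)
  have e2 : ‖((y', z') : ℝ × ℝ) - (y, z)‖ ≤ |y' - y| + |z' - z| := by
    rw [Prod.mk_sub_mk, Prod.norm_mk, Real.norm_eq_abs, Real.norm_eq_abs]
    exact max_le_add_of_nonneg (abs_nonneg _) (abs_nonneg _)
  rw [Real.norm_eq_abs] at key
  simp only [Function.uncurry_apply_pair, Prod.mk_sub_mk, add_apply,
    smul_apply, ContinuousLinearMap.coe_fst',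
    ContinuousLinearMap.coe_snd', smul_eq_mul] at key e2
  refine key.trans ((mul_le_mul_of_nonneg_left e2 hε.le).trans_eq (by ring))

end HasPartials

section Nemytskii

variable {Φ Φ₁ Φ₂ : ℝ → ℝ → ℝ}

theorem coeFn_nemytskii {φ : ℝ → ℝ → ℝ} (hφ : Continuous (Function.uncurry φ)) {u w : L2 0 1}
    {R : ℝ} (hu : AEBdd u R) (hw : AEBdd w R) :
    mkL2 (fun x => φ (u x) (w x)) =ᵐ[volume.restrict (Ioo (0 : ℝ) 1)]
      fun x => φ (u x) (w x) := by
  obtain ⟨C, _, hC⟩ := exists_bound_of_continuous₂ hφ R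
  refine coeFn_mkL2 (C := C) (hφ.comp_aestronglyMeasurable
    ((Lp.aestronglyMeasurable u).prodMk (Lp.aestronglyMeasurable w))) ?_
  filter_upwards [hu, hw] with x h1 h2
  exact hC _ _ h1 h2

/-- The derivative `Φ₁(u,w) u' + Φ₂(u,w) w'` of `Φ(u,w)` along a curve. -/
def chainL2 (Φ₁ Φ₂ : ℝ → ℝ → ℝ) (u w u' w' : L2 0 1) : L2 0 1 :=
  mkL2 fun x => Φ₁ (u x) (w x) * u' x + Φ₂ (u x) (w x) * w' x

theorem coeFn_chainL2 (h₁ : Continuous (Function.uncurry Φ₁)) (h₂ : Continuous (Function.uncurry Φ₂))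
    {u w u' w' : L2 0 1} {R M M' : ℝ} (hu : AEBdd u R) (hw : AEBdd w R) (hu' : AEBdd u' M)
    (hw' : AEBdd w' M') : chainL2 Φ₁ Φ₂ u w u' w' =ᵐ[volume.restrict (Ioo (0 : ℝ) 1)]
      fun x => Φ₁ (u x) (w x) * u' x + Φ₂ (u x) (w x) * w' x := by
  obtain ⟨C₁, hC₁, h1⟩ := exists_bound_of_continuous₂ h₁ R
  obtain ⟨C₂, hC₂, h2⟩ := exists_bound_of_continuous₂ h₂ R
  have hm := (Lp.aestronglyMeasurable u).prodMk (Lp.aestronglyMeasurable w)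
  refine coeFn_mkL2 (C := C₁ * M + C₂ * M')
    (((h₁.comp_aestronglyMeasurable hm).mul (Lp.aestronglyMeasurable u')).add
    ((h₂.comp_aestronglyMeasurable hm).mul (Lp.aestronglyMeasurable w'))) ?_
  filter_upwards [hu, hw, hu', hw'] with x a b c d
  refine (abs_add_le _ _).trans ?_
  rw [abs_mul, abs_mul]
  have := h1 _ _ a b
  have := h2 _ _ a b
  gcongr

theorem hasDerivAt_nemytskii (h : HasPartials Φ Φ₁ Φ₂) {u u' w w' : ℝ → L2 0 1} {M M' : ℝ}
    (hu : BddCurve u u' M) (hw : BddCurve w w' M') (t : ℝ) :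
    HasDerivAt (fun t => mkL2 fun x => Φ (u t x) (w t x)) (chainL2 Φ₁ Φ₂ (u t) (w t) (u' t) (w' t))
      t := by
  set R : ℝ := max (M * (1 + (|t| + 1))) (M' * (1 + (|t| + 1))) with hR
  have hbd : ∀ s, |s - t| ≤ 1 → AEBdd (u s) R ∧ AEBdd (w s) R := by
    intro s hs
    have hst : |s| ≤ |t| + 1 := by
      have := abs_add_le (s - t) t
      rw [sub_add_cancel] at this
      linarith
    have h0 := hu.nonneg
    have h0' := hw.nonneg
    exact ⟨(hu.aebdd s).mono (le_trans (by gcongr) (le_max_left _ _)),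
      (hw.aebdd s).mono (le_trans (by gcongr) (le_max_right _ _))⟩
  obtain ⟨hut, hwt⟩ := hbd t (by simp)
  obtain ⟨C₁, hC₁, hb₁⟩ := exists_bound_of_continuous₂ h.continuous_fst R
  obtain ⟨C₂, hC₂, hb₂⟩ := exists_bound_of_continuous₂ h.continuous_snd R
  rw [hasDerivAt_iff_isLittleO, Asymptotics.isLittleO_iff]
  intro ε hε
  set η : ℝ := ε / (M + M' + C₁ + C₂ + 1) with hη
  have hden : 0 < M + M' + C₁ + C₂ + 1 := by
    have := hu.nonneg
    have := hw.nonneg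
    positivity
  have hηpos : 0 < η := div_pos hε hden
  obtain ⟨δ, hδ, hdel⟩ := h.exists_delta R hηpos
  have o₁ := (hasDerivAt_iff_isLittleO.1 (hu.hasDerivAt t)).def hηpos
  have o₂ := (hasDerivAt_iff_isLittleO.1 (hw.hasDerivAt t)).def hηpos
  have n₁ : ∀ᶠ s in 𝓝 t, |s - t| ≤ 1 := by
    filter_upwards [Metric.closedBall_mem_nhds t one_pos] with s hs
    rwa [Metric.mem_closedBall, Real.dist_eq] at hs
  have n₂ : ∀ᶠ s in 𝓝 t, (M + M') * |s - t| ≤ δ := by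
    have : Tendsto (fun s => (M + M') * |s - t|) (𝓝 t) (𝓝 ((M + M') * |t - t|)) :=
      (Continuous.tendsto (by fun_prop) t)
    rw [sub_self, abs_zero, mul_zero] at this
    exact this.eventually (ge_mem_nhds hδ)
  filter_upwards [o₁, o₂, n₁, n₂] with s h1 h2 h3 h4
  obtain ⟨hus, hws⟩ := hbd s h3
  have hstep : ‖mkL2 (fun x => Φ (u s x) (w s x)) - mkL2 (fun x => Φ (u t x) (w t x))
      - (s - t) • chainL2 Φ₁ Φ₂ (u t) (w t) (u' t) (w' t)‖
      ≤ C₁ * ‖u s - u t - (s - t) • u' t‖ + C₂ * ‖w s - w t - (s - t) • w' t‖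
        + η * ((M + M') * |s - t|) := by
    have hm := hu.nonneg
    have hm' := hw.nonneg
    refine norm_le_of_ae_le hC₁ hC₂ (by positivity) ?_
    filter_upwards [coeFn_nemytskii h.continuous hus hws, coeFn_nemytskii h.continuous hut hwt,
      coeFn_chainL2 h.continuous_fst h.continuous_snd hut hwt (hu.aebdd_deriv t) (hw.aebdd_deriv t),
      Lp.coeFn_sub (mkL2 (fun x => Φ (u s x) (w s x)) - mkL2 (fun x => Φ (u t x) (w t x)))
        ((s - t) • chainL2 Φ₁ Φ₂ (u t) (w t) (u' t) (w' t)),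
      Lp.coeFn_sub (mkL2 (fun x => Φ (u s x) (w s x))) (mkL2 (fun x => Φ (u t x) (w t x))),
      Lp.coeFn_smul (s - t) (chainL2 Φ₁ Φ₂ (u t) (w t) (u' t) (w' t)),
      Lp.coeFn_sub (u s - u t) ((s - t) • u' t), Lp.coeFn_sub (u s) (u t),
      Lp.coeFn_smul (s - t) (u' t),
      Lp.coeFn_sub (w s - w t) ((s - t) • w' t), Lp.coeFn_sub (w s) (w t),
      Lp.coeFn_smul (s - t) (w' t), hut, hwt, hu.aebdd_sub t s, hw.aebdd_sub t s]
      with x a1 a2 a3 a4 a5 a6 b1 b2 b3 c1 c2 c3 d1 d2 d3 d4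
    rw [b2, Pi.sub_apply] at d3
    rw [c2, Pi.sub_apply] at d4
    rw [a4, Pi.sub_apply, a5, Pi.sub_apply, a6, Pi.smul_apply, a1, a2, a3, b1, Pi.sub_apply, b2,
      Pi.sub_apply, b3, Pi.smul_apply, c1, Pi.sub_apply, c2, Pi.sub_apply, c3, Pi.smul_apply]
    simp only [smul_eq_mul]
    have hMst : 0 ≤ M * |s - t| := by positivity
    have hMst' : 0 ≤ M' * |s - t| := by positivity
    have k0 := hdel _ _ _ _ d1 d2 (d3.trans (by linarith)) (d4.trans (by linarith))
    have k1 : |Φ₁ (u t x) (w t x) * (u s x - u t x - (s - t) * u' t x)|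
        ≤ C₁ * |u s x - u t x - (s - t) * u' t x| := by
      rw [abs_mul]
      exact mul_le_mul_of_nonneg_right (hb₁ _ _ d1 d2) (abs_nonneg _)
    have k2 : |Φ₂ (u t x) (w t x) * (w s x - w t x - (s - t) * w' t x)|
        ≤ C₂ * |w s x - w t x - (s - t) * w' t x| := by
      rw [abs_mul]
      exact mul_le_mul_of_nonneg_right (hb₂ _ _ d1 d2) (abs_nonneg _)
    have e : Φ (u s x) (w s x) - Φ (u t x) (w t x)
        - (s - t) * (Φ₁ (u t x) (w t x) * u' t x + Φ₂ (u t x) (w t x) * w' t x)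
        = Φ₁ (u t x) (w t x) * (u s x - u t x - (s - t) * u' t x)
        + Φ₂ (u t x) (w t x) * (w s x - w t x - (s - t) * w' t x)
        + (Φ (u s x) (w s x) - Φ (u t x) (w t x) - (Φ₁ (u t x) (w t x) * (u s x - u t x)
          + Φ₂ (u t x) (w t x) * (w s x - w t x))) := by ring
    rw [e]
    refine (abs_add_three _ _ _).trans (add_le_add (add_le_add k1 k2) (k0.trans ?_))
    nlinarith
  refine hstep.trans ?_
  rw [Real.norm_eq_abs] at h1 h2 ⊢
  have e3 : ε = η * (M + M' + C₁ + C₂ + 1) := by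
    rw [hη]
    field_simp
  have hab := abs_nonneg (s - t)
  have k1 := mul_le_mul_of_nonneg_left h1 hC₁
  have k2 := mul_le_mul_of_nonneg_left h2 hC₂
  rw [e3]
  nlinarith [mul_nonneg hηpos.le hab]

theorem continuous_chainL2 (h₁ : Continuous (Function.uncurry Φ₁))
    (h₂ : Continuous (Function.uncurry Φ₂)) {u u' w w' : ℝ → L2 0 1} {M M' : ℝ}
    (hu : BddCurve u u' M) (hw : BddCurve w w' M') :
    Continuous fun t => chainL2 Φ₁ Φ₂ (u t) (w t) (u' t) (w' t) := by
  rw [continuous_iff_continuousAt]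
  intro t
  set R : ℝ := max (M * (1 + (|t| + 1))) (M' * (1 + (|t| + 1))) with hR
  have hbd : ∀ s, |s - t| ≤ 1 → AEBdd (u s) R ∧ AEBdd (w s) R := by
    intro s hs
    have hst : |s| ≤ |t| + 1 := by
      have := abs_add_le (s - t) t
      rw [sub_add_cancel] at this
      linarith
    have h0 := hu.nonneg
    have h0' := hw.nonneg
    exact ⟨(hu.aebdd s).mono (le_trans (by gcongr) (le_max_left _ _)),
      (hw.aebdd s).mono (le_trans (by gcongr) (le_max_right _ _))⟩
  obtain ⟨hut, hwt⟩ := hbd t (by simp)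
  obtain ⟨C₁, hC₁, hb₁⟩ := exists_bound_of_continuous₂ h₁ R
  obtain ⟨C₂, hC₂, hb₂⟩ := exists_bound_of_continuous₂ h₂ R
  have hm := hu.nonneg
  have hm' := hw.nonneg
  rw [Metric.continuousAt_iff']
  intro ε hε
  set η : ℝ := ε / (2 * (M + M' + 1)) with hη
  have hηpos : 0 < η := by positivity
  obtain ⟨δ₁, hδ₁, hd₁⟩ := exists_delta_of_continuous₂ h₁ R hηpos
  obtain ⟨δ₂, hδ₂, hd₂⟩ := exists_delta_of_continuous₂ h₂ R hηpos
  have n₁ : ∀ᶠ s in 𝓝 t, |s - t| ≤ 1 := by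
    filter_upwards [Metric.closedBall_mem_nhds t one_pos] with s hs
    rwa [Metric.mem_closedBall, Real.dist_eq] at hs
  have n₂ : ∀ᶠ s in 𝓝 t, (M + M') * |s - t| ≤ min δ₁ δ₂ := by
    have : Tendsto (fun s => (M + M') * |s - t|) (𝓝 t) (𝓝 ((M + M') * |t - t|)) :=
      (Continuous.tendsto (by fun_prop) t)
    rw [sub_self, abs_zero, mul_zero] at this
    exact this.eventually (ge_mem_nhds (lt_min hδ₁ hδ₂))
  have n₃ : ∀ᶠ s in 𝓝 t, C₁ * ‖u' s - u' t‖ + C₂ * ‖w' s - w' t‖ < ε / 2 := by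
    have h1 := hu.continuous_deriv
    have h2 := hw.continuous_deriv
    have : Tendsto (fun s => C₁ * ‖u' s - u' t‖ + C₂ * ‖w' s - w' t‖) (𝓝 t)
        (𝓝 (C₁ * ‖u' t - u' t‖ + C₂ * ‖w' t - w' t‖)) :=
      Continuous.tendsto (((h1.sub continuous_const).norm.const_mul _).add
        ((h2.sub continuous_const).norm.const_mul _)) t
    simp only [sub_self, norm_zero, mul_zero, add_zero] at this
    exact this.eventually (gt_mem_nhds (half_pos hε))
  filter_upwards [n₁, n₂, n₃] with s h3 h4 h5
  obtain ⟨hus, hws⟩ := hbd s h3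
  have hstep : ‖chainL2 Φ₁ Φ₂ (u s) (w s) (u' s) (w' s) - chainL2 Φ₁ Φ₂ (u t) (w t) (u' t) (w' t)‖
      ≤ C₁ * ‖u' s - u' t‖ + C₂ * ‖w' s - w' t‖ + η * (M + M') := by
    refine norm_le_of_ae_le hC₁ hC₂ (by positivity) ?_
    filter_upwards [
      coeFn_chainL2 h₁ h₂ hut hwt (hu.aebdd_deriv t) (hw.aebdd_deriv t),
      coeFn_chainL2 h₁ h₂ hus hws (hu.aebdd_deriv s) (hw.aebdd_deriv s),
      Lp.coeFn_sub (chainL2 Φ₁ Φ₂ (u s) (w s) (u' s) (w' s))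
        (chainL2 Φ₁ Φ₂ (u t) (w t) (u' t) (w' t)),
      Lp.coeFn_sub (u' s) (u' t), Lp.coeFn_sub (w' s) (w' t),
      Lp.coeFn_sub (u s) (u t), Lp.coeFn_sub (w s) (w t),
      hut, hwt, hus, hws, hu.aebdd_sub t s, hw.aebdd_sub t s, hu.aebdd_deriv t, hw.aebdd_deriv t]
      with x a1 a2 a3 b1 b2 b3 b4 d1 d2 d1' d2' d3 d4 d5 d6
    rw [b3, Pi.sub_apply] at d3
    rw [b4, Pi.sub_apply] at d4
    rw [a3, Pi.sub_apply, a1, a2, b1, Pi.sub_apply, b2, Pi.sub_apply]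
    have hMst : 0 ≤ M * |s - t| := by positivity
    have hMst' : 0 ≤ M' * |s - t| := by positivity
    have l1 := min_le_left δ₁ δ₂
    have l2 := min_le_right δ₁ δ₂
    have k1 := hd₁ _ _ _ _ d1 d2 (d3.trans (by linarith)) (d4.trans (by linarith))
    have k2 := hd₂ _ _ _ _ d1 d2 (d3.trans (by linarith)) (d4.trans (by linarith))
    have k3 : |Φ₁ (u s x) (w s x) * (u' s x - u' t x)| ≤ C₁ * |u' s x - u' t x| := by
      rw [abs_mul]
      exact mul_le_mul_of_nonneg_right (hb₁ _ _ d1' d2') (abs_nonneg _)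
    have k4 : |Φ₂ (u s x) (w s x) * (w' s x - w' t x)| ≤ C₂ * |w' s x - w' t x| := by
      rw [abs_mul]
      exact mul_le_mul_of_nonneg_right (hb₂ _ _ d1' d2') (abs_nonneg _)
    have k5 : |(Φ₁ (u s x) (w s x) - Φ₁ (u t x) (w t x)) * u' t x| ≤ η * M := by
      rw [abs_mul]
      exact mul_le_mul k1 d5 (abs_nonneg _) hηpos.le
    have k6 : |(Φ₂ (u s x) (w s x) - Φ₂ (u t x) (w t x)) * w' t x| ≤ η * M' := by
      rw [abs_mul]
      exact mul_le_mul k2 d6 (abs_nonneg _) hηpos.le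
    have e : Φ₁ (u s x) (w s x) * u' s x + Φ₂ (u s x) (w s x) * w' s x
        - (Φ₁ (u t x) (w t x) * u' t x + Φ₂ (u t x) (w t x) * w' t x)
        = Φ₁ (u s x) (w s x) * (u' s x - u' t x) + Φ₂ (u s x) (w s x) * (w' s x - w' t x)
        + ((Φ₁ (u s x) (w s x) - Φ₁ (u t x) (w t x)) * u' t x
        + (Φ₂ (u s x) (w s x) - Φ₂ (u t x) (w t x)) * w' t x) := by ring
    rw [e]
    have t1 := abs_add_three (Φ₁ (u s x) (w s x) * (u' s x - u' t x))
      (Φ₂ (u s x) (w s x) * (w' s x - w' t x))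
      ((Φ₁ (u s x) (w s x) - Φ₁ (u t x) (w t x)) * u' t x
        + (Φ₂ (u s x) (w s x) - Φ₂ (u t x) (w t x)) * w' t x)
    have t2 := abs_add_le ((Φ₁ (u s x) (w s x) - Φ₁ (u t x) (w t x)) * u' t x)
      ((Φ₂ (u s x) (w s x) - Φ₂ (u t x) (w t x)) * w' t x)
    linarith
  rw [dist_eq_norm]
  have e3 : η * (M + M' + 1) = ε / 2 := by
    rw [hη]
    field_simp
  nlinarith

end Nemytskii

/-! ### Volterra fixed points -/

theorem exists_fixedPoint_of_volterra {E : Type*} [NormedAddCommGroup E] [CompleteSpace E] {T : ℝ}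
    {S : Set C(Icc (0 : ℝ) T, E)} (hc : IsClosed S) (hne : S.Nonempty)
    {N : C(Icc (0 : ℝ) T, E) → C(Icc (0 : ℝ) T, E)} (hS : MapsTo N S S) {L : ℝ}
    (hL : 0 ≤ L) (hN : ∀ v₁ ∈ S, ∀ v₂ ∈ S, ∀ m : ℝ → ℝ, Continuous m →
      (∀ s : Icc (0 : ℝ) T, ‖v₁ s - v₂ s‖ ≤ m s) →
      ∀ t : Icc (0 : ℝ) T, ‖N v₁ t - N v₂ t‖ ≤ L * ∫ s in (0 : ℝ)..t, m s) :
    ∃ v ∈ S, N v = v := by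
  have hiter : ∀ (n : ℕ) {v₁ v₂ : C(Icc (0 : ℝ) T, E)}, v₁ ∈ S → v₂ ∈ S → ∀ t : Icc (0 : ℝ) T,
      ‖N^[n] v₁ t - N^[n] v₂ t‖ ≤ dist v₁ v₂ * ((L * t) ^ n / n.factorial) := by
    intro n
    induction n with
    | zero =>
      intro v₁ v₂ _ _ t
      simpa [← dist_eq_norm] using ContinuousMap.dist_apply_le_dist t
    | succ n ih =>
      intro v₁ v₂ h₁ h₂ t
      rw [Function.iterate_succ_apply', Function.iterate_succ_apply']
      refine (hN _ (hS.iterate n h₁) _ (hS.iterate n h₂)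
        (fun s => dist v₁ v₂ * ((L * s) ^ n / n.factorial)) (by fun_prop)
        (fun s => ih h₁ h₂ s) t).trans_eq ?_
      have e : ∀ s : ℝ, dist v₁ v₂ * ((L * s) ^ n / n.factorial)
          = dist v₁ v₂ * (L ^ n / n.factorial) * s ^ n := fun s => by
        rw [mul_pow]
        ring
      simp_rw [e]
      rw [intervalIntegral.integral_const_mul, integral_pow, Nat.factorial_succ]
      push_cast
      have : (n.factorial : ℝ) ≠ 0 := by positivity
      field_simp
      ring
  obtain ⟨n, hn⟩ : ∃ n : ℕ, (L * T) ^ n / n.factorial < 1 / 2 :=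
    ((FloorSemiring.tendsto_pow_div_factorial_atTop (L * T)).eventually
      (gt_mem_nhds (by norm_num : (0 : ℝ) < 1 / 2))).exists
  have : CompleteSpace S := hc.completeSpace_coe
  have : Nonempty S := hne.to_subtype
  have hcontr : ContractingWith (1 / 2) (hS.restrict N S S)^[n] := by
    refine ⟨by rw [← NNReal.coe_lt_coe]; norm_num, LipschitzWith.of_dist_le_mul fun v₁ v₂ => ?_⟩
    rw [hS.iterate_restrict, Subtype.dist_eq, Subtype.dist_eq,
      ContinuousMap.dist_le (by positivity)]
    intro t
    rw [dist_eq_norm, mul_comm]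
    refine (hiter n v₁.2 v₂.2 t).trans (mul_le_mul_of_nonneg_left ?_ dist_nonneg)
    have h0 := t.2.1
    have h1 := t.2.2
    have : (L * t) ^ n / n.factorial ≤ (L * T) ^ n / n.factorial := by gcongr
    push_cast
    linarith
  have := hcontr.isFixedPt_fixedPoint_iterate
  exact ⟨_, (ContractingWith.fixedPoint _ hcontr).2, congrArg Subtype.val this⟩

theorem integral_exp_le {l t : ℝ} (hl : 0 < l) :
    ∫ s in (0 : ℝ)..t, Real.exp (l * s) ≤ Real.exp (l * t) / l := by
  have : ∫ s in (0 : ℝ)..t, Real.exp (l * s) = (Real.exp (l * t) - 1) / l := by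
    rw [intervalIntegral.integral_comp_mul_left (fun x => Real.exp x) hl.ne', integral_exp]
    simp
    ring
  rw [this]
  gcongr
  linarith

theorem exists_aebdd_bound {γ₀ γ₁ : ℝ → ℝ} (h₀ : Continuous γ₀) (h₁ : Continuous γ₁) (T : ℝ) :
    ∃ C, 0 ≤ C ∧ ∀ t ∈ Icc 0 T, AEBdd (der (lift (γ₀ t) (γ₁ t)) 0) C := by
  obtain ⟨C₀, hC₀⟩ := (isCompact_Icc (a := (0 : ℝ)) (b := T)).exists_bound_of_continuousOn
    h₀.continuousOn
  obtain ⟨C₁, hC₁⟩ := (isCompact_Icc (a := (0 : ℝ)) (b := T)).exists_bound_of_continuousOn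
    h₁.continuousOn
  refine ⟨max (C₀ + (C₁ + C₀)) 0, le_max_right _ _, fun t ht => AEBdd.mono ?_ (le_max_left _ _)⟩
  have a0 := hC₀ t ht
  have a1 := hC₁ t ht
  rw [Real.norm_eq_abs] at a0 a1
  refine aebdd_of_val_bound fun x hx => ?_
  rw [lift, val_affineH1 _ _ hx]
  have : |(γ₁ t - γ₀ t) * x| ≤ |γ₁ t - γ₀ t| := by
    rw [abs_mul, abs_of_nonneg hx.1]
    exact mul_le_of_le_one_right (abs_nonneg _) hx.2
  have := abs_sub (γ₁ t) (γ₀ t)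
  have := abs_add_le (γ₀ t) ((γ₁ t - γ₀ t) * x)
  linarith

/-- Bounds on the partial derivatives of `Φ` that make `Φ(u,w)` globally well behaved in `w`. -/
structure PartialBounds (Φ₁ Φ₂ : ℝ → ℝ → ℝ) (A : ℝ) : Prop where
  nonneg : 0 ≤ A
  fst_le : ∀ y z, |Φ₁ y z| ≤ A * (1 + |z|)
  snd_le : ∀ y z, |Φ₂ y z| ≤ A
  fst_lip : ∀ y z z', |Φ₁ y z - Φ₁ y z'| ≤ A * |z - z'|
  snd_lip : ∀ y z z', |Φ₂ y z - Φ₂ y z'| ≤ A * |z - z'|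

section

variable {Φ Φ₁ Φ₂ : ℝ → ℝ → ℝ} {A : ℝ}

theorem PartialBounds.aebdd_chainL2 (h₁ : Continuous (Function.uncurry Φ₁))
    (h₂ : Continuous (Function.uncurry Φ₂)) (hA : PartialBounds Φ₁ Φ₂ A) {u w u' v : L2 0 1}
    {R M k l : ℝ} (hu : AEBdd u R) (hu' : AEBdd u' M) (hw : AEBdd w k) (hv : AEBdd v l) :
    AEBdd (chainL2 Φ₁ Φ₂ u w u' v) (A * (1 + k) * M + A * l) := by
  filter_upwards [coeFn_chainL2 h₁ h₂ (hu.mono (le_max_left R k)) (hw.mono (le_max_right R k)) hu' hv,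
    hu', hw, hv] with x h1 h2 h3 h4
  rw [h1]
  refine (abs_add_le _ _).trans ?_
  rw [abs_mul, abs_mul]
  have hA0 := hA.nonneg
  have := hA.fst_le (u x) (w x)
  have := hA.snd_le (u x) (w x)
  have hk := hw.nonneg
  have : A * (1 + |w x|) ≤ A * (1 + k) := by gcongr
  refine add_le_add (mul_le_mul (by linarith) h2 (abs_nonneg _) (by positivity))
    (mul_le_mul (by linarith) h4 (abs_nonneg _) hA0)

theorem PartialBounds.norm_chainL2_sub_le (h₁ : Continuous (Function.uncurry Φ₁))
    (h₂ : Continuous (Function.uncurry Φ₂)) (hA : PartialBounds Φ₁ Φ₂ A)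
    {u u' w₁ w₂ v₁ v₂ : L2 0 1} {R M k l : ℝ} (hu : AEBdd u R) (hu' : AEBdd u' M)
    (hw₁ : AEBdd w₁ k) (hw₂ : AEBdd w₂ k) (hv₁ : AEBdd v₁ l) (hv₂ : AEBdd v₂ l) :
    ‖chainL2 Φ₁ Φ₂ u w₁ u' v₁ - chainL2 Φ₁ Φ₂ u w₂ u' v₂‖
      ≤ A * (M + l) * ‖w₁ - w₂‖ + A * ‖v₁ - v₂‖ := by
  have hA0 := hA.nonneg
  have hM := hu'.nonneg
  have hl := hv₁.nonneg
  have key := norm_le_of_ae_le (f := chainL2 Φ₁ Φ₂ u w₁ u' v₁ - chainL2 Φ₁ Φ₂ u w₂ u' v₂)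
    (g₁ := w₁ - w₂) (g₂ := v₁ - v₂) (c₁ := A * (M + l)) (c₂ := A) (c₃ := 0) (by positivity) hA0 le_rfl
    (by
      filter_upwards [
        coeFn_chainL2 h₁ h₂ (hu.mono (le_max_left R k)) (hw₁.mono (le_max_right R k)) hu' hv₁,
        coeFn_chainL2 h₁ h₂ (hu.mono (le_max_left R k)) (hw₂.mono (le_max_right R k)) hu' hv₂,
        Lp.coeFn_sub (chainL2 Φ₁ Φ₂ u w₁ u' v₁) (chainL2 Φ₁ Φ₂ u w₂ u' v₂),
        Lp.coeFn_sub w₁ w₂, Lp.coeFn_sub v₁ v₂, hu', hv₂] with x a1 a2 a3 a4 a5 a6 a7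
      rw [a3, Pi.sub_apply, a1, a2, a4, a5, Pi.sub_apply, Pi.sub_apply]
      have e : Φ₁ (u x) (w₁ x) * u' x + Φ₂ (u x) (w₁ x) * v₁ x
          - (Φ₁ (u x) (w₂ x) * u' x + Φ₂ (u x) (w₂ x) * v₂ x)
          = (Φ₁ (u x) (w₁ x) - Φ₁ (u x) (w₂ x)) * u' x
            + (Φ₂ (u x) (w₁ x) - Φ₂ (u x) (w₂ x)) * v₂ x
            + Φ₂ (u x) (w₁ x) * (v₁ x - v₂ x) := by ring
      rw [e]
      refine (abs_add_three _ _ _).trans ?_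
      rw [abs_mul, abs_mul, abs_mul]
      have k1 := mul_le_mul (hA.fst_lip (u x) (w₁ x) (w₂ x)) a6 (abs_nonneg _) (by positivity)
      have k2 := mul_le_mul (hA.snd_lip (u x) (w₁ x) (w₂ x)) a7 (abs_nonneg _) (by positivity)
      have k3 := mul_le_mul_of_nonneg_right (hA.snd_le (u x) (w₁ x)) (abs_nonneg (v₁ x - v₂ x))
      linarith)
  linarith

theorem duhamel_sub {E : Type*} [NormedAddCommGroup E] [NormedSpace ℝ E] {K : ℝ → E →L[ℝ] E}
    (hK : Continuous fun p : ℝ × E => K p.1 p.2) {f g : ℝ → E} (hf : Continuous f)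
    (hg : Continuous g) (t : ℝ) :
    duhamel K f t - duhamel K g t = duhamel K (fun s => f s - g s) t := by
  have hK' : ∀ {f : ℝ → E}, Continuous f → Continuous fun s => K (t - s) (f s) :=
    fun hf => hK.comp ((continuous_const.sub continuous_id).prodMk hf)
  simp only [duhamel, map_sub]
  rw [intervalIntegral.integral_sub ((hK' hf).intervalIntegrable _ _)
    ((hK' hg).intervalIntegrable _ _)]

theorem PartialBounds.norm_duhamel_sub_le (hΦ : HasPartials Φ Φ₁ Φ₂) (hA : PartialBounds Φ₁ Φ₂ A)
    {u u' : ℝ → L2 0 1} {M : ℝ} (hu : BddCurve u u' M) {γ : ℝ → L2 0 1} (hγ : Continuous γ)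
    {w₁ v₁ w₂ v₂ : ℝ → L2 0 1} {M' : ℝ} (h₁ : BddCurve w₁ v₁ M') (h₂ : BddCurve w₂ v₂ M')
    (hw : w₁ 0 = w₂ 0) {m : ℝ → ℝ} (hm : Continuous m) {t T : ℝ} (ht : 0 ≤ t) (htT : t ≤ T)
    (hle : ∀ s ∈ Icc 0 t, ‖v₁ s - v₂ s‖ ≤ m s) :
    ‖duhamel waveCos (fun s => -chainL2 Φ₁ Φ₂ (u s) (w₁ s) (u' s) (v₁ s) - γ s) t
      - duhamel waveCos (fun s => -chainL2 Φ₁ Φ₂ (u s) (w₂ s) (u' s) (v₂ s) - γ s) t‖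
      ≤ 2 * (A * (M + M') * T + A) * ∫ s in (0 : ℝ)..t, m s := by
  have hA0 := hA.nonneg
  have hM0 := hu.nonneg
  have hM0' := h₁.nonneg
  have hm0 : ∀ s ∈ Icc 0 t, 0 ≤ m s := fun s hs => (norm_nonneg _).trans (hle s hs)
  set J : ℝ := ∫ s in (0 : ℝ)..t, m s with hJ
  have hJ0 : 0 ≤ J := intervalIntegral.integral_nonneg ht hm0
  have hprim : ∀ s ∈ Icc 0 t, ‖w₁ s - w₂ s‖ ≤ J := fun s hs => by
    have a0 := intervalIntegral.integral_eq_sub_of_hasDerivAt (a := 0) (b := s)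
      (fun x _ => (h₁.hasDerivAt x).sub (h₂.hasDerivAt x))
      ((h₁.continuous_deriv.sub h₂.continuous_deriv).intervalIntegrable _ _)
    simp only [Pi.sub_apply, hw, sub_self, sub_zero] at a0
    rw [← a0]
    have a1 : ‖∫ x in (0 : ℝ)..s, (v₁ x - v₂ x)‖ ≤ ∫ x in (0 : ℝ)..s, m x :=
      intervalIntegral.norm_integral_le_of_norm_le hs.1
        (Eventually.of_forall fun x hx => hle x ⟨hx.1.le, hx.2.trans hs.2⟩)
        (hm.intervalIntegrable _ _)
    have a2 : (∫ x in (0 : ℝ)..s, m x) + ∫ x in s..t, m x = J :=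
      intervalIntegral.integral_add_adjacent_intervals (hm.intervalIntegrable _ _)
        (hm.intervalIntegrable _ _)
    have a3 : 0 ≤ ∫ x in s..t, m x :=
      intervalIntegral.integral_nonneg hs.2 fun x hx => hm0 x ⟨hs.1.trans hx.1, hx.2⟩
    linarith
  have hsrc : ∀ {w v : ℝ → L2 0 1}, BddCurve w v M' → Continuous fun s =>
      -chainL2 Φ₁ Φ₂ (u s) (w s) (u' s) (v s) - γ s := fun hwv =>
    (continuous_chainL2 hΦ.continuous_fst hΦ.continuous_snd hu hwv).neg.sub hγ
  rw [duhamel_sub continuous_waveCos (hsrc h₁) (hsrc h₂)]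
  have b1 : ∀ s ∈ Icc 0 t,
      ‖waveCos (t - s) (-chainL2 Φ₁ Φ₂ (u s) (w₁ s) (u' s) (v₁ s) - γ s
        - (-chainL2 Φ₁ Φ₂ (u s) (w₂ s) (u' s) (v₂ s) - γ s))‖
      ≤ 2 * (A * (M + M') * J) + 2 * A * m s := fun s hs => by
    rw [sub_sub_sub_cancel_right, neg_sub_neg]
    refine (norm_waveCos_le _ _).trans ?_
    rw [norm_sub_rev]
    have c2 := hA.norm_chainL2_sub_le hΦ.continuous_fst hΦ.continuous_snd (hu.aebdd s)
      (hu.aebdd_deriv s) (h₁.aebdd s) (h₂.aebdd s) (h₁.aebdd_deriv s) (h₂.aebdd_deriv s)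
    have c3 : A * (M + M') * ‖w₁ s - w₂ s‖ ≤ A * (M + M') * J :=
      mul_le_mul_of_nonneg_left (hprim s hs) (by positivity)
    have c4 : A * ‖v₁ s - v₂ s‖ ≤ A * m s := mul_le_mul_of_nonneg_left (hle s hs) hA0
    linarith
  refine (intervalIntegral.norm_integral_le_of_norm_le ht
    (Eventually.of_forall fun s hs => b1 s ⟨hs.1.le, hs.2⟩)
    ((continuous_const.add (continuous_const.mul hm)).intervalIntegrable _ _)).trans ?_
  have hm' : Continuous fun s => 2 * A * m s := continuous_const.mul hm
  rw [intervalIntegral.integral_add (by simp) (hm'.intervalIntegrable _ _),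
    intervalIntegral.integral_const, smul_eq_mul, sub_zero, intervalIntegral.integral_const_mul]
  have d1 : t * (2 * (A * (M + M') * J)) ≤ T * (2 * (A * (M + M') * J)) :=
    mul_le_mul_of_nonneg_right htT (by positivity)
  linarith

/-- Solvability of `w' = h + ∫₀ᵗ cos(t-s) (-(Φ(u,w))' - γ) ds` with `w(0) = 0` on `[0,T]`. -/
theorem exists_derivative_fixedPoint {T : ℝ} (hT : 0 < T) (hΦ : HasPartials Φ Φ₁ Φ₂)
    (hA : PartialBounds Φ₁ Φ₂ A) {u u' : ℝ → L2 0 1} {M : ℝ} (hu : BddCurve u u' M)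
    {h γ : ℝ → L2 0 1} (hh : Continuous h) (hγ : Continuous γ) {H Γ : ℝ}
    (hhb : ∀ t ∈ Icc 0 T, AEBdd (h t) H) (hγb : ∀ t ∈ Icc 0 T, AEBdd (γ t) Γ) :
    ∃ (w v : ℝ → L2 0 1) (M' : ℝ), BddCurve w v M' ∧ w 0 = 0 ∧ ∀ t ∈ Icc 0 T,
      v t = h t + duhamel waveCos (fun s => -chainL2 Φ₁ Φ₂ (u s) (w s) (u' s) (v s) - γ s) t := by
  have hA0 := hA.nonneg
  have hM0 := hu.nonneg
  have hH0 : 0 ≤ H := (hhb 0 ⟨le_rfl, hT.le⟩).nonneg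
  have hΓ0 : 0 ≤ Γ := (hγb 0 ⟨le_rfl, hT.le⟩).nonneg
  set l : ℝ := 2 * A * (M + 1) + 2 with hl
  have hl0 : 0 < l := by positivity
  set k : ℝ := 2 * (H + (A * M + Γ) * T) with hk
  have hk0 : 0 ≤ k := by positivity
  set M' : ℝ := k * Real.exp (l * T) with hM'
  set ext : C(Icc (0 : ℝ) T, L2 0 1) → ℝ → L2 0 1 := fun v => IccExtend hT.le v with hext
  set prim : C(Icc (0 : ℝ) T, L2 0 1) → ℝ → L2 0 1 := fun v t => ∫ s in (0 : ℝ)..t, ext v s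
    with hprim
  have hextc : ∀ v, Continuous (ext v) := fun v => v.continuous.Icc_extend'
  have hext_of : ∀ v {t : ℝ} (ht : t ∈ Icc 0 T), ext v t = v ⟨t, ht⟩ := fun v t ht =>
    IccExtend_of_mem _ _ ht
  set S : Set C(Icc (0 : ℝ) T, L2 0 1) :=
    {v | ∀ t : Icc (0 : ℝ) T, AEBdd (v t) (k * Real.exp (l * t))} with hSdef
  have hSext : ∀ v ∈ S, ∀ t ∈ Icc 0 T, AEBdd (ext v t) (k * Real.exp (l * t)) := by
    intro v hv t ht
    rw [hext_of v ht]
    exact hv ⟨t, ht⟩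
  have hbc : ∀ v ∈ S, BddCurve (prim v) (ext v) M' := fun v hv =>
    ⟨fun t => intervalIntegral.integral_hasDerivAt_right ((hextc v).intervalIntegrable _ _)
      ((hextc v).stronglyMeasurableAtFilter _ _) (hextc v).continuousAt, hextc v, fun t => by
      have h1 := (projIcc (0 : ℝ) T hT.le t).2
      refine (hv (projIcc 0 T hT.le t)).mono ?_
      have := h1.2
      rw [hM']
      gcongr, by
      simp only [hprim, intervalIntegral.integral_same]
      exact aebdd_zero.mono (by positivity)⟩
  have hprimb : ∀ v ∈ S, ∀ t ∈ Icc 0 T, AEBdd (prim v t) (k * Real.exp (l * t)) := by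
    intro v hv t ht
    refine (AEBdd.intervalIntegral (m := fun s => k * Real.exp (l * s)) (hextc v)
      (by fun_prop) ht.1 fun s hs =>
      hSext v hv s ⟨hs.1, hs.2.trans ht.2⟩).mono ?_
    rw [intervalIntegral.integral_const_mul]
    refine mul_le_mul_of_nonneg_left ((integral_exp_le hl0).trans ?_) hk0
    refine div_le_self (Real.exp_nonneg _) ?_
    have : 0 ≤ 2 * A * (M + 1) := by positivity
    linarith
  set src : C(Icc (0 : ℝ) T, L2 0 1) → ℝ → L2 0 1 := fun v s =>
    -chainL2 Φ₁ Φ₂ (u s) (prim v s) (u' s) (ext v s) - γ s with hsrc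
  have hsrcc : ∀ v ∈ S, Continuous (src v) := fun v hv =>
    (continuous_chainL2 hΦ.continuous_fst hΦ.continuous_snd hu (hbc v hv)).neg.sub hγ
  have hNc : ∀ v ∈ S, Continuous fun t => h t + duhamel waveCos (src v) t := fun v hv =>
    hh.add (continuous_duhamel continuous_waveCos (hsrcc v hv))
  classical
  set N : C(Icc (0 : ℝ) T, L2 0 1) → C(Icc (0 : ℝ) T, L2 0 1) := fun v =>
    if hv : v ∈ S then ⟨fun t => h t + duhamel waveCos (src v) t,
      (hNc v hv).comp continuous_subtype_val⟩ else 0 with hN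
  have hNv : ∀ v ∈ S, ∀ t, N v t = h t + duhamel waveCos (src v) t := by
    intro v hv t
    simp only [hN, dif_pos hv]
    rfl
  have hclosed : IsClosed S := by
    rw [hSdef, ofPred_forall]
    exact isClosed_iInter fun t => (isClosed_aebdd _).preimage (continuous_eval_const t)
  have hmaps : MapsTo N S S := by
    intro v hv t
    rw [hNv v hv]
    have ht := t.2
    have hd := AEBdd.duhamel continuous_waveCos (fun f M τ hf => hf.waveCos τ)
      (m := fun s => (A * M + Γ) + A * (M + 1) * k * Real.exp (l * s)) (hsrcc v hv) (by fun_prop)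
      ht.1 fun s hs => by
        have hs' : s ∈ Icc 0 T := ⟨hs.1, hs.2.trans ht.2⟩
        refine ((hA.aebdd_chainL2 hΦ.continuous_fst hΦ.continuous_snd (hu.aebdd s)
          (hu.aebdd_deriv s) (hprimb v hv s hs') (hSext v hv s hs')).neg.sub (hγb s hs')).mono
          (le_of_eq ?_)
        ring
    refine ((hhb t ht).add hd).mono ?_
    rw [intervalIntegral.integral_add (by simp) ((by fun_prop : Continuous fun s : ℝ =>
      A * (M + 1) * k * Real.exp (l * s)).intervalIntegrable _ _),
      intervalIntegral.integral_const_mul, intervalIntegral.integral_const, smul_eq_mul, sub_zero]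
    have e1 := integral_exp_le (t := (t : ℝ)) hl0
    have e2 : A * (M + 1) * k * (∫ s in (0 : ℝ)..t, Real.exp (l * s))
        ≤ A * (M + 1) * k * (Real.exp (l * t) / l) :=
      mul_le_mul_of_nonneg_left e1 (by positivity)
    have e3 : A * (M + 1) * k * (Real.exp (l * t) / l) ≤ k / 2 * Real.exp (l * t) := by
      rw [mul_div_assoc', div_le_iff₀ hl0]
      have : 0 ≤ k * Real.exp (l * t) := by positivity
      rw [hl]
      nlinarith
    have e4 : (t : ℝ) * (A * M + Γ) ≤ (A * M + Γ) * T := by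
      rw [mul_comm]
      exact mul_le_mul_of_nonneg_left ht.2 (by positivity)
    have e5 : k / 2 ≤ k / 2 * Real.exp (l * t) :=
      le_mul_of_one_le_right (by positivity) (Real.one_le_exp (mul_nonneg hl0.le ht.1))
    linarith
  obtain ⟨v, hv, hfix⟩ := exists_fixedPoint_of_volterra hclosed
    ⟨0, fun t => aebdd_zero.mono (by positivity)⟩ hmaps
    (L := 2 * (A * (M + M') * T + A)) (by positivity) (by
      intro v₁ h₁ v₂ h₂ m hm hle t
      rw [hNv v₁ h₁, hNv v₂ h₂, add_sub_add_left_eq_sub]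
      refine hA.norm_duhamel_sub_le hΦ hu hγ (hbc v₁ h₁) (hbc v₂ h₂) ?_ hm t.2.1 t.2.2
        fun s hs => ?_
      · simp only [hprim, intervalIntegral.integral_same]
      · have hs' : s ∈ Icc 0 T := ⟨hs.1, hs.2.trans t.2.2⟩
        rw [hext_of v₁ hs', hext_of v₂ hs']
        exact hle ⟨s, hs'⟩)
  refine ⟨prim v, ext v, M', hbc v hv, intervalIntegral.integral_same, fun t ht => ?_⟩
  have := hNv v hv ⟨t, ht⟩
  rw [hfix] at this
  rw [hext_of v ht, this]

end

/-! ### Semilinear problems -/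

/-- `(p,u)` is given by d'Alembert's formula for the source `f` and boundary fluxes `γ₀`, `γ₁`. -/
structure IsMild (f : ℝ → L2 0 1) (γ₀ γ₁ : ℝ → ℝ) (c : ℝ) (p u : ℝ → Sobolev 1 0 1) : Prop where
  continuous : Continuous f
  der_p : ∀ t, der (p t) 0 = duhamel waveSin f t
    + der (affineH1 (c - ∫ s in (0 : ℝ)..t, (γ₁ s - γ₀ s)) 0) 0
  der_u : ∀ t, der (u t) 0 = duhamel waveCos f t + der (lift (γ₀ t) (γ₁ t)) 0

theorem continuous_propagator {E : Type*} [NormedAddCommGroup E] [NormedSpace ℝ E]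
    {K : ℝ → E →L[ℝ] E} (hK : Continuous fun p : ℝ × E => K p.1 p.2) (f : E) :
    Continuous fun t => K t f :=
  hK.comp (continuous_id.prodMk continuous_const)

theorem IsClassicalSolution.congr {T : ℝ} {f f' : ℝ → ℝ → ℝ} {g₀ g₁ p₀ u₀ : ℝ → ℝ}
    {p u : ℝ → Sobolev 1 0 1} (h : IsClassicalSolution T f g₀ g₁ p₀ u₀ p u)
    (hf : ∀ t ∈ Icc 0 T, f t =ᵐ[volume.restrict (Ioo (0 : ℝ) 1)] f' t) :
    IsClassicalSolution T f' g₀ g₁ p₀ u₀ p u :=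
  { h with
    momentum := fun t ht => by
      filter_upwards [h.momentum t ht, hf t ht] with x h1 h2
      rw [h1, h2] }

theorem exists_semilinear_wave {Φ Φ₁ Φ₂ : ℝ → ℝ → ℝ} {A : ℝ} {T : ℝ} (hT : 0 < T)
    (hΦ : HasPartials Φ Φ₁ Φ₂) (hA : PartialBounds Φ₁ Φ₂ A) {u u' : ℝ → L2 0 1} {M : ℝ}
    (hu : BddCurve u u' M) {γ₀ γ₁ γ₀' γ₁' γ₀'' γ₁'' : ℝ → ℝ}
    (h₀ : ∀ t, HasDerivAt γ₀ (γ₀' t) t) (h₁ : ∀ t, HasDerivAt γ₁ (γ₁' t) t)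
    (h₀' : ∀ t, HasDerivAt γ₀' (γ₀'' t) t) (h₁' : ∀ t, HasDerivAt γ₁' (γ₁'' t) t)
    (hc₀ : Continuous γ₀'') (hc₁ : Continuous γ₁'') (hz₀ : γ₀ 0 = 0) (hz₁ : γ₁ 0 = 0) (c : ℝ) :
    ∃ (p w : ℝ → Sobolev 1 0 1) (f W W' : ℝ → L2 0 1) (M' : ℝ), BddCurve W W' M' ∧
      (∀ t ∈ Icc 0 T, W t = der (w t) 0) ∧ IsMild f γ₀ γ₁ c p w ∧
      (∀ t ∈ Icc 0 T, f t =ᵐ[volume.restrict (Ioo (0 : ℝ) 1)]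
        fun x => -Φ (u t x) (val (w t) x) - val (lift (γ₀' t) (γ₁' t)) x) ∧
      ∀ g₀ g₁ : ℝ → ℝ, EqOn g₀ γ₀ (Icc 0 T) → EqOn g₁ γ₁ (Icc 0 T) →
        IsClassicalSolution T (fun t x => -Φ (u t x) (val (w t) x)) g₀ g₁ (fun _ => c) (fun _ => 0)
          p w := by
  have hγ₀' : Continuous γ₀' := continuous_iff_continuousAt.2 fun t => (h₀' t).continuousAt
  have hγ₁' : Continuous γ₁' := continuous_iff_continuousAt.2 fun t => (h₁' t).continuousAt
  set f₀ : L2 0 1 := -mkL2 (fun x => Φ (u 0 x) ((0 : L2 0 1) x)) - der (lift (γ₀' 0) (γ₁' 0)) 0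
    with hf₀
  obtain ⟨C₁, hC₁, hb₁⟩ := exists_aebdd_bound hγ₀' hγ₁' T
  obtain ⟨C₂, hC₂, hb₂⟩ := exists_aebdd_bound hc₀ hc₁ T
  obtain ⟨C₀, hC₀, hb₀⟩ := exists_bound_of_continuous₂ hΦ.continuous M
  have hf₀b : AEBdd f₀ (C₀ + C₁) := by
    refine AEBdd.sub (AEBdd.neg ?_) (hb₁ 0 ⟨le_rfl, hT.le⟩)
    filter_upwards [coeFn_nemytskii hΦ.continuous hu.aebdd_zero (aebdd_zero.mono hu.nonneg),
      hu.aebdd_zero, aebdd_zero.mono hu.nonneg] with x h1 h2 h3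
    rw [h1]
    exact hb₀ _ _ h2 h3
  have hlc' : Continuous fun t => der (lift (γ₀' t) (γ₁' t)) 0 :=
    (continuous_der 0).comp (continuous_lift hγ₀' hγ₁')
  have hlc'' : Continuous fun t => der (lift (γ₀'' t) (γ₁'' t)) 0 :=
    (continuous_der 0).comp (continuous_lift hc₀ hc₁)
  have hcos : Continuous fun t => waveCos t f₀ := continuous_propagator continuous_waveCos f₀
  obtain ⟨W, V, M', hW, hW0, hV⟩ := exists_derivative_fixedPoint hT hΦ hA hu
    (hlc'.add hcos) hlc'' (fun t ht => (hb₁ t ht).add (hf₀b.waveCos t)) hb₂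
  set f : ℝ → L2 0 1 := fun t => -mkL2 (fun x => Φ (u t x) (W t x)) - der (lift (γ₀' t) (γ₁' t)) 0
    with hf
  set f' : ℝ → L2 0 1 := fun t => -chainL2 Φ₁ Φ₂ (u t) (W t) (u' t) (V t)
    - der (lift (γ₀'' t) (γ₁'' t)) 0 with hf'
  have hfd : ∀ t, HasDerivAt f (f' t) t := fun t =>
    (hasDerivAt_nemytskii hΦ hu hW t).neg.sub (hasDerivAt_der_lift (h₀' t) (h₁' t))
  have hfc' : Continuous f' :=
    (continuous_chainL2 hΦ.continuous_fst hΦ.continuous_snd hu hW).neg.sub hlc''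
  have hfc : Continuous f := continuous_iff_continuousAt.2 fun t => (hfd t).continuousAt
  have hf0 : f 0 = f₀ := by
    simp only [hf, hf₀, hW0]
  obtain ⟨p, w, hp, hw, hsol⟩ := exists_wave_with_boundary hT hfd hfc' h₀ h₁ hγ₀' hγ₁' hz₀ hz₁ c
  have hwd : ∀ t, HasDerivAt (fun t => der (w t) 0 - W t)
      (waveCos t (f 0) + duhamel waveCos f' t + der (lift (γ₀' t) (γ₁' t)) 0 - V t) t := by
    intro t
    simp only [hw]
    exact ((hasDerivAt_duhamel continuous_waveCos hfd hfc' t).add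
      (hasDerivAt_der_lift (h₀ t) (h₁ t))).sub (hW.hasDerivAt t)
  have hWw : ∀ t ∈ Icc 0 T, W t = der (w t) 0 := by
    have key := constant_of_has_deriv_right_zero (f := fun t => der (w t) 0 - W t) (a := 0) (b := T)
      (fun t _ => (hwd t).continuousAt.continuousWithinAt) (fun t ht => by
        refine ((hwd t).congr_deriv ?_).hasDerivWithinAt
        rw [hV t ⟨ht.1, ht.2.le⟩, hf0, Pi.add_apply]
        abel)
    intro t ht
    have h1 := key t ht
    have h2 : der (w 0) 0 = 0 := by
      have h0 : lift 0 0 = 0 := by rw [lift_eq]; simp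
      rw [hw, hz₀, hz₁, h0, der_zero]
      simp [duhamel]
    rw [h2, hW0, sub_zero] at h1
    exact (sub_eq_zero.1 h1).symm
  have hmk : ∀ t ∈ Icc 0 T, mkL2 (fun x => Φ (u t x) (W t x))
      =ᵐ[volume.restrict (Ioo (0 : ℝ) 1)] fun x => Φ (u t x) (val (w t) x) := fun t ht => by
    filter_upwards [coeFn_nemytskii hΦ.continuous ((hu.aebdd t).mono (le_max_left _ _))
      ((hW.aebdd t).mono (le_max_right _ _)), val_ae (w t)] with x h1 h2
    rw [h1, ← h2, hWw t ht]
  refine ⟨p, w, f, W, V, M', hW, hWw, ⟨hfc, hp, hw⟩, fun t ht => ?_, fun g₀ g₁ hg₀ hg₁ =>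
    hsol _ g₀ g₁ hg₀ hg₁ fun t ht => ?_⟩
  · filter_upwards [hmk t ht, val_ae (lift (γ₀' t) (γ₁' t)),
      Lp.coeFn_sub (-mkL2 (fun x => Φ (u t x) (W t x))) (der (lift (γ₀' t) (γ₁' t)) 0),
      Lp.coeFn_neg (mkL2 (fun x => Φ (u t x) (W t x)))] with x h1 h2 h3 h4
    simp only [hf]
    rw [h3, Pi.sub_apply, h4, Pi.neg_apply, h1, h2]
  · have e : f t + der (lift (γ₀' t) (γ₁' t)) 0 = -mkL2 (fun x => Φ (u t x) (W t x)) := by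
      simp only [hf, sub_add_cancel]
    rw [e]
    filter_upwards [hmk t ht, Lp.coeFn_neg (mkL2 (fun x => Φ (u t x) (W t x)))] with x h1 h4
    rw [h4, Pi.neg_apply, h1]

/-! ### A Gronwall inequality in the supremum norm -/

theorem aebdd_of_forall_pow {f : L2 0 1} {x y z : ℝ}
    (h : ∀ n : ℕ, AEBdd f ((x / 2 ^ n + y) * z)) : AEBdd f (y * z) := by
  have h' := ae_all_iff.2 h
  filter_upwards [h'] with ξ hξ
  have h1 : Tendsto (fun n : ℕ => (x / 2 ^ n + y) * z) atTop (𝓝 ((0 + y) * z)) :=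
    ((tendsto_const_nhds.div_atTop (tendsto_pow_atTop_atTop_of_one_lt one_lt_two)).add_const
      y).mul_const z
  rw [zero_add] at h1
  exact ge_of_tendsto' h1 hξ

theorem gronwall_mild {F : ℝ → L2 0 1} (hF : Continuous F) {T A B k : ℝ} (hA : 0 < A)
    (hB : 0 ≤ B) (hbd : ∀ t ∈ Icc 0 T, AEBdd (duhamel waveCos F t) k)
    (hFD : ∀ t ∈ Icc 0 T, ∀ᵐ x ∂(volume.restrict (Ioo (0 : ℝ) 1)),
      |F t x| ≤ A * |duhamel waveCos F t x| + B) {t : ℝ} (ht : t ∈ Icc 0 T) :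
    AEBdd (duhamel waveCos F t) (B * (2 * T * Real.exp (2 * A * T))) ∧
      AEBdd (duhamel waveSin F t) (B * (T * (A * (2 * T * Real.exp (2 * A * T)) + 1))) := by
  have hT : 0 ≤ T := ht.1.trans ht.2
  have hk : 0 ≤ k := (hbd t ht).nonneg
  have hl : 0 < 2 * A := by positivity
  have hFb : ∀ {t l : ℝ}, t ∈ Icc 0 T → AEBdd (duhamel waveCos F t) l → AEBdd (F t) (A * l + B) := by
    intro t l ht h
    filter_upwards [hFD t ht, h] with x h1 h2
    have := mul_le_mul_of_nonneg_left h2 hA.le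
    linarith
  have hiter : ∀ n : ℕ, ∀ t ∈ Icc 0 T,
      AEBdd (duhamel waveCos F t) ((k / 2 ^ n + 2 * B * T) * Real.exp (2 * A * t)) := by
    intro n
    induction n with
    | zero =>
      intro t ht
      refine (hbd t ht).mono ?_
      have h1 : 1 ≤ Real.exp (2 * A * t) := Real.one_le_exp (mul_nonneg hl.le ht.1)
      have h2 : k ≤ k / 2 ^ 0 + 2 * B * T := by
        have : 0 ≤ 2 * B * T := by positivity
        simpa
      exact h2.trans (le_mul_of_one_le_right (hk.trans h2) h1)
    | succ n ih =>
      intro t ht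
      have hd := AEBdd.duhamel continuous_waveCos (fun f M τ hf => hf.waveCos τ)
        (m := fun s => B + A * (k / 2 ^ n + 2 * B * T) * Real.exp (2 * A * s)) hF (by fun_prop) ht.1
        fun s hs => (hFb ⟨hs.1, hs.2.trans ht.2⟩ (ih s ⟨hs.1, hs.2.trans ht.2⟩)).mono
          (le_of_eq (by ring))
      refine hd.mono ?_
      have hc : Continuous fun s => A * (k / 2 ^ n + 2 * B * T) * Real.exp (2 * A * s) := by
        fun_prop
      rw [intervalIntegral.integral_add (by simp) (hc.intervalIntegrable _ _),
        intervalIntegral.integral_const, smul_eq_mul, sub_zero, intervalIntegral.integral_const_mul]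
      have hn : 0 ≤ k / 2 ^ n + 2 * B * T := by positivity
      have e1 := mul_le_mul_of_nonneg_left (integral_exp_le (t := t) hl) (mul_nonneg hA.le hn)
      have e2 : A * (k / 2 ^ n + 2 * B * T) * (Real.exp (2 * A * t) / (2 * A))
          = (k / 2 ^ (n + 1) + B * T) * Real.exp (2 * A * t) := by
        rw [pow_succ]
        field_simp
      have e3 : t * B ≤ B * T * Real.exp (2 * A * t) := by
        have h1 : 1 ≤ Real.exp (2 * A * t) := Real.one_le_exp (mul_nonneg hl.le ht.1)
        have h2 : t * B ≤ B * T := by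
          rw [mul_comm]
          exact mul_le_mul_of_nonneg_left ht.2 hB
        exact h2.trans (le_mul_of_one_le_right (by positivity) h1)
      rw [e2] at e1
      linarith
  have hcos : ∀ t ∈ Icc 0 T, AEBdd (duhamel waveCos F t) (B * (2 * T * Real.exp (2 * A * T))) := by
    intro t ht
    refine (aebdd_of_forall_pow fun n => hiter n t ht).mono ?_
    have : Real.exp (2 * A * t) ≤ Real.exp (2 * A * T) := by
      have := ht.2
      gcongr
    have := mul_le_mul_of_nonneg_left this (by positivity : 0 ≤ 2 * B * T)
    linarith
  refine ⟨hcos t ht, ?_⟩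
  have hd := AEBdd.duhamel continuous_waveSin (fun f M τ hf => hf.waveSin τ) hF
    (continuous_const (y := A * (B * (2 * T * Real.exp (2 * A * T))) + B)) ht.1
    fun s hs => hFb ⟨hs.1, hs.2.trans ht.2⟩ (hcos s ⟨hs.1, hs.2.trans ht.2⟩)
  refine hd.mono ?_
  rw [intervalIntegral.integral_const, smul_eq_mul, sub_zero]
  have := mul_le_mul_of_nonneg_right ht.2
    (by positivity : 0 ≤ A * (B * (2 * T * Real.exp (2 * A * T))) + B)
  linarith

/-! ### Extensions of continuously differentiable functions -/

theorem exists_primitive_extension {a b : ℝ} {g φ : ℝ → ℝ}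
    (hg : ∀ x ∈ Icc a b, HasDerivWithinAt g (φ x) (Icc a b) x) (hφ : Continuous φ) :
    ∃ γ : ℝ → ℝ, (∀ x, HasDerivAt γ (φ x) x) ∧ EqOn g γ (Icc a b) := by
  have hd : ∀ x, HasDerivAt (fun x => g a + ∫ t in a..x, φ t) (φ x) x := fun x =>
    (intervalIntegral.integral_hasDerivAt_right (hφ.intervalIntegrable _ _)
      (hφ.stronglyMeasurableAtFilter _ _) hφ.continuousAt).const_add _
  refine ⟨_, hd, fun x hx => ?_⟩
  refine eq_of_has_deriv_right_eq (f' := φ) (fun y hy => ?_)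
    (fun y _ => (hd y).hasDerivWithinAt) (fun y hy => (hg y hy).continuousWithinAt)
    (fun y _ => (hd y).continuousAt.continuousWithinAt) (by simp) x hx
  exact (hg y (Ico_subset_Icc_self hy)).mono_of_mem_nhdsWithin (Icc_mem_nhdsGE_of_mem hy)

/-- Twice continuously differentiable extensions to the line of the boundary fluxes. -/
structure BoundaryExt (d : Data) (γ₀ γ₁ γ₀' γ₁' γ₀'' γ₁'' : ℝ → ℝ) : Prop where
  hasDerivAt₀ : ∀ t, HasDerivAt γ₀ (γ₀' t) t
  hasDerivAt₁ : ∀ t, HasDerivAt γ₁ (γ₁' t) t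
  hasDerivAt₀' : ∀ t, HasDerivAt γ₀' (γ₀'' t) t
  hasDerivAt₁' : ∀ t, HasDerivAt γ₁' (γ₁'' t) t
  continuous₀ : Continuous γ₀''
  continuous₁ : Continuous γ₁''
  eqOn₀ : EqOn d.g₀ γ₀ (Icc 0 d.T)
  eqOn₁ : EqOn d.g₁ γ₁ (Icc 0 d.T)

theorem exists_extension₂ {T : ℝ} (hT : 0 < T) {g : ℝ → ℝ} (hg : ContDiffOn ℝ 4 g (Icc 0 T)) :
    ∃ γ γ' γ'' : ℝ → ℝ, (∀ t, HasDerivAt γ (γ' t) t) ∧ (∀ t, HasDerivAt γ' (γ'' t) t) ∧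
      Continuous γ'' ∧ EqOn g γ (Icc 0 T) := by
  have hu := uniqueDiffOn_Icc hT
  have h1 : ContDiffOn ℝ 3 (derivWithin g (Icc 0 T)) (Icc 0 T) := hg.derivWithin hu (by norm_num)
  have h2 : ContinuousOn (derivWithin (derivWithin g (Icc 0 T)) (Icc 0 T)) (Icc 0 T) :=
    h1.continuousOn_derivWithin hu (by norm_num)
  have hφ : Continuous fun t => derivWithin (derivWithin g (Icc 0 T)) (Icc 0 T)
      (projIcc 0 T hT.le t) :=
    (continuousOn_iff_continuous_domRestrict.1 h2).comp continuous_projIcc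
  obtain ⟨γ', hγ', e'⟩ := exists_primitive_extension (a := 0) (b := T)
    (g := derivWithin g (Icc 0 T)) (fun x hx => by
      rw [projIcc_of_mem hT.le hx]
      exact (h1.differentiableOn (by norm_num) x hx).hasDerivWithinAt) hφ
  obtain ⟨γ, hγ, e⟩ := exists_primitive_extension (a := 0) (b := T) (g := g) (φ := γ')
    (fun x hx => by
      rw [← e' hx]
      exact (hg.differentiableOn (by norm_num) x hx).hasDerivWithinAt)
    (continuous_iff_continuousAt.2 fun t => (hγ' t).continuousAt)
  exact ⟨γ, γ', _, hγ, hγ', hφ, e⟩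

theorem exists_boundaryExt (d : Data) : ∃ γ₀ γ₁ γ₀' γ₁' γ₀'' γ₁'' : ℝ → ℝ,
    BoundaryExt d γ₀ γ₁ γ₀' γ₁' γ₀'' γ₁'' := by
  obtain ⟨γ₀, γ₀', γ₀'', a1, a2, a3, a4⟩ := exists_extension₂ d.T_pos d.contDiffOn_g₀
  obtain ⟨γ₁, γ₁', γ₁'', b1, b2, b3, b4⟩ := exists_extension₂ d.T_pos d.contDiffOn_g₁
  exact ⟨γ₀, γ₁, γ₀', γ₁', γ₀'', γ₁'', a1, b1, a2, b2, a3, b3, a4, b4⟩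

/-! ### Functions in `H²(m,M)` -/

section H2

variable {m M : ℝ}

theorem continuousOn_derivVal (h : m < M) (a : Sobolev 2 m M) :
    ContinuousOn (derivVal a) (Icc m M) :=
  (HasWeakDeriv.continuousOn_contRep h (a.2 1) : _)

theorem exists_H2_extension (h : m < M) (b : Sobolev 2 m M) : ∃ β β' : ℝ → ℝ,
    (∀ ξ, HasDerivAt β (β' ξ) ξ) ∧ Continuous β' ∧ EqOn (val b) β (Icc m M) ∧
      EqOn (derivVal b) β' (Icc m M) ∧ ∃ C, ∀ ξ, |β' ξ| ≤ C := by
  have hc := continuousOn_derivVal h b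
  have hφ : Continuous fun ξ => derivVal b (projIcc m M h.le ξ) :=
    (continuousOn_iff_continuous_domRestrict.1 hc).comp continuous_projIcc
  have he : EqOn (derivVal b) (fun ξ => derivVal b (projIcc m M h.le ξ)) (Icc m M) :=
    fun ξ hξ => by simp only [projIcc_of_mem h.le hξ]
  have hw : HasWeakDeriv (der b 0) (der b 1) := b.2 0
  have hw' : HasWeakDeriv (der b 1) (der b 2) := b.2 1
  refine ⟨fun ξ => val b m + ∫ t in m..ξ, derivVal b (projIcc m M h.le t), _, fun ξ =>
    (intervalIntegral.integral_hasDerivAt_right (hφ.intervalIntegrable _ _)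
      (hφ.stronglyMeasurableAtFilter _ _) hφ.continuousAt).const_add _, hφ, fun ξ hξ => ?_, he, ?_⟩
  · have h1 := hw.contRep_sub h (left_mem_Icc.2 h.le) hξ
    have h2 : ∫ t in m..ξ, der b 1 t = ∫ t in m..ξ, derivVal b (projIcc m M h.le t) := by
      rw [intervalIntegral_eq_Ioo hξ.1, intervalIntegral_eq_Ioo hξ.1]
      refine integral_congr_ae ?_
      have hs : Ioo m ξ ⊆ Ioo m M := Ioo_subset_Ioo_right hξ.2
      filter_upwards [ae_restrict_of_ae_restrict_of_subset hs (hw'.ae_eq_contRep h),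
        ae_restrict_mem measurableSet_Ioo] with t h3 h4
      rw [h3]
      exact he (Ioo_subset_Icc_self (hs h4))
    simp only [← h2, ← h1, val]
    ring
  · obtain ⟨C, hC⟩ := isCompact_Icc.exists_bound_of_continuousOn hc
    exact ⟨C, fun ξ => hC _ (projIcc m M h.le ξ).2⟩

theorem hasDerivWithinAt_val (h : m < M) (b : Sobolev 2 m M) {ξ : ℝ} (hξ : ξ ∈ Icc m M) :
    HasDerivWithinAt (val b) (derivVal b ξ) (Icc m M) ξ := by
  obtain ⟨β, β', h1, _, h3, h4, _⟩ := exists_H2_extension h b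
  rw [h4 hξ]
  exact (h1 ξ).hasDerivWithinAt.congr h3 (h3 hξ)

theorem derivVal_eq_deriv (h : m < M) {a : Sobolev 2 m M} {α : ℝ → ℝ} (hα : Differentiable ℝ α)
    (ha : ∀ ξ ∈ Icc m M, val a ξ = α ξ) {ξ : ℝ} (hξ : ξ ∈ Icc m M) : derivVal a ξ = deriv α ξ :=
  (uniqueDiffOn_Icc h ξ hξ).eq_deriv _ (hasDerivWithinAt_val h a hξ)
    ((hα ξ).hasDerivAt.hasDerivWithinAt.congr ha (ha ξ hξ))

theorem val_add_smul₂ (h : m < M) (a b : Sobolev 2 m M) (c : ℝ) {ξ : ℝ} (hξ : ξ ∈ Icc m M) :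
    val (a + c • b) ξ = val a ξ + c * val b ξ := by
  have ha : HasWeakDeriv (der a 0) (der a 1) := a.2 0
  have hb : HasWeakDeriv (der b 0) (der b 1) := b.2 0
  rw [val, der_add, der_smul, contRep_add h ha (hb.smul c) hξ, contRep_smul h c hb hξ]
  rfl

theorem val_sub₂ (h : m < M) (a b : Sobolev 2 m M) {ξ : ℝ} (hξ : ξ ∈ Icc m M) :
    val (a - b) ξ = val a ξ - val b ξ := by
  have := val_add_smul₂ h a b (-1) hξ
  rw [neg_one_smul, ← sub_eq_add_neg] at this
  rw [this]
  ring

theorem derivVal_sub₂ (h : m < M) (a b : Sobolev 2 m M) {ξ : ℝ} (hξ : ξ ∈ Icc m M) :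
    derivVal (a - b) ξ = derivVal a ξ - derivVal b ξ :=
  (uniqueDiffOn_Icc h ξ hξ).eq_deriv _ (hasDerivWithinAt_val h (a - b) hξ)
    (((hasDerivWithinAt_val h a hξ).sub (hasDerivWithinAt_val h b hξ)).congr
      (fun _ hη => val_sub₂ h a b hη) (val_sub₂ h a b hξ))

theorem exists_H2_bound (h : m < M) : ∃ C : ℝ, 0 ≤ C ∧ ∀ b : Sobolev 2 m M, ∀ ξ ∈ Icc m M,
    |val b ξ| ≤ C * ‖b‖ ∧ |derivVal b ξ| ≤ C * ‖b‖ := by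
  obtain ⟨C, hC, hb⟩ := HasWeakDeriv.exists_bound h
  refine ⟨C * 2, by positivity, fun b ξ hξ => ?_⟩
  have h0 := norm_der_le b 0
  have h1 := norm_der_le b 1
  have h2 := norm_der_le b 2
  have k1 := hb (f := der b 0) (g := der b 1) (b.2 0) ξ hξ
  have k2 := hb (f := der b 1) (g := der b 2) (b.2 1) ξ hξ
  have e1 : C * (‖der b 0‖ + ‖der b 1‖) ≤ C * (‖b‖ + ‖b‖) := by gcongr
  have e2 : C * (‖der b 1‖ + ‖der b 2‖) ≤ C * (‖b‖ + ‖b‖) := by gcongr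
  exact ⟨k1.trans (by linarith), k2.trans (by linarith)⟩

theorem abs_val_sub_le (h : m < M) {b : Sobolev 2 m M} {C : ℝ}
    (hC : ∀ ξ ∈ Icc m M, |derivVal b ξ| ≤ C) {ξ η : ℝ} (hξ : ξ ∈ Icc m M) (hη : η ∈ Icc m M) :
    |val b η - val b ξ| ≤ C * |η - ξ| :=
  (convex_Icc m M).norm_image_sub_le_of_norm_hasDerivWithin_le
    (fun _ hx => hasDerivWithinAt_val h b hx) hC hξ hη

end H2

/-! ### Damping laws -/

namespace IsDampingLaw

variable {K : Bounds} {α : ℝ → ℝ}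

theorem differentiable (h : IsDampingLaw K α) : Differentiable ℝ α :=
  h.contDiff.differentiable (by norm_num)

theorem continuous_deriv (h : IsDampingLaw K α) : Continuous (deriv α) :=
  h.contDiff.continuous_deriv (by norm_num)

theorem hasDerivAt_deriv (h : IsDampingLaw K α) (ξ : ℝ) :
    HasDerivAt (deriv α) (iteratedDeriv 2 α ξ) ξ := by
  have h1 : ContDiff ℝ 1 (deriv α) := (contDiff_succ_iff_deriv (n := 1).1 (by
    exact_mod_cast h.contDiff)).2.2
  have := (h1.differentiable (by norm_num) ξ).hasDerivAt
  rwa [iteratedDeriv_succ, iteratedDeriv_one]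

theorem abs_deriv_le (h : IsDampingLaw K α) (ξ : ℝ) : |deriv α ξ| ≤ K.a₁ := by
  have h1 := h.le_deriv ξ
  have h2 := h.deriv_le ξ
  have h3 := K.a₀_pos
  rw [abs_of_nonneg (by linarith)]
  exact h2

theorem abs_sub_le (h : IsDampingLaw K α) (y z : ℝ) : |α z - α y| ≤ K.a₁ * |z - y| :=
  convex_univ.norm_image_sub_le_of_norm_deriv_le (fun x _ => h.differentiable x)
    (fun x _ => h.abs_deriv_le x) (mem_univ y) (mem_univ z)

theorem abs_deriv_sub_le (h : IsDampingLaw K α) (y z : ℝ) :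
    |deriv α z - deriv α y| ≤ K.a₂ * |z - y| :=
  convex_univ.norm_image_sub_le_of_norm_hasDerivWithin_le
    (fun x _ => (h.hasDerivAt_deriv x).hasDerivWithinAt) (fun x _ => h.abs_deriv2_le x)
    (mem_univ y) (mem_univ z)

theorem abs_taylor_le (h : IsDampingLaw K α) (y z : ℝ) :
    |α z - α y - deriv α y * (z - y)| ≤ K.a₂ * |z - y| ^ 2 := by
  have key := (convex_uIcc y z).norm_image_sub_le_of_norm_hasDerivWithin_le
    (f := fun ξ => α ξ - deriv α y * ξ) (f' := fun ξ => deriv α ξ - deriv α y)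
    (C := K.a₂ * |z - y|) (fun ξ _ => (((h.differentiable ξ).hasDerivAt).sub
      (by simpa using (hasDerivAt_id ξ).const_mul (deriv α y))).hasDerivWithinAt)
    (fun ξ hξ => (h.abs_deriv_sub_le y ξ).trans
      (mul_le_mul_of_nonneg_left (abs_sub_left_of_mem_uIcc hξ) K.a₂_pos.le))
    left_mem_uIcc right_mem_uIcc
  rw [Real.norm_eq_abs, Real.norm_eq_abs] at key
  rw [show α z - α y - deriv α y * (z - y) = α z - deriv α y * z - (α y - deriv α y * y) by ring]
  linarith

theorem monotone_mul (h : IsDampingLaw K α) (y z : ℝ) : 0 ≤ (α y - α z) * (y - z) := by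
  have hm : Monotone α := monotone_of_deriv_nonneg h.differentiable fun x =>
    K.a₀_pos.le.trans (h.le_deriv x)
  rcases le_total y z with hyz | hyz
  · exact mul_nonneg_of_nonpos_of_nonpos (sub_nonpos.2 (hm hyz)) (sub_nonpos.2 hyz)
  · exact mul_nonneg (sub_nonneg.2 (hm hyz)) (sub_nonneg.2 hyz)

end IsDampingLaw

/-! ### Pressure drops -/

theorem exists_pressureDrop {T : ℝ} {p : ℝ → Sobolev 1 0 1} (hp : ContinuousOn p (Icc 0 T)) :
    ∃ h : L2 0 T, IsPressureDrop p h := by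
  have hc : ContinuousOn (fun t => val (p t) 0 - val (p t) 1) (Icc 0 T) :=
    (val_continuousOn hp (by simp)).sub (val_continuousOn hp (by simp))
  exact ⟨(memLp_of_continuousOn hc).toLp _, MemLp.coeFn_toLp _⟩

theorem IsPressureDrop.congr {T : ℝ} {p p' : ℝ → Sobolev 1 0 1} {h : L2 0 T}
    (hp : IsPressureDrop p h) (he : EqOn p p' (Icc 0 T)) : IsPressureDrop p' h := by
  filter_upwards [hp, ae_restrict_mem measurableSet_Ioo] with t h1 h2
  rw [h1, he (Ioo_subset_Icc_self h2)]

theorem IsPressureDrop.unique {T : ℝ} {p : ℝ → Sobolev 1 0 1} {h h' : L2 0 T}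
    (hp : IsPressureDrop p h) (hp' : IsPressureDrop p h') : h = h' :=
  Lp.ext (hp.trans hp'.symm)

theorem IsPressureDrop.add_smul {T : ℝ} {p p' : ℝ → Sobolev 1 0 1} {h h' : L2 0 T}
    (hp : IsPressureDrop p h) (hp' : IsPressureDrop p' h') (c : ℝ) :
    IsPressureDrop (fun t => p t + c • p' t) (h + c • h') := by
  filter_upwards [hp, hp', Lp.coeFn_add h (c • h'), Lp.coeFn_smul c h'] with t h1 h2 h3 h4
  rw [h3, Pi.add_apply, h4, Pi.smul_apply, h1, h2, val_add (by simp), val_add (by simp),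
    val_smul _ (by simp), val_smul _ (by simp), smul_eq_mul]
  ring

theorem IsPressureDrop.norm_le {T : ℝ} (hT : 0 < T) {p : ℝ → Sobolev 1 0 1} {h : L2 0 T}
    (hp : IsPressureDrop p h) {C : ℝ}
    (hC : ∀ t ∈ Icc 0 T, ∀ x ∈ Icc (0 : ℝ) 1, |val (p t) x| ≤ C) : ‖h‖ ≤ √T * (2 * C) := by
  have h0 : 0 ≤ C := (abs_nonneg _).trans (hC 0 ⟨le_rfl, hT.le⟩ 0 (by simp))
  have := Lp.norm_le_of_ae_bound (f := h) (C := 2 * C) (by positivity) (by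
    filter_upwards [hp, ae_restrict_mem measurableSet_Ioo] with t h1 h2
    rw [h1, Real.norm_eq_abs]
    have a0 := hC t (Ioo_subset_Icc_self h2) 0 (by simp)
    have a1 := hC t (Ioo_subset_Icc_self h2) 1 (by simp)
    exact (abs_sub _ _).trans (by linarith))
  refine this.trans (mul_le_mul_of_nonneg_right (le_of_eq ?_) (by positivity))
  simp [measureUnivNNReal, Real.volume_Ioo, Real.sqrt_eq_rpow, ENNReal.ofReal,
    Real.coe_toNNReal T hT.le]

/-! ### Estimates for mild solutions -/

theorem IsMild.sub {f f' : ℝ → L2 0 1} {γ₀ γ₁ : ℝ → ℝ} {c : ℝ} {p u p' u' : ℝ → Sobolev 1 0 1}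
    (h : IsMild f γ₀ γ₁ c p u) (h' : IsMild f' γ₀ γ₁ c p' u') :
    IsMild (fun t => f t - f' t) (fun _ => 0) (fun _ => 0) 0 (fun t => p t + (-1 : ℝ) • p' t)
      (fun t => u t + (-1 : ℝ) • u' t) := by
  have h0 : affineH1 0 0 = 0 := by rw [affineH1_eq]; simp
  refine ⟨h.continuous.sub h'.continuous, fun t => ?_, fun t => ?_⟩
  · rw [← duhamel_sub continuous_waveSin h.continuous h'.continuous, der_add, der_smul, h.der_p,
      h'.der_p]
    simp [h0]
    abel
  · rw [← duhamel_sub continuous_waveCos h.continuous h'.continuous, der_add, der_smul, h.der_u,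
      h'.der_u]
    simp [lift, h0]
    abel

/-- The constant in the supremum norm estimates. -/
def gronwallConst (A T : ℝ) : ℝ :=
  2 * T * Real.exp (2 * A * T) + T * (A * (2 * T * Real.exp (2 * A * T)) + 1)

theorem gronwallConst_nonneg {A T : ℝ} (hA : 0 < A) (hT : 0 < T) : 0 ≤ gronwallConst A T := by
  unfold gronwallConst
  positivity

theorem IsMild.estimate {f : ℝ → L2 0 1} {p u : ℝ → Sobolev 1 0 1}
    (h : IsMild f (fun _ => 0) (fun _ => 0) 0 p u) {T A B k : ℝ} (hA : 0 < A)
    (hB : 0 ≤ B) (hk : ∀ t ∈ Icc 0 T, AEBdd (der (u t) 0) k)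
    (hf : ∀ t ∈ Icc 0 T, ∀ᵐ x ∂(volume.restrict (Ioo (0 : ℝ) 1)),
      |f t x| ≤ A * |val (u t) x| + B) {t : ℝ} (ht : t ∈ Icc 0 T) {x : ℝ}
    (hx : x ∈ Icc (0 : ℝ) 1) :
    |val (u t) x| ≤ B * gronwallConst A T ∧ |val (p t) x| ≤ B * gronwallConst A T := by
  have hT : 0 ≤ T := ht.1.trans ht.2
  have h0 : affineH1 0 0 = 0 := by rw [affineH1_eq]; simp
  have hu : ∀ t, der (u t) 0 = duhamel waveCos f t := fun t => by
    rw [h.der_u]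
    simp [lift, h0]
  have hp : ∀ t, der (p t) 0 = duhamel waveSin f t := fun t => by
    rw [h.der_p]
    simp [h0]
  have key := gronwall_mild h.continuous hA hB (fun t ht => by rw [← hu]; exact hk t ht)
    (fun t ht => by
      rw [← hu]
      filter_upwards [hf t ht, val_ae (u t)] with x h1 h2
      rwa [h2]) ht
  rw [← hu, ← hp] at key
  constructor
  · refine (val_bound_of_aebdd key.1 hx).trans (mul_le_mul_of_nonneg_left ?_ hB)
    rw [gronwallConst]
    have : 0 ≤ T * (A * (2 * T * Real.exp (2 * A * T)) + 1) := by positivity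
    linarith
  · refine (val_bound_of_aebdd key.2 hx).trans (mul_le_mul_of_nonneg_left ?_ hB)
    rw [gronwallConst]
    have : 0 ≤ 2 * T * Real.exp (2 * A * T) := by positivity
    linarith

/-! ### The state system -/

namespace IsDampingLaw

variable {K : Bounds} {α : ℝ → ℝ}

theorem hasPartials (h : IsDampingLaw K α) :
    HasPartials (fun _ z => α z) (fun _ _ => 0) (fun _ z => deriv α z) where
  hasFDerivAt q := by
    have := (h.differentiable q.2).hasDerivAt.comp_hasFDerivAt q
      (hasFDerivAt_snd (𝕜 := ℝ) (E := ℝ) (F := ℝ) (p := q))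
    rw [zero_smul, zero_add]
    exact this
  continuous_fst := continuous_const
  continuous_snd := h.continuous_deriv.comp continuous_snd

theorem partialBounds (h : IsDampingLaw K α) :
    PartialBounds (fun _ _ => 0) (fun _ z => deriv α z) (K.a₁ + K.a₂) := by
  have h1 := K.a₁_pos
  have h2 := K.a₂_pos
  refine ⟨by positivity, fun y z => ?_, fun y z => ?_, fun y z z' => ?_, fun y z z' => ?_⟩
  · rw [abs_zero]
    positivity
  · exact (h.abs_deriv_le z).trans (by linarith)
  · rw [sub_zero, abs_zero]
    positivity
  · exact (h.abs_deriv_sub_le z' z).trans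
      (mul_le_mul_of_nonneg_right (by linarith) (abs_nonneg _))

theorem hasPartials_linearized (h : IsDampingLaw K α) {β β' : ℝ → ℝ}
    (hβ : ∀ ξ, HasDerivAt β (β' ξ) ξ) (hc : Continuous β') :
    HasPartials (fun y z => deriv α y * z + β y) (fun y z => iteratedDeriv 2 α y * z + β' y)
      (fun y _ => deriv α y) where
  hasFDerivAt q := by
    have h1 := hasFDerivAt_fst (𝕜 := ℝ) (E := ℝ) (F := ℝ) (p := q)
    have h2 := hasFDerivAt_snd (𝕜 := ℝ) (E := ℝ) (F := ℝ) (p := q)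
    have key := (((h.hasDerivAt_deriv q.1).comp_hasFDerivAt q h1).mul h2).add
      ((hβ q.1).comp_hasFDerivAt q h1)
    refine key.congr_fderiv ?_
    ext <;> simp [mul_comm]
  continuous_fst := ((h.contDiff.continuous_iteratedDeriv 2 le_rfl).comp continuous_fst).mul
    continuous_snd |>.add (hc.comp continuous_fst)
  continuous_snd := h.continuous_deriv.comp continuous_fst

theorem partialBounds_linearized (h : IsDampingLaw K α) {β' : ℝ → ℝ} {C : ℝ}
    (hC : ∀ ξ, |β' ξ| ≤ C) :
    PartialBounds (fun y z => iteratedDeriv 2 α y * z + β' y) (fun y _ => deriv α y)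
      (K.a₁ + K.a₂ + C) := by
  have h1 := K.a₁_pos
  have h2 := K.a₂_pos
  have hC0 : 0 ≤ C := (abs_nonneg _).trans (hC 0)
  refine ⟨by positivity, fun y z => ?_, fun y z => ?_, fun y z z' => ?_, fun y z z' => ?_⟩
  · have a1 := abs_add_le (iteratedDeriv 2 α y * z) (β' y)
    rw [abs_mul] at a1
    have a2 := mul_le_mul_of_nonneg_right (h.abs_deriv2_le y) (abs_nonneg z)
    have a3 := hC y
    have a4 := abs_nonneg z
    nlinarith [mul_nonneg h1.le a4, mul_nonneg hC0 a4]
  · exact (h.abs_deriv_le y).trans (by linarith)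
  · rw [add_sub_add_right_eq_sub, ← mul_sub, abs_mul]
    exact mul_le_mul_of_nonneg_right ((h.abs_deriv2_le y).trans (by linarith)) (abs_nonneg _)
  · rw [sub_self, abs_zero]
    positivity

end IsDampingLaw

theorem bddCurve_zero : BddCurve (fun _ => 0) (fun _ => 0) 0 :=
  ⟨fun t => hasDerivAt_const t 0, continuous_const, fun _ => aebdd_zero, aebdd_zero⟩

/-- A solution of the state system together with its representation by d'Alembert's formula. -/
structure MildState (d : Data) (γ₀ γ₁ γ₀' γ₁' α : ℝ → ℝ) (p u : ℝ → Sobolev 1 0 1)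
    (f : ℝ → L2 0 1) : Prop where
  state : IsState d α p u
  mild : IsMild f γ₀ γ₁ d.c p u
  source : ∀ t ∈ Icc 0 d.T, f t =ᵐ[volume.restrict (Ioo (0 : ℝ) 1)]
    fun x => -α (val (u t) x) - val (lift (γ₀' t) (γ₁' t)) x
  curve : ∃ (W W' : ℝ → L2 0 1) (M' : ℝ), BddCurve W W' M' ∧ ∀ t ∈ Icc 0 d.T, W t = der (u t) 0

theorem exists_mildState {d : Data} {K : Bounds} {γ₀ γ₁ γ₀' γ₁' γ₀'' γ₁'' α : ℝ → ℝ}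
    (hα : IsDampingLaw K α) (hγ : BoundaryExt d γ₀ γ₁ γ₀' γ₁' γ₀'' γ₁'') :
    ∃ p u f, MildState d γ₀ γ₁ γ₀' γ₁' α p u f := by
  have h0 : (0 : ℝ) ∈ Icc 0 d.T := ⟨le_rfl, d.T_pos.le⟩
  obtain ⟨p, u, f, W, W', M', h1, h2, h3, h4, h5⟩ := exists_semilinear_wave d.T_pos hα.hasPartials
    hα.partialBounds bddCurve_zero hγ.hasDerivAt₀ hγ.hasDerivAt₁ hγ.hasDerivAt₀' hγ.hasDerivAt₁'
    hγ.continuous₀ hγ.continuous₁ (by rw [← hγ.eqOn₀ h0, d.g₀_zero])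
    (by rw [← hγ.eqOn₁ h0, d.g₁_zero]) d.c
  exact ⟨p, u, f, h5 _ _ hγ.eqOn₀ hγ.eqOn₁, h3, h4, W, W', M', h1, h2⟩

theorem IsState.unique {d : Data} {K : Bounds} {α : ℝ → ℝ} (hα : IsDampingLaw K α)
    {p u p' u' : ℝ → Sobolev 1 0 1} (h : IsState d α p u) (h' : IsState d α p' u') :
    EqOn p p' (Icc 0 d.T) ∧ EqOn u u' (Icc 0 d.T) :=
  h.eqOn_of_dissipative d.T_pos h' fun t _ x _ => by
    have := hα.monotone_mul (val (u t) x) (val (u' t) x)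
    linarith

theorem MildState.exists_aebdd {d : Data} {γ₀ γ₁ γ₀' γ₁' α : ℝ → ℝ} {p u : ℝ → Sobolev 1 0 1}
    {f : ℝ → L2 0 1} (h : MildState d γ₀ γ₁ γ₀' γ₁' α p u f) :
    ∃ k, ∀ t ∈ Icc 0 d.T, AEBdd (der (u t) 0) k := by
  obtain ⟨W, W', M', h1, h2⟩ := h.curve
  refine ⟨M' * (1 + d.T), fun t ht => ?_⟩
  rw [← h2 t ht]
  refine (h1.aebdd t).mono ?_
  have h3 := h1.nonneg
  have h4 := ht.2
  rw [abs_of_nonneg ht.1]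
  gcongr

theorem isMild_zero {γ₀ γ₁ : ℝ → ℝ} {c : ℝ} : IsMild (fun _ => 0) γ₀ γ₁ c
    (fun t => affineH1 (c - ∫ s in (0 : ℝ)..t, (γ₁ s - γ₀ s)) 0) (fun t => lift (γ₀ t) (γ₁ t)) :=
  ⟨continuous_const, fun t => by simp [duhamel], fun t => by simp [duhamel]⟩

theorem val_add_neg_smul (f g : Sobolev 1 0 1) {x : ℝ} (hx : x ∈ Icc (0 : ℝ) 1) :
    val (f + (-1 : ℝ) • g) x = val f x - val g x := by
  rw [val_add hx, val_smul _ hx]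
  ring

theorem aebdd_add_neg_smul {f g : Sobolev 1 0 1} {k l : ℝ} (hf : AEBdd (der f 0) k)
    (hg : AEBdd (der g 0) l) : AEBdd (der (f + (-1 : ℝ) • g) 0) (k + l) := by
  rw [der_add, der_smul, neg_one_smul, ← sub_eq_add_neg]
  exact hf.sub hg

theorem exists_fluxBounds (d : Data) (K : Bounds) : ∃ m M : ℝ, m < M ∧ AreFluxBounds d K m M := by
  obtain ⟨γ₀, γ₁, γ₀', γ₁', γ₀'', γ₁'', hγ⟩ := exists_boundaryExt d
  have hc : ∀ {γ γ' : ℝ → ℝ}, (∀ t, HasDerivAt γ (γ' t) t) → Continuous γ := fun h =>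
    continuous_iff_continuousAt.2 fun t => (h t).continuousAt
  obtain ⟨C, hC, hb⟩ := exists_aebdd_bound (hc hγ.hasDerivAt₀) (hc hγ.hasDerivAt₁) d.T
  obtain ⟨C', hC', hb'⟩ := exists_aebdd_bound (hc hγ.hasDerivAt₀') (hc hγ.hasDerivAt₁') d.T
  have ha₁ := K.a₁_pos
  set R : ℝ := (K.a₁ * C + C') * gronwallConst K.a₁ d.T + C with hR
  have hR0 : 0 ≤ R := by
    have := gronwallConst_nonneg ha₁ d.T_pos
    positivity
  refine ⟨-(R + 1), R + 1, by linarith, fun α hα p u hpu t ht x hx => ?_⟩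
  obtain ⟨p', u', f, h⟩ := exists_mildState hα hγ
  rw [(hpu.unique hα h.state).2 ht]
  obtain ⟨k, hk⟩ := h.exists_aebdd
  have est := (h.mild.sub isMild_zero).estimate (T := d.T) ha₁
    (B := K.a₁ * C + C') (by positivity)
    (fun t ht => aebdd_add_neg_smul (hk t ht) (hb t ht)) (fun t ht => by
      filter_upwards [h.source t ht, Lp.coeFn_sub (f t) 0,
        Lp.coeFn_zero ℝ 2 (volume.restrict (Ioo (0 : ℝ) 1)), hb t ht, hb' t ht,
        val_ae (lift (γ₀ t) (γ₁ t)), val_ae (lift (γ₀' t) (γ₁' t)),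
        ae_restrict_mem measurableSet_Ioo] with x h1 h2 h3 h4 h5 h6 h7 h8
      rw [h2, Pi.sub_apply, h3, h1, val_add_neg_smul _ _ (Ioo_subset_Icc_self h8)]
      rw [h6] at h4
      rw [h7] at h5
      have k1 := hα.abs_sub_le 0 (val (u' t) x)
      rw [hα.zero, sub_zero, sub_zero] at k1
      have k2 := abs_add_le (val (u' t) x - val (lift (γ₀ t) (γ₁ t)) x) (val (lift (γ₀ t) (γ₁ t)) x)
      rw [sub_add_cancel] at k2
      have k3 := abs_sub (-α (val (u' t) x)) (val (lift (γ₀' t) (γ₁' t)) x)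
      rw [abs_neg] at k3
      simp only [Pi.zero_apply, sub_zero]
      nlinarith) ht hx
  have e1 := est.1
  have e2 := val_bound_of_aebdd (hb t ht) hx
  rw [val_add_neg_smul _ _ hx] at e1
  rw [abs_le] at e1 e2
  constructor <;> linarith [e1.1, e1.2, e2.1, e2.2]

section FluxBounds

variable {d : Data} {K : Bounds} {m M : ℝ}

theorem isStateFor_iff (hfb : AreFluxBounds d K m M) {a : Sobolev 2 m M} {α : ℝ → ℝ}
    (hα : IsDampingLaw K α) (ha : ∀ ξ ∈ Icc m M, val a ξ = α ξ) {p u : ℝ → Sobolev 1 0 1} :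
    IsStateFor d a p u ↔ IsState d α p u := by
  constructor
  · rintro ⟨h, hv⟩
    refine h.congr fun t ht => ?_
    filter_upwards [ae_restrict_mem measurableSet_Ioo] with x hx
    rw [ha _ (hv t ht x (Ioo_subset_Icc_self hx))]
  · intro h
    have hv := hfb α hα p u h
    refine ⟨h.congr fun t ht => ?_, hv⟩
    filter_upwards [ae_restrict_mem measurableSet_Ioo] with x hx
    rw [ha _ (hv t ht x (Ioo_subset_Icc_self hx))]

theorem IsStateFor.unique (hfb : AreFluxBounds d K m M) {a : Sobolev 2 m M} (ha : a ∈ domF K m M)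
    {p u p' u' : ℝ → Sobolev 1 0 1} (h : IsStateFor d a p u) (h' : IsStateFor d a p' u') :
    EqOn p p' (Icc 0 d.T) ∧ EqOn u u' (Icc 0 d.T) := by
  obtain ⟨α, hα, hv⟩ := ha
  exact ((isStateFor_iff hfb hα hv).1 h).unique hα ((isStateFor_iff hfb hα hv).1 h')

theorem isPressureDrop_forwardOp (hfb : AreFluxBounds d K m M) {a : Sobolev 2 m M}
    (ha : a ∈ domF K m M) {p u : ℝ → Sobolev 1 0 1} (h : IsStateFor d a p u) :
    IsPressureDrop p (forwardOp d m M a) := by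
  obtain ⟨y, hy⟩ := exists_pressureDrop h.1.continuousOn_p
  have hex : ∃ y : L2 0 d.T, ∃ p u, IsStateFor d a p u ∧ IsPressureDrop p y := ⟨y, p, u, h, hy⟩
  rw [forwardOp, dif_pos hex]
  obtain ⟨p', u', h1, h2⟩ := hex.choose_spec
  exact h2.congr (h1.unique hfb ha h).1

/-! ### The sensitivity system -/

/-- A solution of the sensitivity system together with its representation by d'Alembert's
formula. -/
structure MildSensitivity (d : Data) (a b : Sobolev 2 m M) (u r w : ℝ → Sobolev 1 0 1)
    (f : ℝ → L2 0 1) : Prop where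
  sensitivity : IsSensitivity d a b u r w
  mild : IsMild f (fun _ => 0) (fun _ => 0) 0 r w
  source : ∀ t ∈ Icc 0 d.T, f t =ᵐ[volume.restrict (Ioo (0 : ℝ) 1)]
    fun x => -derivVal a (val (u t) x) * val (w t) x - val b (val (u t) x)
  exists_aebdd : ∃ k, ∀ t ∈ Icc 0 d.T, AEBdd (der (w t) 0) k

theorem exists_mildSensitivity (hmM : m < M) {a : Sobolev 2 m M} {α : ℝ → ℝ}
    (hα : IsDampingLaw K α) (ha : ∀ ξ ∈ Icc m M, val a ξ = α ξ) {p u : ℝ → Sobolev 1 0 1}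
    {γ₀ γ₁ γ₀' γ₁' : ℝ → ℝ} {F : ℝ → L2 0 1} (hs : MildState d γ₀ γ₁ γ₀' γ₁' α p u F)
    (hv : TakesValuesIn d m M u) (b : Sobolev 2 m M) :
    ∃ r w f, MildSensitivity d a b u r w f := by
  obtain ⟨U, U', N, hU, hUu⟩ := hs.curve
  obtain ⟨β, β', hβ, hβc, hβb, _, C, hC⟩ := exists_H2_extension hmM b
  obtain ⟨r, w, f, W, W', N', h1, h2, h3, h4, h5⟩ := exists_semilinear_wave d.T_pos
    (hα.hasPartials_linearized hβ hβc) (hα.partialBounds_linearized hC) hU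
    (γ₀ := fun _ => 0) (γ₁ := fun _ => 0) (γ₀' := fun _ => 0) (γ₁' := fun _ => 0)
    (γ₀'' := fun _ => 0) (γ₁'' := fun _ => 0)
    (fun t => hasDerivAt_const t 0) (fun t => hasDerivAt_const t 0) (fun t => hasDerivAt_const t 0)
    (fun t => hasDerivAt_const t 0) continuous_const continuous_const rfl rfl 0
  have hpt : ∀ t ∈ Icc 0 d.T, ∀ᵐ x ∂(volume.restrict (Ioo (0 : ℝ) 1)),
      -(deriv α (U t x) * val (w t) x + β (U t x))
        = -derivVal a (val (u t) x) * val (w t) x - val b (val (u t) x) := by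
    intro t ht
    rw [hUu t ht]
    filter_upwards [val_ae (u t), ae_restrict_mem measurableSet_Ioo] with x hx hx'
    have hm := hv t ht x (Ioo_subset_Icc_self hx')
    rw [hx, hβb hm, derivVal_eq_deriv hmM hα.differentiable ha hm]
    ring
  refine ⟨r, w, f, (h5 _ _ (fun _ _ => rfl) (fun _ _ => rfl)).congr hpt, h3, fun t ht => ?_,
    N' * (1 + d.T), fun t ht => ?_⟩
  · filter_upwards [h4 t ht, hpt t ht, ae_restrict_mem measurableSet_Ioo] with x k1 k2 k3
    rw [k1, k2, lift, val_affineH1 _ _ (Ioo_subset_Icc_self k3)]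
    ring
  · rw [← h2 t ht]
    refine (h1.aebdd t).mono ?_
    have h3 := h1.nonneg
    have h4 := ht.2
    rw [abs_of_nonneg ht.1]
    gcongr

theorem IsSensitivity.congr_flux {a b : Sobolev 2 m M} {u u' r w : ℝ → Sobolev 1 0 1}
    (h : IsSensitivity d a b u r w) (he : EqOn u u' (Icc 0 d.T)) :
    IsSensitivity d a b u' r w :=
  IsClassicalSolution.congr h fun t ht => by rw [he ht]

theorem IsSensitivity.unique (hmM : m < M) {a b : Sobolev 2 m M} (ha : a ∈ domF K m M)
    {u r w r' w' : ℝ → Sobolev 1 0 1} (hv : TakesValuesIn d m M u)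
    (h : IsSensitivity d a b u r w) (h' : IsSensitivity d a b u r' w') :
    EqOn r r' (Icc 0 d.T) ∧ EqOn w w' (Icc 0 d.T) := by
  obtain ⟨α, hα, hval⟩ := ha
  refine IsClassicalSolution.eqOn_of_dissipative d.T_pos h h' fun t ht x hx => ?_
  rw [derivVal_eq_deriv hmM hα.differentiable hval (hv t ht x hx)]
  have h1 := K.a₀_pos.le.trans (hα.le_deriv (val (u t) x))
  nlinarith [mul_nonneg h1 (sq_nonneg (val (w t) x - val (w' t) x))]

theorem IsSensitivity.add_smul (hmM : m < M) {a b b' : Sobolev 2 m M}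
    {u r w r' w' : ℝ → Sobolev 1 0 1} (hv : TakesValuesIn d m M u)
    (h : IsSensitivity d a b u r w) (h' : IsSensitivity d a b' u r' w') (c : ℝ) :
    IsSensitivity d a (b + c • b') u (fun t => r t + c • r' t) (fun t => w t + c • w' t) := by
  have key := (IsClassicalSolution.add_smul d.T_pos h h' c).congr
    (f' := fun t x => -derivVal a (val (u t) x) * val (w t + c • w' t) x
      - val (b + c • b') (val (u t) x)) fun t ht => by
    filter_upwards [ae_restrict_mem measurableSet_Ioo] with x hx
    have hx' := Ioo_subset_Icc_self hx
    rw [val_add_smul₂ hmM _ _ _ (hv t ht x hx'), val_add hx', val_smul _ hx']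
    ring
  simpa [IsSensitivity] using key

end FluxBounds

/-! ### Estimates for the forward operator -/

section Estimates

variable {d : Data} {K : Bounds} {m M : ℝ} {γ₀ γ₁ γ₀' γ₁' : ℝ → ℝ} {C : ℝ}

/-- `C` bounds the norm of the embedding of `H²(m,M)` in `C¹([m,M])`. -/
def IsEmbeddingBound (m M C : ℝ) : Prop := ∀ b : Sobolev 2 m M, ∀ ξ ∈ Icc m M,
  |val b ξ| ≤ C * ‖b‖ ∧ |derivVal b ξ| ≤ C * ‖b‖

/-- The solution of the state system for the restriction `a` of the damping law `α`, with values
in `[m,M]`. -/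
structure MildStateFor (d : Data) (K : Bounds) {m M : ℝ} (γ₀ γ₁ γ₀' γ₁' : ℝ → ℝ) (a : Sobolev 2 m M)
    (α : ℝ → ℝ) (p u : ℝ → Sobolev 1 0 1) (f : ℝ → L2 0 1) : Prop
    extends MildState d γ₀ γ₁ γ₀' γ₁' α p u f where
  law : IsDampingLaw K α
  val_eq : ∀ ξ ∈ Icc m M, val a ξ = α ξ
  stateFor : IsStateFor d a p u

theorem exists_mildStateFor (hfb : AreFluxBounds d K m M) {γ₀'' γ₁'' : ℝ → ℝ}
    (hγ : BoundaryExt d γ₀ γ₁ γ₀' γ₁' γ₀'' γ₁'') {a : Sobolev 2 m M} (ha : a ∈ domF K m M) :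
    ∃ α p u f, MildStateFor d K γ₀ γ₁ γ₀' γ₁' a α p u f := by
  obtain ⟨α, hα, hv⟩ := ha
  obtain ⟨p, u, f, h⟩ := exists_mildState hα hγ
  exact ⟨α, p, u, f, h, hα, hv, (isStateFor_iff hfb hα hv).2 h.state⟩

namespace MildStateFor

variable {a a' : Sobolev 2 m M} {α α' : ℝ → ℝ} {p u p' u' : ℝ → Sobolev 1 0 1}
  {f f' : ℝ → L2 0 1}

theorem derivVal_eq (h : MildStateFor d K γ₀ γ₁ γ₀' γ₁' a α p u f) (hmM : m < M) {ξ : ℝ}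
    (hξ : ξ ∈ Icc m M) : derivVal a ξ = deriv α ξ :=
  derivVal_eq_deriv hmM h.law.differentiable h.val_eq hξ

theorem law_eq (h : MildStateFor d K γ₀ γ₁ γ₀' γ₁' a α p u f)
    (h' : MildStateFor d K γ₀ γ₁ γ₀' γ₁' a' α' p' u' f') (hmM : m < M) {ξ : ℝ}
    (hξ : ξ ∈ Icc m M) : α' ξ = α ξ + val (a' - a) ξ := by
  rw [val_sub₂ hmM _ _ hξ, h.val_eq ξ hξ, h'.val_eq ξ hξ]
  ring

theorem abs_val_flux_sub_le (h : MildStateFor d K γ₀ γ₁ γ₀' γ₁' a α p u f)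
    (h' : MildStateFor d K γ₀ γ₁ γ₀' γ₁' a' α' p' u' f') (hmM : m < M)
    (hC : IsEmbeddingBound m M C) (hC0 : 0 ≤ C) {t : ℝ} (ht : t ∈ Icc 0 d.T) {x : ℝ}
    (hx : x ∈ Icc (0 : ℝ) 1) :
    |val (u' t) x - val (u t) x| ≤ C * ‖a' - a‖ * gronwallConst K.a₁ d.T := by
  obtain ⟨k, hk⟩ := h.exists_aebdd
  obtain ⟨k', hk'⟩ := h'.exists_aebdd
  have est := (h'.mild.sub h.mild).estimate (T := d.T) K.a₁_pos (B := C * ‖a' - a‖) (by positivity)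
    (fun t ht => aebdd_add_neg_smul (hk' t ht) (hk t ht)) (fun t ht => by
      filter_upwards [h.source t ht, h'.source t ht, Lp.coeFn_sub (f' t) (f t),
        ae_restrict_mem measurableSet_Ioo] with x h1 h2 h3 h4
      have hx := Ioo_subset_Icc_self h4
      have hv' := h'.stateFor.2 t ht x hx
      rw [h3, Pi.sub_apply, h1, h2, val_add_neg_smul _ _ hx, law_eq h h' hmM hv']
      have k1 := h.law.abs_sub_le (val (u t) x) (val (u' t) x)
      have k2 := (hC (a' - a) _ hv').1
      rw [abs_le] at k1 k2 ⊢
      constructor <;> linarith [k1.1, k1.2, k2.1, k2.2]) ht hx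
  have := est.1
  rwa [val_add_neg_smul _ _ hx] at this

end MildStateFor

namespace MildSensitivity

variable {a a' b : Sobolev 2 m M} {α α' : ℝ → ℝ} {p u p' u' r w r' w' : ℝ → Sobolev 1 0 1}
  {f f' F F' : ℝ → L2 0 1}

theorem estimate (hs : MildSensitivity d a b u r w F)
    (h : MildStateFor d K γ₀ γ₁ γ₀' γ₁' a α p u f) (hmM : m < M)
    (hC : IsEmbeddingBound m M C) (hC0 : 0 ≤ C) {t : ℝ} (ht : t ∈ Icc 0 d.T) {x : ℝ}
    (hx : x ∈ Icc (0 : ℝ) 1) :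
    |val (w t) x| ≤ C * ‖b‖ * gronwallConst K.a₁ d.T ∧
      |val (r t) x| ≤ C * ‖b‖ * gronwallConst K.a₁ d.T := by
  obtain ⟨k, hk⟩ := hs.exists_aebdd
  refine hs.mild.estimate (T := d.T) K.a₁_pos (B := C * ‖b‖) (by positivity) hk
    (fun t ht => ?_) ht hx
  filter_upwards [hs.source t ht, ae_restrict_mem measurableSet_Ioo] with x h1 h2
  have hv := h.stateFor.2 t ht x (Ioo_subset_Icc_self h2)
  rw [h1, h.derivVal_eq hmM hv]
  refine (abs_sub _ _).trans (add_le_add ?_ (hC b _ hv).1)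
  rw [abs_mul, abs_neg]
  exact mul_le_mul_of_nonneg_right (h.law.abs_deriv_le _) (abs_nonneg _)

theorem abs_remainder_le (hs : MildSensitivity d a (a' - a) u r w F)
    (h : MildStateFor d K γ₀ γ₁ γ₀' γ₁' a α p u f)
    (h' : MildStateFor d K γ₀ γ₁ γ₀' γ₁' a' α' p' u' f') (hmM : m < M)
    (hC : IsEmbeddingBound m M C) (hC0 : 0 ≤ C) {t : ℝ} (ht : t ∈ Icc 0 d.T) {x : ℝ}
    (hx : x ∈ Icc (0 : ℝ) 1) :
    |val (p' t + (-1 : ℝ) • p t + (-1 : ℝ) • r t) x|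
      ≤ (K.a₂ * (C * ‖a' - a‖ * gronwallConst K.a₁ d.T) ^ 2
        + C * ‖a' - a‖ * (C * ‖a' - a‖ * gronwallConst K.a₁ d.T)) * gronwallConst K.a₁ d.T := by
  obtain ⟨k, hk⟩ := h.exists_aebdd
  obtain ⟨k', hk'⟩ := h'.exists_aebdd
  obtain ⟨l, hl⟩ := hs.exists_aebdd
  have hG := gronwallConst_nonneg K.a₁_pos d.T_pos
  have hK2 := K.a₂_pos
  set δ : ℝ := C * ‖a' - a‖ * gronwallConst K.a₁ d.T with hδ
  have hδ0 : 0 ≤ δ := by positivity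
  refine (((h'.mild.sub h.mild).sub hs.mild).estimate (T := d.T) K.a₁_pos
    (B := K.a₂ * δ ^ 2 + C * ‖a' - a‖ * δ) (by positivity)
    (fun t ht => aebdd_add_neg_smul (aebdd_add_neg_smul (hk' t ht) (hk t ht)) (hl t ht))
    (fun t ht => ?_) ht hx).2
  filter_upwards [h.source t ht, h'.source t ht, hs.source t ht, Lp.coeFn_sub (f' t) (f t),
    Lp.coeFn_sub (f' t - f t) (F t), ae_restrict_mem measurableSet_Ioo] with x h1 h2 h3 h4 h5 h6
  have hx := Ioo_subset_Icc_self h6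
  have hv := h.stateFor.2 t ht x hx
  have hv' := h'.stateFor.2 t ht x hx
  have hD := h.abs_val_flux_sub_le h' hmM hC hC0 ht hx
  rw [← hδ] at hD
  rw [h5, Pi.sub_apply, h4, Pi.sub_apply, h1, h2, h3, val_add_neg_smul _ _ hx,
    val_add_neg_smul _ _ hx, h.law_eq h' hmM hv', h.derivVal_eq hmM hv]
  have k1 := h.law.abs_taylor_le (val (u t) x) (val (u' t) x)
  have k2 := abs_val_sub_le hmM (fun ξ hξ => (hC (a' - a) ξ hξ).2) hv hv'
  have k3 : K.a₂ * |val (u' t) x - val (u t) x| ^ 2 ≤ K.a₂ * δ ^ 2 := by gcongr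
  have k4 : C * ‖a' - a‖ * |val (u' t) x - val (u t) x| ≤ C * ‖a' - a‖ * δ := by gcongr
  have k5 : |deriv α (val (u t) x) * (val (u' t) x - val (u t) x - val (w t) x)|
      ≤ K.a₁ * |val (u' t) x - val (u t) x - val (w t) x| := by
    rw [abs_mul]
    exact mul_le_mul_of_nonneg_right (h.law.abs_deriv_le _) (abs_nonneg _)
  rw [abs_le] at k1 k2 k5 ⊢
  constructor <;> linarith [k1.1, k1.2, k2.1, k2.2, k5.1, k5.2]

theorem abs_sub_le (hs : MildSensitivity d a b u r w F) (hs' : MildSensitivity d a' b u' r' w' F')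
    (h : MildStateFor d K γ₀ γ₁ γ₀' γ₁' a α p u f)
    (h' : MildStateFor d K γ₀ γ₁ γ₀' γ₁' a' α' p' u' f') (hmM : m < M)
    (hC : IsEmbeddingBound m M C) (hC0 : 0 ≤ C) {t : ℝ} (ht : t ∈ Icc 0 d.T) {x : ℝ}
    (hx : x ∈ Icc (0 : ℝ) 1) :
    |val (r' t + (-1 : ℝ) • r t) x|
      ≤ ((K.a₂ * (C * ‖a' - a‖ * gronwallConst K.a₁ d.T) + C * ‖a' - a‖)
          * (C * ‖b‖ * gronwallConst K.a₁ d.T)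
        + C * ‖b‖ * (C * ‖a' - a‖ * gronwallConst K.a₁ d.T)) * gronwallConst K.a₁ d.T := by
  obtain ⟨l, hl⟩ := hs.exists_aebdd
  obtain ⟨l', hl'⟩ := hs'.exists_aebdd
  have hG := gronwallConst_nonneg K.a₁_pos d.T_pos
  have hK2 := K.a₂_pos
  set δ : ℝ := C * ‖a' - a‖ * gronwallConst K.a₁ d.T with hδ
  set θ : ℝ := C * ‖b‖ * gronwallConst K.a₁ d.T with hθ
  have hδ0 : 0 ≤ δ := by positivity
  have hθ0 : 0 ≤ θ := by positivity
  refine ((hs'.mild.sub hs.mild).estimate (T := d.T) K.a₁_pos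
    (B := (K.a₂ * δ + C * ‖a' - a‖) * θ + C * ‖b‖ * δ) (by positivity)
    (fun t ht => aebdd_add_neg_smul (hl' t ht) (hl t ht)) (fun t ht => ?_) ht hx).2
  filter_upwards [hs.source t ht, hs'.source t ht, Lp.coeFn_sub (F' t) (F t),
    ae_restrict_mem measurableSet_Ioo] with x h1 h2 h3 h4
  have hx := Ioo_subset_Icc_self h4
  have hv := h.stateFor.2 t ht x hx
  have hv' := h'.stateFor.2 t ht x hx
  have hD := h.abs_val_flux_sub_le h' hmM hC hC0 ht hx
  have hw' := (hs'.estimate h' hmM hC hC0 ht hx).1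
  rw [← hδ] at hD
  rw [← hθ] at hw'
  rw [h3, Pi.sub_apply, h1, h2, val_add_neg_smul _ _ hx, h.derivVal_eq hmM hv]
  have e1 : derivVal a' (val (u' t) x) = deriv α (val (u' t) x)
      + derivVal (a' - a) (val (u' t) x) := by
    rw [derivVal_sub₂ hmM _ _ hv', h.derivVal_eq hmM hv']
    ring
  have k1 : |derivVal a' (val (u' t) x) - deriv α (val (u t) x)|
      ≤ K.a₂ * δ + C * ‖a' - a‖ := by
    have c1 := h.law.abs_deriv_sub_le (val (u t) x) (val (u' t) x)
    have c2 := (hC (a' - a) _ hv').2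
    have c3 : K.a₂ * |val (u' t) x - val (u t) x| ≤ K.a₂ * δ := by gcongr
    rw [e1]
    rw [abs_le] at c1 c2 ⊢
    constructor <;> linarith [c1.1, c1.2, c2.1, c2.2]
  have k2 := abs_val_sub_le hmM (fun ξ hξ => (hC b ξ hξ).2) hv hv'
  have k3 : C * ‖b‖ * |val (u' t) x - val (u t) x| ≤ C * ‖b‖ * δ := by gcongr
  have k4 : |(derivVal a' (val (u' t) x) - deriv α (val (u t) x)) * val (w' t) x|
      ≤ (K.a₂ * δ + C * ‖a' - a‖) * θ := by
    rw [abs_mul]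
    exact mul_le_mul k1 hw' (abs_nonneg _) (by positivity)
  have k5 : |deriv α (val (u t) x) * (val (w' t) x - val (w t) x)|
      ≤ K.a₁ * |val (w' t) x - val (w t) x| := by
    rw [abs_mul]
    exact mul_le_mul_of_nonneg_right (h.law.abs_deriv_le _) (abs_nonneg _)
  rw [abs_le] at k2 k4 k5 ⊢
  constructor <;> linarith [k2.1, k2.2, k4.1, k4.2, k5.1, k5.2]

end MildSensitivity

/-! ### The derivative of the forward operator -/

/-- `h` is the pressure drop of the solution of the sensitivity system at `a` in direction `b`. -/
def IsSensitivityDrop (d : Data) (a b : Sobolev 2 m M) (h : L2 0 d.T) : Prop :=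
  ∃ p u r w, IsStateFor d a p u ∧ IsSensitivity d a b u r w ∧ IsPressureDrop r h

theorem IsSensitivityDrop.isPressureDrop (hmM : m < M) (hfb : AreFluxBounds d K m M)
    {a b : Sobolev 2 m M} (ha : a ∈ domF K m M) {h : L2 0 d.T} (hh : IsSensitivityDrop d a b h)
    {p u r w : ℝ → Sobolev 1 0 1} (hs : IsStateFor d a p u) (hr : IsSensitivity d a b u r w) :
    IsPressureDrop r h := by
  obtain ⟨p', u', r', w', h1, h2, h3⟩ := hh
  exact h3.congr ((h2.congr_flux (h1.unique hfb ha hs).2).unique hmM ha hs.2 hr).1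

theorem exists_isSensitivityDrop (hmM : m < M) (hfb : AreFluxBounds d K m M)
    {a : Sobolev 2 m M} (ha : a ∈ domF K m M) (b : Sobolev 2 m M) :
    ∃ h, IsSensitivityDrop d a b h := by
  obtain ⟨_, _, _, _, _, _, hγ⟩ := exists_boundaryExt d
  obtain ⟨α, p, u, f, h⟩ := exists_mildStateFor hfb hγ ha
  obtain ⟨r, w, F, hs⟩ := exists_mildSensitivity hmM h.law h.val_eq h.toMildState h.stateFor.2 b
  obtain ⟨y, hy⟩ := exists_pressureDrop hs.sensitivity.continuousOn_p
  exact ⟨y, p, u, r, w, h.stateFor, hs.sensitivity, hy⟩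

theorem IsSensitivityDrop.add_smul (hmM : m < M) (hfb : AreFluxBounds d K m M)
    {a b b' : Sobolev 2 m M} (ha : a ∈ domF K m M) {h h' : L2 0 d.T}
    (hh : IsSensitivityDrop d a b h) (hh' : IsSensitivityDrop d a b' h') (c : ℝ) :
    IsSensitivityDrop d a (b + c • b') (h + c • h') := by
  obtain ⟨p, u, r, w, h1, h2, h3⟩ := hh
  obtain ⟨p', u', r', w', h1', h2', h3'⟩ := hh'
  exact ⟨p, u, _, _, h1, h2.add_smul hmM h1.2 (h2'.congr_flux (h1'.unique hfb ha h1).2) c,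
    h3.add_smul h3' c⟩

theorem IsSensitivityDrop.norm_le (hmM : m < M) (hfb : AreFluxBounds d K m M)
    (hC : IsEmbeddingBound m M C) (hC0 : 0 ≤ C) {a b : Sobolev 2 m M} (ha : a ∈ domF K m M)
    {h : L2 0 d.T} (hh : IsSensitivityDrop d a b h) :
    ‖h‖ ≤ √d.T * (2 * (C * gronwallConst K.a₁ d.T)) * ‖b‖ := by
  obtain ⟨_, _, _, _, _, _, hγ⟩ := exists_boundaryExt d
  obtain ⟨α, p, u, f, h⟩ := exists_mildStateFor hfb hγ ha
  obtain ⟨r, w, F, hs⟩ := exists_mildSensitivity hmM h.law h.val_eq h.toMildState h.stateFor.2 b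
  refine ((hh.isPressureDrop hmM hfb ha h.stateFor hs.sensitivity).norm_le d.T_pos
    fun t ht x hx => (hs.estimate h hmM hC hC0 ht hx).2).trans_eq ?_
  ring

theorem IsSensitivityDrop.unique (hmM : m < M) (hfb : AreFluxBounds d K m M)
    {a b : Sobolev 2 m M} (ha : a ∈ domF K m M) {h h' : L2 0 d.T}
    (hh : IsSensitivityDrop d a b h) (hh' : IsSensitivityDrop d a b h') : h = h' := by
  obtain ⟨p, u, r, w, h1, h2, h3⟩ := hh
  exact h3.unique (hh'.isPressureDrop hmM hfb ha h1 h2)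

theorem exists_sensitivityOp (hmM : m < M) (hfb : AreFluxBounds d K m M)
    {a : Sobolev 2 m M} (ha : a ∈ domF K m M) :
    ∃ S : Sobolev 2 m M →L[ℝ] L2 0 d.T, ∀ b, IsSensitivityDrop d a b (S b) := by
  obtain ⟨C, hC0, hC⟩ := exists_H2_bound hmM
  choose S hS using exists_isSensitivityDrop hmM hfb ha
  have hnorm : ∀ b, ‖S b‖ ≤ √d.T * (2 * (C * gronwallConst K.a₁ d.T)) * ‖b‖ := fun b =>
    (hS b).norm_le hmM hfb hC hC0 ha
  have hadd : ∀ b b' (c : ℝ), S (b + c • b') = S b + c • S b' := fun b b' c =>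
    (hS _).unique hmM hfb ha ((hS b).add_smul hmM hfb ha (hS b') c)
  have h0 : S 0 = 0 := norm_le_zero_iff.1 (by simpa using hnorm 0)
  let L : Sobolev 2 m M →ₗ[ℝ] L2 0 d.T :=
    { toFun := S
      map_add' := fun b b' => by simpa using hadd b b' 1
      map_smul' := fun c b => by simpa [h0] using hadd 0 b c }
  exact ⟨L.mkContinuous _ hnorm, hS⟩

theorem exists_norm_remainder_le (hmM : m < M) (hfb : AreFluxBounds d K m M) :
    ∃ Q, ∀ a ∈ domF K m M, ∀ a' ∈ domF K m M, ∀ h, IsSensitivityDrop d a (a' - a) h →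
      ‖forwardOp d m M a' - forwardOp d m M a - h‖ ≤ Q * ‖a' - a‖ ^ 2 := by
  obtain ⟨C, hC0, hC⟩ := exists_H2_bound hmM
  obtain ⟨_, _, _, _, _, _, hγ⟩ := exists_boundaryExt d
  set G := gronwallConst K.a₁ d.T with hG
  refine ⟨√d.T * (2 * ((K.a₂ * (C * G) ^ 2 + C * (C * G)) * G)), fun a ha a' ha' y hy => ?_⟩
  obtain ⟨α, p, u, f, h⟩ := exists_mildStateFor hfb hγ ha
  obtain ⟨α', p', u', f', h'⟩ := exists_mildStateFor hfb hγ ha'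
  obtain ⟨r, w, F, hs⟩ := exists_mildSensitivity hmM h.law h.val_eq h.toMildState h.stateFor.2
    (a' - a)
  have hd := ((isPressureDrop_forwardOp hfb ha' h'.stateFor).add_smul
    (isPressureDrop_forwardOp hfb ha h.stateFor) (-1)).add_smul
    (hy.isPressureDrop hmM hfb ha h.stateFor hs.sensitivity) (-1)
  have := hd.norm_le d.T_pos fun t ht x hx => hs.abs_remainder_le h h' hmM hC hC0 ht hx
  rw [neg_one_smul, neg_one_smul, ← sub_eq_add_neg, ← sub_eq_add_neg] at this
  refine this.trans_eq ?_
  ring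

theorem exists_norm_sub_le (hmM : m < M) (hfb : AreFluxBounds d K m M) :
    ∃ Q, 0 ≤ Q ∧ ∀ a ∈ domF K m M, ∀ a' ∈ domF K m M, ∀ b h h', IsSensitivityDrop d a b h →
      IsSensitivityDrop d a' b h' → ‖h - h'‖ ≤ Q * ‖a - a'‖ * ‖b‖ := by
  obtain ⟨C, hC0, hC⟩ := exists_H2_bound hmM
  obtain ⟨_, _, _, _, _, _, hγ⟩ := exists_boundaryExt d
  have hG0 := gronwallConst_nonneg K.a₁_pos d.T_pos
  have hK2 := K.a₂_pos
  set G := gronwallConst K.a₁ d.T with hG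
  refine ⟨√d.T * (2 * (((K.a₂ * (C * G) + C) * (C * G) + C * (C * G)) * G)), by positivity,
    fun a ha a' ha' b y y' hy hy' => ?_⟩
  obtain ⟨α, p, u, f, h⟩ := exists_mildStateFor hfb hγ ha
  obtain ⟨α', p', u', f', h'⟩ := exists_mildStateFor hfb hγ ha'
  obtain ⟨r, w, F, hs⟩ := exists_mildSensitivity hmM h.law h.val_eq h.toMildState h.stateFor.2 b
  obtain ⟨r', w', F', hs'⟩ := exists_mildSensitivity hmM h'.law h'.val_eq h'.toMildState
    h'.stateFor.2 b
  have hd := (hy.isPressureDrop hmM hfb ha h.stateFor hs.sensitivity).add_smul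
    (hy'.isPressureDrop hmM hfb ha' h'.stateFor hs'.sensitivity) (-1)
  have := hd.norm_le d.T_pos fun t ht x hx => hs'.abs_sub_le hs h' h hmM hC hC0 ht hx
  rw [neg_one_smul, ← sub_eq_add_neg] at this
  refine this.trans_eq ?_
  ring

end Estimates

end DampedWave

end

theorem mainTheorem4 (d : Data) (K : Bounds) :
    (∃ m M : ℝ, m < M ∧ AreFluxBounds d K m M) ∧
    ∀ m M : ℝ, m < M → AreFluxBounds d K m M →
      (∀ a ∈ domF K m M, ∃ p u : ℝ → Sobolev 1 0 1, IsStateFor d a p u ∧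
        (∀ p' u', IsStateFor d a p' u' → EqOn p' p (Icc 0 d.T) ∧ EqOn u' u (Icc 0 d.T)) ∧
        IsPressureDrop p (forwardOp d m M a)) ∧
      ∃ F' : Sobolev 2 m M → (Sobolev 2 m M →L[ℝ] L2 0 d.T),
        (∀ a ∈ domF K m M, HasFDerivWithinAt (forwardOp d m M) (F' a) (domF K m M) a) ∧
        (∀ a ∈ domF K m M, ∀ p u, IsStateFor d a p u → ∀ b : Sobolev 2 m M,
          ∃ r w : ℝ → Sobolev 1 0 1, IsSensitivity d a b u r w ∧
            (∀ r' w', IsSensitivity d a b u r' w' →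
              EqOn r' r (Icc 0 d.T) ∧ EqOn w' w (Icc 0 d.T)) ∧
            IsPressureDrop r (F' a b)) ∧
        ∃ L : ℝ, 0 ≤ L ∧ ∀ a ∈ domF K m M, ∀ a' ∈ domF K m M, ‖F' a - F' a'‖ ≤ L * ‖a - a'‖ := by
  refine ⟨exists_fluxBounds d K, fun m M hmM hfb => ⟨fun a ha => ?_, ?_⟩⟩
  · obtain ⟨_, _, _, _, _, _, hγ⟩ := exists_boundaryExt d
    obtain ⟨α, p, u, f, h⟩ := exists_mildStateFor hfb hγ ha
    exact ⟨p, u, h.stateFor, fun p' u' h' => h'.unique hfb ha h.stateFor,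
      isPressureDrop_forwardOp hfb ha h.stateFor⟩
  classical
  choose S hS using fun (a : Sobolev 2 m M) (ha : a ∈ domF K m M) =>
    exists_sensitivityOp hmM hfb ha
  set F' : Sobolev 2 m M → (Sobolev 2 m M →L[ℝ] L2 0 d.T) := fun a =>
    if ha : a ∈ domF K m M then S a ha else 0 with hF'
  have hdrop : ∀ a ∈ domF K m M, ∀ b, IsSensitivityDrop d a b (F' a b) := fun a ha b => by
    simp only [hF', dif_pos ha]
    exact hS a ha b
  refine ⟨F', fun a ha => ?_, fun a ha p u hpu b => ?_, ?_⟩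
  · obtain ⟨Q, hQ⟩ := exists_norm_remainder_le hmM hfb
    refine HasFDerivWithinAt.of_isLittleO (Asymptotics.IsLittleO.of_bound fun ε hε => ?_)
    have hsmall : ∀ᶠ a' in 𝓝[domF K m M] a, Q * ‖a' - a‖ < ε := by
      have hc : Continuous fun a' : Sobolev 2 m M => Q * ‖a' - a‖ := by fun_prop
      have ht := hc.tendsto a
      rw [sub_self, norm_zero, mul_zero] at ht
      exact nhdsWithin_le_nhds (ht.eventually (gt_mem_nhds hε))
    filter_upwards [hsmall, self_mem_nhdsWithin] with a' h1 h2
    refine (hQ a ha a' h2 _ (hdrop a ha (a' - a))).trans ?_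
    rw [pow_two, ← mul_assoc]
    exact mul_le_mul_of_nonneg_right h1.le (norm_nonneg _)
  · obtain ⟨_, _, _, _, _, _, hγ⟩ := exists_boundaryExt d
    obtain ⟨α, p', u', f, h⟩ := exists_mildStateFor hfb hγ ha
    obtain ⟨r, w, F, hs⟩ := exists_mildSensitivity hmM h.law h.val_eq h.toMildState
      h.stateFor.2 b
    have hsens := hs.sensitivity.congr_flux (h.stateFor.unique hfb ha hpu).2
    exact ⟨r, w, hsens, fun r' w' hs' => hs'.unique hmM ha hpu.2 hsens,
      (hdrop a ha b).isPressureDrop hmM hfb ha hpu hsens⟩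
  · obtain ⟨Q, hQ0, hQ⟩ := exists_norm_sub_le hmM hfb
    exact ⟨Q, hQ0, fun a ha a' ha' => ContinuousLinearMap.opNorm_le_bound _ (by positivity)
      fun b => hQ a ha a' ha' b _ _ (hdrop a ha b) (hdrop a' ha' b)⟩
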